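/- Let $\mathcal H_0$ be the $\mathbb C$-linear monoidal category generated by two objects $\mathsf P$ (an upward strand) and $\mathsf Q$ (a downward strand). Its morphisms are generated by the crossing $\mathsf P\mathsf P\to\mathsf P\mathsf P$ of two upward strands and by the four oriented cups and caps $1\to\mathsf Q\mathsf P$, $\mathsf Q\mathsf P\to 1$, $1\to\mathsf P\mathsf Q$, $\mathsf P\mathsf Q\to 1$. Diagrams are read from bottom to top and taken up to planar isotopy (the four zigzag identities hold, and the two half turns of the crossing agree). They are subject to the following local relations: 1. the crossing squares to the identity of $\mathsf P\mathsf P$ and satisfies the braid relation on $\mathsf P\mathsf P\mathsf P$; 2. for the crossings $\mathsf Q\mathsf P\to\mathsf P\mathsf Q$ and $\mathsf P\mathsf Q\to\mathsf Q\mathsf P$ obtained from the upward crossing by quarter turns, the composite $\mathsf Q\mathsf P\to\mathsf P\mathsf Q\to\mathsf Q\mathsf P$ equals $\mathrm{id}_{\mathsf Q\mathsf P}-(\mathsf Q\mathsf P\to 1\to\mathsf Q\mathsf P)$, where the last map is the cap followed by the cup, and the composite $\mathsf P\mathsf Q\to\mathsf Q\mathsf P\to\mathsf P\mathsf Q$ equals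 $\mathrm{id}_{\mathsf P\mathsf Q}$; 3. a counterclockwise circle equals $1$, and an upward strand with a curl on its left equals $0$. Let $\mathcal H'$ be the additive closure of $\mathcal H_0$ (formal finite direct sums), and let Khovanov's Heisenberg category $\mathcal H$ be the Karoubi envelope of $\mathcal H'$, with the induced monoidal structure. Let $$\operatorname{Tr}(\mathcal H)=\Big(\bigoplus_{X\in\operatorname{Ob}\mathcal H}\operatorname{End}_{\mathcal H}(X)\Big)\Big/\operatorname{Span}_{\mathbb C}\{fg-gf \;:\; f\colon X\to Y,\ g\colon Y\to X\},$$ a unital associative $\mathbb C$-algebra with product $[f][g]=[f\otimes g]$ and unit $[\mathrm{id}_{1}]$. Put $h_1\otimes 1=[\mathrm{id}_{\mathsf P}]$ and $h_{-1}\otimes 1=[\mathrm{id}_{\mathsf Q}]$. A dot on an upward strand denotes a curl on its right. For $n\ge 0$ let $c_n$ be the class of the endomorphism of the unit object given by a clockwise circle carrying $n$ dots. **Lemma.** The $\mathbb C$-algebra $\operatorname{Tr}(\mathcal H)$ is generated by the three elements $h_{-1}\otimes 1$, $h_1\otimes 1$ and $c_0+c_1$. -/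

import Mathlib

noncomputable section

open CategoryTheory MonoidalCategory

/-! ## The trace (zeroth Hochschild homology) of a `ℂ`-linear category -/

section Trace

universe v u

variable (C : Type u) [Category.{v} C] [Preadditive C] [Linear ℂ C]

/-- The space `⨁_X End(X)`, the sum being over all objects of `C`. -/
abbrev EndSum : Type (max u v) := DirectSum C (fun X : C => (X ⟶ X))

variable {C}

open scoped Classical in
/-- The inclusion of `End(X)` in `⨁_X End(X)`. -/
def endIncl (X : C) : (X ⟶ X) →ₗ[ℂ] EndSum C :=
  DirectSum.lof ℂ C (fun X : C => (X ⟶ X)) X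

variable (C)

/-- The span of all `f g - g f`, for `f : X ⟶ Y` and `g : Y ⟶ X`. -/
def commutatorSpan : Submodule ℂ (EndSum C) :=
  Submodule.span ℂ {x | ∃ (X Y : C) (f : X ⟶ Y) (g : Y ⟶ X),
    x = endIncl X (f ≫ g) - endIncl Y (g ≫ f)}

/-- The trace `Tr(C)` of a `ℂ`-linear category. -/
def CatTrace : Type (max u v) := EndSum C ⧸ commutatorSpan C

instance : AddCommGroup (CatTrace C) :=
  inferInstanceAs (AddCommGroup (EndSum C ⧸ commutatorSpan C))

instance : Module ℂ (CatTrace C) :=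
  inferInstanceAs (Module ℂ (EndSum C ⧸ commutatorSpan C))

variable {C}

/-- The class `[f]` of an endomorphism in the trace, as a linear map. -/
def trClassLin (X : C) : (X ⟶ X) →ₗ[ℂ] CatTrace C :=
  (commutatorSpan C).mkQ ∘ₗ endIncl X

/-- The class `[f]` in `Tr(C)` of an endomorphism `f`. -/
def trClass {X : C} (f : X ⟶ X) : CatTrace C := trClassLin X f

theorem trClass_comm {X Y : C} (f : X ⟶ Y) (g : Y ⟶ X) :
    trClass (f ≫ g) = trClass (g ≫ f) := by
  refine (Submodule.Quotient.eq (commutatorSpan C)).2 ?_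
  exact Submodule.subset_span ⟨X, Y, f, g, rfl⟩

theorem trClass_conj {X Y : C} (i : X ≅ Y) (f : X ⟶ X) (g : Y ⟶ Y)
    (h : f ≫ i.hom = i.hom ≫ g) : trClass f = trClass g := by
  have h1 : f = i.hom ≫ (g ≫ i.inv) := by
    rw [← Category.assoc, ← h]; simp
  rw [h1, trClass_comm]; simp

theorem catTrace_induction {p : CatTrace C → Prop}
    (h0 : p 0) (hadd : ∀ x y, p x → p y → p (x + y))
    (hc : ∀ (X : C) (f : X ⟶ X), p (trClass f)) (x : CatTrace C) : p x := by
  classical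
  obtain ⟨y, rfl⟩ := Submodule.mkQ_surjective (commutatorSpan C) x
  induction y using DirectSum.induction_on with
  | zero => rw [map_zero]; exact h0
  | of X f => exact hc X f
  | add a b ha hb => rw [map_add]; exact hadd _ _ ha hb

/-- A family of linear maps on the spaces `End(X)` that is insensitive to the order of composition
factors through the trace. -/
def trLift {M : Type*} [AddCommGroup M] [Module ℂ M] (φ : ∀ X : C, (X ⟶ X) →ₗ[ℂ] M)
    (h : ∀ (X Y : C) (f : X ⟶ Y) (g : Y ⟶ X), φ X (f ≫ g) = φ Y (g ≫ f)) :
    CatTrace C →ₗ[ℂ] M :=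
  (commutatorSpan C).liftQ
    (open scoped Classical in DirectSum.toModule ℂ C M φ) (by
      classical
      refine Submodule.span_le.2 ?_
      rintro _ ⟨X, Y, f, g, rfl⟩
      simp only [SetLike.mem_coe, LinearMap.mem_ker, map_sub, endIncl]
      erw [DirectSum.toModule_lof, DirectSum.toModule_lof]
      rw [h, sub_self])

theorem trLift_trClass {M : Type*} [AddCommGroup M] [Module ℂ M] (φ : ∀ X : C, (X ⟶ X) →ₗ[ℂ] M)
    (h : ∀ (X Y : C) (f : X ⟶ Y) (g : Y ⟶ X), φ X (f ≫ g) = φ Y (g ≫ f))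
    {X : C} (f : X ⟶ X) : trLift φ h (trClass f) = φ X f := by
  classical
  unfold trLift trClass trClassLin endIncl
  erw [Submodule.liftQ_apply, DirectSum.toModule_lof]

variable [MonoidalCategory C] [MonoidalPreadditive C] [MonoidalLinear ℂ C]

set_option linter.unusedSectionVars false

/-- The bilinear map `(f, g) ↦ [f ⊗ g]`. -/
def trTensor (X Y : C) : (X ⟶ X) →ₗ[ℂ] (Y ⟶ Y) →ₗ[ℂ] CatTrace C :=
  LinearMap.mk₂ ℂ (fun f g => trClassLin (X ⊗ Y) (f ⊗ₘ g))
    (fun f f' g => by rw [MonoidalPreadditive.add_tensor, map_add])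
    (fun c f g => by
      rw [← map_smul]; congr 1; simp [MonoidalCategory.tensorHom_def])
    (fun f g g' => by rw [MonoidalPreadditive.tensor_add, map_add])
    (fun c f g => by
      rw [← map_smul]; congr 1; simp [MonoidalCategory.tensorHom_def])

/-- The product `[f] [g] := [f ⊗ g]` on the trace of a monoidal `ℂ`-linear category. -/
def trMul : CatTrace C →ₗ[ℂ] CatTrace C →ₗ[ℂ] CatTrace C :=
  trLift
    (fun X => LinearMap.flip (trLift (fun Y => (trTensor X Y).flip) (by
      intro Y Z f g
      ext e
      change trClass (e ⊗ₘ (f ≫ g)) = trClass (e ⊗ₘ (g ≫ f))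
      have h1 : (e ⊗ₘ (f ≫ g)) = (e ⊗ₘ f) ≫ (𝟙 X ⊗ₘ g) := by
        rw [tensorHom_comp_tensorHom, Category.comp_id]
      have h2 : (e ⊗ₘ (g ≫ f)) = (𝟙 X ⊗ₘ g) ≫ (e ⊗ₘ f) := by
        rw [tensorHom_comp_tensorHom, Category.id_comp]
      rw [h1, h2, trClass_comm])))
    (by
      intro X Y f g
      ext y
      refine catTrace_induction (p := fun y => _ = _) ?_ ?_ ?_ y
      · simp
      · intro a b ha hb
        rw [map_add, map_add, ha, hb]
      · intro Z e
        simp only [LinearMap.flip_apply, trLift_trClass]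
        change trClass ((f ≫ g) ⊗ₘ e) = trClass ((g ≫ f) ⊗ₘ e)
        have h1 : ((f ≫ g) ⊗ₘ e) = (f ⊗ₘ e) ≫ (g ⊗ₘ 𝟙 Z) := by
          rw [tensorHom_comp_tensorHom, Category.comp_id]
        have h2 : ((g ≫ f) ⊗ₘ e) = (g ⊗ₘ 𝟙 Z) ≫ (f ⊗ₘ e) := by
          rw [tensorHom_comp_tensorHom, Category.id_comp]
        rw [h1, h2, trClass_comm])

theorem trMul_trClass {X Y : C} (f : X ⟶ X) (g : Y ⟶ Y) :
    trMul (trClass f) (trClass g) = trClass (f ⊗ₘ g) := by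
  unfold trMul
  rw [trLift_trClass, LinearMap.flip_apply, trLift_trClass]
  rfl

theorem trMul_assoc (x y z : CatTrace C) :
    trMul (trMul x y) z = trMul x (trMul y z) := by
  refine catTrace_induction (p := fun x => ∀ y z, trMul (trMul x y) z = trMul x (trMul y z))
    (by simp) (by intro a b ha hb y z; simp [ha, hb]) ?_ x y z
  intro X f y z
  refine catTrace_induction
    (p := fun y => ∀ z, trMul (trMul (trClass f) y) z = trMul (trClass f) (trMul y z))
    (by simp) (by intro a b ha hb z; simp [ha, hb]) ?_ y z
  intro Y g z
  refine catTrace_induction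
    (p := fun z => trMul (trMul (trClass f) (trClass g)) z = trMul (trClass f) (trMul (trClass g) z))
    (by simp) (by intro a b ha hb; simp only [map_add, ha, hb]) ?_ z
  intro Z h
  simp only [trMul_trClass]
  exact trClass_conj (α_ X Y Z) _ _ (associator_naturality f g h)

theorem trMul_one_left (x : CatTrace C) : trMul (trClass (𝟙 (𝟙_ C))) x = x := by
  refine catTrace_induction (p := fun x => trMul (trClass (𝟙 (𝟙_ C))) x = x)
    (by simp) (by intro a b ha hb; simp only [map_add, ha, hb]) ?_ x
  intro X f
  rw [trMul_trClass]
  exact trClass_conj (λ_ X) _ _ (by rw [id_tensorHom, leftUnitor_naturality])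

theorem trMul_one_right (x : CatTrace C) : trMul x (trClass (𝟙 (𝟙_ C))) = x := by
  refine catTrace_induction (p := fun x => trMul x (trClass (𝟙 (𝟙_ C))) = x)
    (by simp) (by intro a b ha hb; simp only [map_add, LinearMap.add_apply, ha, hb]) ?_ x
  intro X f
  rw [trMul_trClass]
  exact trClass_conj (ρ_ X) _ _ (by rw [tensorHom_id, rightUnitor_naturality])

/-- The ring structure on the trace of a monoidal `ℂ`-linear category. -/
instance : Ring (CatTrace C) :=
  { (inferInstance : AddCommGroup (CatTrace C)) with
    mul := fun x y => trMul x y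
    one := trClass (𝟙 (𝟙_ C))
    mul_assoc := trMul_assoc
    one_mul := trMul_one_left
    mul_one := trMul_one_right
    left_distrib := fun x y z => map_add (trMul x) y z
    right_distrib := fun x y z => by
      change trMul (x + y) z = trMul x z + trMul y z
      rw [map_add, LinearMap.add_apply]
    zero_mul := fun x => by
      change trMul 0 x = 0
      rw [map_zero, LinearMap.zero_apply]
    mul_zero := fun x => map_zero (trMul x) }

instance : Algebra ℂ (CatTrace C) :=
  Algebra.ofModule
    (fun r x y => by
      change trMul (r • x) y = r • trMul x y
      rw [map_smul, LinearMap.smul_apply])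
    (fun r x y => map_smul (trMul x) r y)

end Trace

/-! ## The monoidal structure on the additive envelope -/

section MatMonoidal

universe v u

variable {C : Type u} [Category.{v} C] [Preadditive C]

namespace MatEnv

instance [Linear ℂ C] : Linear ℂ (Mat_ C) where
  homModule M N :=
    { smul := fun r f i j => r • f i j
      one_smul := fun f => by ext i j; exact one_smul ℂ (f i j)
      mul_smul := fun a b f => by ext i j; exact mul_smul a b (f i j)
      smul_zero := fun a => by ext i j; exact smul_zero a
      smul_add := fun a f g => by ext i j; exact smul_add a (f i j) (g i j)
      add_smul := fun a b f => by ext i j; exact add_smul a b (f i j)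
      zero_smul := fun f => by ext i j; exact zero_smul ℂ (f i j) }
  smul_comp M N K r f g := by
    ext i j
    change ∑ l, (r • f i l) ≫ g l j = r • ∑ l, f i l ≫ g l j
    simp [Finset.smul_sum]
  comp_smul M N K f r g := by
    ext i j
    change ∑ l, f i l ≫ (r • g l j) = r • ∑ l, f i l ≫ g l j
    simp [Finset.smul_sum]

open scoped Classical in
/-- The matrix with entries `φ i` at the positions `(i, e i)` and zeros elsewhere. -/
def mono {M N : Mat_ C} (e : M.ι → N.ι) (φ : ∀ i, M.X i ⟶ N.X (e i)) : M ⟶ N :=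
  fun i j => if h : e i = j then φ i ≫ eqToHom (congrArg N.X h) else 0

theorem mono_apply {M N : Mat_ C} (e : M.ι → N.ι) (φ : ∀ i, M.X i ⟶ N.X (e i)) (i : M.ι) :
    mono e φ i (e i) = φ i := by
  simp [mono]

theorem mono_apply_ne {M N : Mat_ C} (e : M.ι → N.ι) (φ : ∀ i, M.X i ⟶ N.X (e i)) (i : M.ι)
    (j : N.ι) (h : e i ≠ j) : mono e φ i j = 0 := by
  simp [mono, h]

theorem mono_comp {M N K : Mat_ C} (e : M.ι → N.ι) (φ : ∀ i, M.X i ⟶ N.X (e i)) (g : N ⟶ K)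
    (i : M.ι) (k : K.ι) : (mono e φ ≫ g) i k = φ i ≫ g (e i) k := by
  rw [Mat_.comp_apply, Finset.sum_eq_single (e i)]
  · rw [mono_apply]
  · intro j _ hj
    rw [mono_apply_ne _ _ _ _ hj.symm, Limits.zero_comp]
  · simp

theorem comp_mono {M N K : Mat_ C} (f : K ⟶ M) (e : M.ι → N.ι) (he : Function.Injective e)
    (φ : ∀ i, M.X i ⟶ N.X (e i)) (k : K.ι) (i : M.ι) :
    (f ≫ mono e φ) k (e i) = f k i ≫ φ i := by
  rw [Mat_.comp_apply, Finset.sum_eq_single i]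
  · rw [mono_apply]
  · intro j _ hj
    rw [mono_apply_ne _ _ _ _ (fun h => hj (he h)), Limits.comp_zero]
  · simp

theorem mono_comp_mono {M N K : Mat_ C} (e : M.ι → N.ι) (φ : ∀ i, M.X i ⟶ N.X (e i))
    (e' : N.ι → K.ι) (φ' : ∀ i, N.X i ⟶ K.X (e' i)) :
    mono e φ ≫ mono e' φ' = mono (fun i => e' (e i)) (fun i => φ i ≫ φ' (e i)) := by
  ext i k
  rw [mono_comp]
  by_cases h : e' (e i) = k
  · subst h
    rw [mono_apply, mono_apply (fun i => e' (e i))]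
  · rw [mono_apply_ne _ _ _ _ h, mono_apply_ne (fun i => e' (e i)) _ _ _ h, Limits.comp_zero]

theorem id_eq_mono (M : Mat_ C) : 𝟙 M = mono (fun i => i) (fun i => 𝟙 (M.X i)) := by
  ext i j
  by_cases h : i = j
  · subst h
    rw [Mat_.id_apply_self, mono_apply (fun i => i)]
  · rw [Mat_.id_apply_of_ne _ _ _ h, mono_apply_ne (fun i => i) _ _ _ h]

open scoped Classical in
/-- The inverse of `mono e φ`, for `e` bijective and each `φ i` an isomorphism. -/
def monoInv {M N : Mat_ C} (e : M.ι → N.ι) (φ : ∀ i, M.X i ≅ N.X (e i)) : N ⟶ M :=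
  fun j i => if h : e i = j then eqToHom (congrArg N.X h.symm) ≫ (φ i).inv else 0

theorem monoInv_apply {M N : Mat_ C} (e : M.ι → N.ι) (φ : ∀ i, M.X i ≅ N.X (e i)) (i : M.ι) :
    monoInv e φ (e i) i = (φ i).inv := by
  simp [monoInv]

theorem monoInv_apply_ne {M N : Mat_ C} (e : M.ι → N.ι) (φ : ∀ i, M.X i ≅ N.X (e i))
    (j : N.ι) (i : M.ι) (h : e i ≠ j) : monoInv e φ j i = 0 := by
  simp [monoInv, h]

/-- The isomorphism given by a reindexing and isomorphisms of the entries. -/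
def monoIso {M N : Mat_ C} (e : M.ι → N.ι) (he : Function.Bijective e)
    (φ : ∀ i, M.X i ≅ N.X (e i)) : M ≅ N where
  hom := mono e (fun i => (φ i).hom)
  inv := monoInv e φ
  hom_inv_id := by
    ext i k
    rw [mono_comp]
    by_cases h : i = k
    · subst h; rw [monoInv_apply, Mat_.id_apply_self, Iso.hom_inv_id]
    · rw [Mat_.id_apply_of_ne _ _ _ h, monoInv_apply_ne _ _ _ _ (fun h' => h (he.1 h').symm),
        Limits.comp_zero]
  inv_hom_id := by
    ext j k
    obtain ⟨i, rfl⟩ := he.2 k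
    rw [comp_mono _ _ he.1]
    by_cases h : e i = j
    · subst h; rw [monoInv_apply, Mat_.id_apply_self, Iso.inv_hom_id]
    · rw [Mat_.id_apply_of_ne _ _ _ (Ne.symm h), monoInv_apply_ne _ _ _ _ h, Limits.zero_comp]

variable [MonoidalCategory C] [MonoidalPreadditive C]

set_option linter.unusedSectionVars false

/-- The tensor product of two finite tuples of objects, indexed by pairs. -/
abbrev tObj (M N : Mat_ C) : Mat_ C := ⟨M.ι × N.ι, fun p => M.X p.1 ⊗ N.X p.2⟩

/-- The Kronecker product of two matrices of morphisms. -/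
def tHom {M N M' N' : Mat_ C} (f : M ⟶ M') (g : N ⟶ N') : tObj M N ⟶ tObj M' N' :=
  fun p q => f p.1 q.1 ⊗ₘ g p.2 q.2

theorem tHom_apply {M N M' N' : Mat_ C} (f : M ⟶ M') (g : N ⟶ N') (p : M.ι × N.ι)
    (q : M'.ι × N'.ι) : tHom f g p q = f p.1 q.1 ⊗ₘ g p.2 q.2 := rfl

theorem tHom_mono {M N M' N' : Mat_ C} (e : M.ι → M'.ι) (φ : ∀ i, M.X i ⟶ M'.X (e i))
    (e' : N.ι → N'.ι) (φ' : ∀ i, N.X i ⟶ N'.X (e' i)) :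
    tHom (mono e φ) (mono e' φ') =
      mono (M := tObj M N) (N := tObj M' N') (fun p => (e p.1, e' p.2))
        (fun p => φ p.1 ⊗ₘ φ' p.2) := by
  ext ⟨i, k⟩ ⟨j, l⟩
  refine (tHom_apply _ _ (i, k) (j, l)).trans ?_
  by_cases h1 : e i = j
  · by_cases h2 : e' k = l
    · subst h1 h2
      exact (congrArg₂ (· ⊗ₘ ·) (mono_apply e φ i) (mono_apply e' φ' k)).trans
        (mono_apply (M := tObj M N) (N := tObj M' N') (fun p => (e p.1, e' p.2))
          (fun p => φ p.1 ⊗ₘ φ' p.2) (i, k)).symm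
    · rw [mono_apply_ne (M := tObj M N) (N := tObj M' N') (fun p => (e p.1, e' p.2)) _ (i, k)
        (j, l) (fun h => h2 (congrArg Prod.snd h))]
      change mono e φ i j ⊗ₘ mono e' φ' k l = 0
      rw [mono_apply_ne e' _ _ _ h2, MonoidalPreadditive.tensor_zero]
  · rw [mono_apply_ne (M := tObj M N) (N := tObj M' N') (fun p => (e p.1, e' p.2)) _ (i, k)
        (j, l) (fun h => h1 (congrArg Prod.fst h))]
    change mono e φ i j ⊗ₘ mono e' φ' k l = 0
    rw [mono_apply_ne e _ _ _ h1, MonoidalPreadditive.zero_tensor]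

theorem tHom_id (M N : Mat_ C) : tHom (𝟙 M) (𝟙 N) = 𝟙 (tObj M N) := by
  rw [id_eq_mono M, id_eq_mono N, tHom_mono, id_eq_mono (tObj M N)]
  congr 1
  funext p
  exact id_tensorHom_id _ _

theorem tHom_comp {M M' M'' N N' N'' : Mat_ C} (f : M ⟶ M') (g : N ⟶ N') (f' : M' ⟶ M'')
    (g' : N' ⟶ N'') : tHom f g ≫ tHom f' g' = tHom (f ≫ f') (g ≫ g') := by
  ext p q
  change ∑ r : M'.ι × N'.ι, (f p.1 r.1 ⊗ₘ g p.2 r.2) ≫ (f' r.1 q.1 ⊗ₘ g' r.2 q.2)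
    = (∑ a, f p.1 a ≫ f' a q.1) ⊗ₘ (∑ b, g p.2 b ≫ g' b q.2)
  rw [sum_tensor, Fintype.sum_prod_type]
  refine Finset.sum_congr rfl fun a _ => ?_
  rw [tensor_sum]
  refine Finset.sum_congr rfl fun b _ => ?_
  rw [tensorHom_comp_tensorHom]

instance : MonoidalCategoryStruct (Mat_ C) where
  tensorObj := tObj
  tensorHom f g := tHom f g
  whiskerLeft M _ _ f := tHom (𝟙 M) f
  whiskerRight f N := tHom f (𝟙 N)
  tensorUnit := (Mat_.embedding C).obj (𝟙_ C)
  associator M N K :=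
    monoIso (M := tObj (tObj M N) K) (N := tObj M (tObj N K)) (fun p => (p.1.1, (p.1.2, p.2)))
      (Equiv.prodAssoc M.ι N.ι K.ι).bijective
      (fun p => α_ (M.X p.1.1) (N.X p.1.2) (K.X p.2))
  leftUnitor M :=
    monoIso (M := tObj ((Mat_.embedding C).obj (𝟙_ C)) M) (N := M) (fun p => p.2)
      (Equiv.punitProd M.ι).bijective (fun p => λ_ (M.X p.2))
  rightUnitor M :=
    monoIso (M := tObj M ((Mat_.embedding C).obj (𝟙_ C))) (N := M) (fun p => p.1)
      (Equiv.prodPUnit M.ι).bijective (fun p => ρ_ (M.X p.1))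

/-- The monoidal structure on the additive envelope. -/
instance : MonoidalCategory (Mat_ C) :=
  MonoidalCategory.ofTensorHom
    (id_tensorHom_id := tHom_id)
    (id_tensorHom := fun _ _ _ _ => rfl)
    (tensorHom_id := fun _ _ => rfl)
    (tensorHom_comp_tensorHom := fun f g f' g' => tHom_comp f g f' g')
    (associator_naturality := by
      intro M₁ M₂ M₃ N₁ N₂ N₃ f g h
      refine Mat_.hom_ext _ _ ?_
      rintro ⟨⟨i, j⟩, k⟩ ⟨i', ⟨j', k'⟩⟩
      refine (comp_mono (M := tObj (tObj N₁ N₂) N₃) (N := tObj N₁ (tObj N₂ N₃)) (tHom (tHom f g) h)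
        (fun p => (p.1.1, (p.1.2, p.2)))
        (Equiv.prodAssoc N₁.ι N₂.ι N₃.ι).injective _ ((i, j), k) ((i', j'), k')).trans ?_
      refine Eq.trans ?_ (mono_comp (M := tObj (tObj M₁ M₂) M₃) (N := tObj M₁ (tObj M₂ M₃))
        (fun p => (p.1.1, (p.1.2, p.2))) _ (tHom f (tHom g h)) ((i, j), k) (i', (j', k'))).symm
      exact MonoidalCategory.associator_naturality (f i i') (g j j') (h k k'))
    (leftUnitor_naturality := by
      intro M N f
      refine Mat_.hom_ext _ _ ?_
      rintro ⟨⟨⟩, i⟩ j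
      refine (comp_mono (M := tObj ((Mat_.embedding C).obj (𝟙_ C)) N) (N := N) (tHom (𝟙 _) f)
        (fun p => p.2) (Equiv.punitProd N.ι).injective _ (PUnit.unit, i) (PUnit.unit, j)).trans ?_
      refine Eq.trans ?_ (mono_comp (M := tObj ((Mat_.embedding C).obj (𝟙_ C)) M) (N := M)
        (fun p => p.2) _ f (PUnit.unit, i) j).symm
      refine Eq.trans ?_ (MonoidalCategory.leftUnitor_naturality (f i j))
      rw [← MonoidalCategory.id_tensorHom, tHom_apply, Mat_.id_apply_self]
      rfl)
    (rightUnitor_naturality := by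
      intro M N f
      refine Mat_.hom_ext _ _ ?_
      rintro ⟨i, ⟨⟩⟩ j
      refine (comp_mono (M := tObj N ((Mat_.embedding C).obj (𝟙_ C))) (N := N) (tHom f (𝟙 _))
        (fun p => p.1) (Equiv.prodPUnit N.ι).injective _ (i, PUnit.unit) (j, PUnit.unit)).trans ?_
      refine Eq.trans ?_ (mono_comp (M := tObj M ((Mat_.embedding C).obj (𝟙_ C))) (N := M)
        (fun p => p.1) _ f (i, PUnit.unit) j).symm
      refine Eq.trans ?_ (MonoidalCategory.rightUnitor_naturality (f i j))
      rw [← MonoidalCategory.tensorHom_id, tHom_apply, Mat_.id_apply_self]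
      rfl)
    (pentagon := by
      intro W X Y Z
      change tHom (mono _ _) (𝟙 Z) ≫ mono _ _ ≫ tHom (𝟙 W) (mono _ _) = mono _ _ ≫ mono _ _
      rw [id_eq_mono Z, id_eq_mono W, tHom_mono, tHom_mono]
      erw [mono_comp_mono, mono_comp_mono, mono_comp_mono]
      refine congrArg (mono _) ?_
      funext p
      dsimp
      rw [MonoidalCategory.tensorHom_id, MonoidalCategory.id_tensorHom]
      exact MonoidalCategory.pentagon _ _ _ _)
    (triangle := by
      intro X Y
      change mono _ _ ≫ tHom (𝟙 X) (mono _ _) = tHom (mono _ _) (𝟙 Y)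
      rw [id_eq_mono X, id_eq_mono Y, tHom_mono, tHom_mono]
      erw [mono_comp_mono]
      refine congrArg (mono _) ?_
      funext p
      dsimp
      rw [MonoidalCategory.tensorHom_id, MonoidalCategory.id_tensorHom]
      exact MonoidalCategory.triangle _ _)

instance : MonoidalPreadditive (Mat_ C) where
  whiskerLeft_zero := by
    intro X Y Z
    refine Mat_.hom_ext _ _ fun p q => ?_
    exact MonoidalPreadditive.tensor_zero _
  zero_whiskerRight := by
    intro X Y Z
    refine Mat_.hom_ext _ _ fun p q => ?_
    exact MonoidalPreadditive.zero_tensor _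
  whiskerLeft_add := by
    intro X Y Z f g
    refine Mat_.hom_ext _ _ fun p q => ?_
    exact MonoidalPreadditive.tensor_add _ _ _
  add_whiskerRight := by
    intro X Y Z f g
    refine Mat_.hom_ext _ _ fun p q => ?_
    exact MonoidalPreadditive.add_tensor _ _ _

instance [Linear ℂ C] [MonoidalLinear ℂ C] : MonoidalLinear ℂ (Mat_ C) where
  whiskerLeft_smul := by
    intro X Y Z r f
    refine Mat_.hom_ext _ _ fun p q => ?_
    change (𝟙 X : X ⟶ X) p.1 q.1 ⊗ₘ (r • f p.2 q.2) = r • ((𝟙 X : X ⟶ X) p.1 q.1 ⊗ₘ f p.2 q.2)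
    simp [MonoidalCategory.tensorHom_def]
  smul_whiskerRight := by
    intro r Y Z f X
    refine Mat_.hom_ext _ _ fun p q => ?_
    change (r • f p.1 q.1) ⊗ₘ (𝟙 X : X ⟶ X) p.2 q.2 = r • (f p.1 q.1 ⊗ₘ (𝟙 X : X ⟶ X) p.2 q.2)
    simp [MonoidalCategory.tensorHom_def]

end MatEnv

end MatMonoidal

/-! ## The monoidal structure on the Karoubi envelope -/

section KarMonoidal

universe v u

open CategoryTheory.Idempotents

namespace KarEnv

variable {C : Type u} [Category.{v} C]

instance [Preadditive C] [Linear ℂ C] : Linear ℂ (Karoubi C) where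
  homModule P Q :=
    { smul := fun r f => ⟨r • f.f, by
        rw [Linear.smul_comp, Linear.comp_smul, f.comm]⟩
      one_smul := fun f => Karoubi.hom_ext _ _ (one_smul ℂ f.f)
      mul_smul := fun a b f => Karoubi.hom_ext _ _ (mul_smul a b f.f)
      smul_zero := fun a => Karoubi.hom_ext _ _ (smul_zero a)
      smul_add := fun a f g => Karoubi.hom_ext _ _ (smul_add a f.f g.f)
      add_smul := fun a b f => Karoubi.hom_ext _ _ (add_smul a b f.f)
      zero_smul := fun f => Karoubi.hom_ext _ _ (zero_smul ℂ f.f) }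
  smul_comp P Q R r f g := Karoubi.hom_ext _ _ (Linear.smul_comp _ _ _ r f.f g.f)
  comp_smul P Q R f r g := Karoubi.hom_ext _ _ (Linear.comp_smul _ _ _ f.f r g.f)

variable [MonoidalCategory C]

set_option linter.unusedSectionVars false

/-- The tensor product of the formal images of two idempotents. -/
abbrev tObj (P Q : Karoubi C) : Karoubi C :=
  ⟨P.X ⊗ Q.X, P.p ⊗ₘ Q.p, by rw [tensorHom_comp_tensorHom, P.idem, Q.idem]⟩

/-- The tensor product of morphisms in the Karoubi envelope. -/
abbrev tHom {P Q P' Q' : Karoubi C} (f : P ⟶ P') (g : Q ⟶ Q') : tObj P Q ⟶ tObj P' Q' :=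
  ⟨f.f ⊗ₘ g.f, by simp only [tensorHom_comp_tensorHom, f.comm, g.comm]⟩

/-- The morphism of formal images induced by a morphism commuting with the idempotents. -/
abbrev restr {P Q : Karoubi C} (φ : P.X ⟶ Q.X) (h : P.p ≫ φ = φ ≫ Q.p) : P ⟶ Q :=
  ⟨P.p ≫ φ, by rw [Category.assoc, ← h]; simp⟩

/-- The isomorphism of formal images induced by an isomorphism commuting with the idempotents. -/
abbrev restrIso {P Q : Karoubi C} (φ : P.X ≅ Q.X) (h : P.p ≫ φ.hom = φ.hom ≫ Q.p) : P ≅ Q where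
  hom := restr φ.hom h
  inv := restr φ.inv (by rw [← cancel_epi φ.hom, ← Category.assoc, ← h]; simp)
  hom_inv_id := by
    refine Karoubi.hom_ext _ _ ?_
    change (P.p ≫ φ.hom) ≫ Q.p ≫ φ.inv = P.p
    rw [Category.assoc, ← Category.assoc φ.hom, ← h]
    simp
  inv_hom_id := by
    refine Karoubi.hom_ext _ _ ?_
    change (Q.p ≫ φ.inv) ≫ P.p ≫ φ.hom = Q.p
    rw [h]
    simp

theorem restr_comm_id {P Q : Karoubi C} (φ : P.X ⟶ Q.X) (h : P.p ≫ φ = φ ≫ Q.p) (R : Karoubi C) :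
    (P.p ⊗ₘ R.p) ≫ (φ ▷ R.X) = (φ ▷ R.X) ≫ (Q.p ⊗ₘ R.p) := by
  rw [← MonoidalCategory.tensorHom_id, MonoidalCategory.tensorHom_comp_tensorHom,
    MonoidalCategory.tensorHom_comp_tensorHom, h, Category.comp_id, Category.id_comp]

theorem restr_id_comm {P Q : Karoubi C} (φ : P.X ⟶ Q.X) (h : P.p ≫ φ = φ ≫ Q.p) (R : Karoubi C) :
    (R.p ⊗ₘ P.p) ≫ (R.X ◁ φ) = (R.X ◁ φ) ≫ (R.p ⊗ₘ Q.p) := by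
  rw [← MonoidalCategory.id_tensorHom, MonoidalCategory.tensorHom_comp_tensorHom,
    MonoidalCategory.tensorHom_comp_tensorHom, h, Category.comp_id, Category.id_comp]

theorem tHom_restr_id {P Q : Karoubi C} (φ : P.X ⟶ Q.X) (h : P.p ≫ φ = φ ≫ Q.p) (R : Karoubi C) :
    tHom (restr φ h) (𝟙 R) =
      restr (P := tObj P R) (Q := tObj Q R) (φ ▷ R.X) (restr_comm_id φ h R) := by
  refine Karoubi.hom_ext _ _ ?_
  change (P.p ≫ φ) ⊗ₘ R.p = (P.p ⊗ₘ R.p) ≫ (φ ▷ R.X)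
  rw [← MonoidalCategory.tensorHom_id, MonoidalCategory.tensorHom_comp_tensorHom, Category.comp_id]

theorem tHom_id_restr {P Q : Karoubi C} (φ : P.X ⟶ Q.X) (h : P.p ≫ φ = φ ≫ Q.p) (R : Karoubi C) :
    tHom (𝟙 R) (restr φ h) =
      restr (P := tObj R P) (Q := tObj R Q) (R.X ◁ φ) (restr_id_comm φ h R) := by
  refine Karoubi.hom_ext _ _ ?_
  change R.p ⊗ₘ (P.p ≫ φ) = (R.p ⊗ₘ P.p) ≫ (R.X ◁ φ)
  rw [← MonoidalCategory.id_tensorHom, MonoidalCategory.tensorHom_comp_tensorHom, Category.comp_id]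

theorem restr_comp {P Q R : Karoubi C} (φ : P.X ⟶ Q.X) (h : P.p ≫ φ = φ ≫ Q.p)
    (ψ : Q.X ⟶ R.X) (h' : Q.p ≫ ψ = ψ ≫ R.p) :
    restr φ h ≫ restr ψ h' = restr (φ ≫ ψ) (by rw [← Category.assoc, h, Category.assoc, h',
      Category.assoc]) := by
  refine Karoubi.hom_ext _ _ ?_
  change (P.p ≫ φ) ≫ Q.p ≫ ψ = P.p ≫ φ ≫ ψ
  rw [Category.assoc, ← Category.assoc φ, ← h]
  simp

theorem restr_congr {P Q : Karoubi C} {φ ψ : P.X ⟶ Q.X} (h : P.p ≫ φ = φ ≫ Q.p)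
    (h' : P.p ≫ ψ = ψ ≫ Q.p) (e : φ = ψ) : restr φ h = restr ψ h' := by
  subst e; rfl

theorem assoc_comm (P Q R : Karoubi C) :
    (tObj (tObj P Q) R).p ≫ (α_ P.X Q.X R.X).hom =
      (α_ P.X Q.X R.X).hom ≫ (tObj P (tObj Q R)).p :=
  MonoidalCategory.associator_naturality _ _ _

theorem left_comm (P : Karoubi C) :
    (tObj ((toKaroubi C).obj (𝟙_ C)) P).p ≫ (λ_ P.X).hom = (λ_ P.X).hom ≫ P.p := by
  change (𝟙 (𝟙_ C) ⊗ₘ P.p) ≫ _ = _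
  rw [MonoidalCategory.id_tensorHom]
  exact MonoidalCategory.leftUnitor_naturality _

theorem right_comm (P : Karoubi C) :
    (tObj P ((toKaroubi C).obj (𝟙_ C))).p ≫ (ρ_ P.X).hom = (ρ_ P.X).hom ≫ P.p := by
  change (P.p ⊗ₘ 𝟙 (𝟙_ C)) ≫ _ = _
  rw [MonoidalCategory.tensorHom_id]
  exact MonoidalCategory.rightUnitor_naturality _

instance : MonoidalCategoryStruct (Karoubi C) where
  tensorObj := tObj
  tensorHom f g := tHom f g
  whiskerLeft P _ _ f := tHom (𝟙 P) f
  whiskerRight f Q := tHom f (𝟙 Q)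
  tensorUnit := (toKaroubi C).obj (𝟙_ C)
  associator P Q R := restrIso (P := tObj (tObj P Q) R) (Q := tObj P (tObj Q R))
    (α_ P.X Q.X R.X) (assoc_comm P Q R)
  leftUnitor P := restrIso (P := tObj ((toKaroubi C).obj (𝟙_ C)) P) (Q := P) (λ_ P.X) (left_comm P)
  rightUnitor P :=
    restrIso (P := tObj P ((toKaroubi C).obj (𝟙_ C))) (Q := P) (ρ_ P.X) (right_comm P)

/-- The monoidal structure on the Karoubi envelope. -/
instance : MonoidalCategory (Karoubi C) :=
  MonoidalCategory.ofTensorHom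
    (id_tensorHom_id := fun _ _ => rfl)
    (id_tensorHom := fun _ _ _ _ => rfl)
    (tensorHom_id := fun _ _ => rfl)
    (tensorHom_comp_tensorHom := fun f g f' g' =>
      Karoubi.hom_ext _ _ (MonoidalCategory.tensorHom_comp_tensorHom f.f g.f f'.f g'.f))
    (associator_naturality := by
      intro X₁ X₂ X₃ Y₁ Y₂ Y₃ f g h
      refine Karoubi.hom_ext _ _ ?_
      change ((f.f ⊗ₘ g.f) ⊗ₘ h.f) ≫ ((Y₁.p ⊗ₘ Y₂.p) ⊗ₘ Y₃.p) ≫ (α_ _ _ _).hom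
        = (((X₁.p ⊗ₘ X₂.p) ⊗ₘ X₃.p) ≫ (α_ _ _ _).hom) ≫ (f.f ⊗ₘ (g.f ⊗ₘ h.f))
      rw [Category.assoc, ← MonoidalCategory.associator_naturality f.f g.f h.f,
        ← Category.assoc, ← Category.assoc]
      simp only [MonoidalCategory.tensorHom_comp_tensorHom, Karoubi.comp_p, Karoubi.p_comp])
    (leftUnitor_naturality := by
      intro X Y f
      refine Karoubi.hom_ext _ _ ?_
      change (𝟙 _ ⊗ₘ f.f) ≫ (𝟙 _ ⊗ₘ Y.p) ≫ (λ_ _).hom = ((𝟙 _ ⊗ₘ X.p) ≫ (λ_ _).hom) ≫ f.f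
      rw [← Category.assoc, MonoidalCategory.tensorHom_comp_tensorHom, Karoubi.comp_p,
        Category.id_comp,
        MonoidalCategory.id_tensorHom, MonoidalCategory.id_tensorHom,
        MonoidalCategory.leftUnitor_naturality,
        MonoidalCategory.leftUnitor_naturality, Category.assoc, Karoubi.p_comp])
    (rightUnitor_naturality := by
      intro X Y f
      refine Karoubi.hom_ext _ _ ?_
      change (f.f ⊗ₘ 𝟙 _) ≫ (Y.p ⊗ₘ 𝟙 _) ≫ (ρ_ _).hom = ((X.p ⊗ₘ 𝟙 _) ≫ (ρ_ _).hom) ≫ f.f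
      rw [← Category.assoc, MonoidalCategory.tensorHom_comp_tensorHom, Karoubi.comp_p,
        Category.id_comp,
        MonoidalCategory.tensorHom_id, MonoidalCategory.tensorHom_id,
        MonoidalCategory.rightUnitor_naturality,
        MonoidalCategory.rightUnitor_naturality, Category.assoc, Karoubi.p_comp])
    (pentagon := by
      intro W X Y Z
      change tHom (restr _ (assoc_comm W X Y)) (𝟙 Z) ≫ restr _ (assoc_comm W (tObj X Y) Z) ≫
          tHom (𝟙 W) (restr _ (assoc_comm X Y Z)) =
        restr _ (assoc_comm (tObj W X) Y Z) ≫ restr _ (assoc_comm W X (tObj Y Z))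
      rw [tHom_restr_id, tHom_id_restr]
      erw [restr_comp, restr_comp, restr_comp]
      exact restr_congr _ _ (MonoidalCategory.pentagon W.X X.X Y.X Z.X))
    (triangle := by
      intro X Y
      change restr _ (assoc_comm X ((toKaroubi C).obj (𝟙_ C)) Y) ≫
          tHom (𝟙 X) (restr _ (left_comm Y)) = tHom (restr _ (right_comm X)) (𝟙 Y)
      rw [tHom_restr_id, tHom_id_restr]
      erw [restr_comp]
      exact restr_congr _ _ (MonoidalCategory.triangle X.X Y.X))

instance [Preadditive C] [MonoidalPreadditive C] : MonoidalPreadditive (Karoubi C) where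
  whiskerLeft_zero := Karoubi.hom_ext _ _ (MonoidalPreadditive.tensor_zero _)
  zero_whiskerRight := Karoubi.hom_ext _ _ (MonoidalPreadditive.zero_tensor _)
  whiskerLeft_add _ _ := Karoubi.hom_ext _ _ (MonoidalPreadditive.tensor_add _ _ _)
  add_whiskerRight _ _ := Karoubi.hom_ext _ _ (MonoidalPreadditive.add_tensor _ _ _)

instance [Preadditive C] [MonoidalPreadditive C] [Linear ℂ C] [MonoidalLinear ℂ C] :
    MonoidalLinear ℂ (Karoubi C) where
  whiskerLeft_smul := by
    intro X Y Z r f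
    refine Karoubi.hom_ext _ _ ?_
    change X.p ⊗ₘ (r • f.f) = r • (X.p ⊗ₘ f.f)
    simp [MonoidalCategory.tensorHom_def]
  smul_whiskerRight := by
    intro r Y Z f X
    refine Karoubi.hom_ext _ _ ?_
    change (r • f.f) ⊗ₘ X.p = r • (f.f ⊗ₘ X.p)
    simp [MonoidalCategory.tensorHom_def]

end KarEnv

end KarMonoidal

/-! ## Khovanov's Heisenberg category

The `ℂ`-linear monoidal category generated by two objects `P` (an upward strand) and `Q` (a downward
strand) and by the crossing of two upward strands and the four oriented cups and caps, subject to
planar isotopy and to the local relations of the Heisenberg category. It is presented in the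
non-strict form: objects are bracketed words in `P` and `Q`. Diagrams are read from bottom to top,
so that in `f ≫ g` the diagram `g` is put on top of `f`; in `f ⊗ g` the diagram `f` stands on the
left of `g`. -/

namespace Heis

/-- Bracketed words in the letters `P` and `Q`. -/
inductive Obj : Type
  | one : Obj
  | P : Obj
  | Q : Obj
  | tensor : Obj → Obj → Obj

open Obj

/-- Formal linear combinations, composites and tensor products of the generating diagrams. -/
inductive Diag : Obj → Obj → Type
  | ident (X : Obj) : Diag X X
  | comp {X Y Z : Obj} (f : Diag X Y) (g : Diag Y Z) : Diag X Z
  | tens {X Y X' Y' : Obj} (f : Diag X X') (g : Diag Y Y') : Diag (tensor X Y) (tensor X' Y')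
  | assoc (X Y Z : Obj) : Diag (tensor (tensor X Y) Z) (tensor X (tensor Y Z))
  | assocInv (X Y Z : Obj) : Diag (tensor X (tensor Y Z)) (tensor (tensor X Y) Z)
  | lunit (X : Obj) : Diag (tensor one X) X
  | lunitInv (X : Obj) : Diag X (tensor one X)
  | runit (X : Obj) : Diag (tensor X one) X
  | runitInv (X : Obj) : Diag X (tensor X one)
  | zero (X Y : Obj) : Diag X Y
  | add {X Y : Obj} (f g : Diag X Y) : Diag X Y
  | smul {X Y : Obj} (r : ℂ) (f : Diag X Y) : Diag X Y
  /-- the crossing of two upward strands -/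
  | crossing : Diag (tensor P P) (tensor P P)
  /-- the cup `1 ⟶ QP`, whose left end is the downward and whose right end is the upward strand -/
  | cupQP : Diag one (tensor Q P)
  /-- the cap `QP ⟶ 1` -/
  | capQP : Diag (tensor Q P) one
  /-- the cup `1 ⟶ PQ`, whose left end is the upward and whose right end is the downward strand -/
  | cupPQ : Diag one (tensor P Q)
  /-- the cap `PQ ⟶ 1` -/
  | capPQ : Diag (tensor P Q) one

namespace Diag

/-- Rotation of a diagram by a quarter turn counterclockwise: the upward strand at the lower right
is bent to the upper right, and the one at the upper left is bent to the lower left. -/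
def rotCCW {X Y : Obj} (f : Diag (tensor X P) (tensor P Y)) : Diag (tensor Q X) (tensor Y Q) :=
  (runitInv (tensor Q X)).comp <|
  ((ident (tensor Q X)).tens cupPQ).comp <|
  (assocInv (tensor Q X) P Q).comp <|
  ((assoc Q X P).tens (ident Q)).comp <|
  (((ident Q).tens f).tens (ident Q)).comp <|
  ((assocInv Q P Y).tens (ident Q)).comp <|
  ((capQP.tens (ident Y)).tens (ident Q)).comp <|
  (lunit Y).tens (ident Q)

/-- Rotation of a diagram by a quarter turn clockwise: the upward strand at the lower left is bent
to the upper left, and the one at the upper right is bent to the lower right. -/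
def rotCW {X Y : Obj} (f : Diag (tensor P X) (tensor Y P)) : Diag (tensor X Q) (tensor Q Y) :=
  (lunitInv (tensor X Q)).comp <|
  (cupQP.tens (ident (tensor X Q))).comp <|
  (assoc Q P (tensor X Q)).comp <|
  ((ident Q).tens (assocInv P X Q)).comp <|
  ((ident Q).tens (f.tens (ident Q))).comp <|
  ((ident Q).tens (assoc Y P Q)).comp <|
  ((ident Q).tens ((ident Y).tens capPQ)).comp <|
  (ident Q).tens (runit Y)

/-- The crossing `QP ⟶ PQ`. -/
def crossingQP : Diag (tensor Q P) (tensor P Q) := rotCCW crossing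

/-- The crossing `PQ ⟶ QP`. -/
def crossingPQ : Diag (tensor P Q) (tensor Q P) := rotCW crossing

/-- The upward strand with a curl (a loop traversed clockwise) on its right. -/
def rightCurl : Diag P P :=
  (runitInv P).comp <|
  ((ident P).tens cupPQ).comp <|
  (assocInv P P Q).comp <|
  (crossing.tens (ident Q)).comp <|
  (assoc P P Q).comp <|
  ((ident P).tens capPQ).comp <|
  runit P

/-- The upward strand with a curl (a loop traversed counterclockwise) on its left. -/
def leftCurl : Diag P P :=
  (lunitInv P).comp <|
  (cupQP.tens (ident P)).comp <|
  (assoc Q P P).comp <|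
  ((ident Q).tens crossing).comp <|
  (assocInv Q P P).comp <|
  (capQP.tens (ident P)).comp <|
  lunit P

end Diag

open Diag

/-- The relations between formal diagrams: the congruence generated by the axioms of a `ℂ`-linear
monoidal category, by planar isotopy, and by the local relations of the Heisenberg category. -/
inductive Rel : ∀ {X Y : Obj}, Diag X Y → Diag X Y → Prop
  -- equivalence relation and congruence
  | refl {X Y} (f : Diag X Y) : Rel f f
  | symm {X Y} {f g : Diag X Y} : Rel f g → Rel g f
  | trans {X Y} {f g h : Diag X Y} : Rel f g → Rel g h → Rel f h
  | comp_congr {X Y Z} {f f' : Diag X Y} {g g' : Diag Y Z} :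
      Rel f f' → Rel g g' → Rel (f.comp g) (f'.comp g')
  | tens_congr {X Y X' Y'} {f f' : Diag X X'} {g g' : Diag Y Y'} :
      Rel f f' → Rel g g' → Rel (f.tens g) (f'.tens g')
  | add_congr {X Y} {f f' g g' : Diag X Y} : Rel f f' → Rel g g' → Rel (f.add g) (f'.add g')
  | smul_congr {X Y} (r : ℂ) {f f' : Diag X Y} : Rel f f' → Rel (f.smul r) (f'.smul r)
  -- morphisms form complex vector spaces
  | add_assoc {X Y} (f g h : Diag X Y) : Rel ((f.add g).add h) (f.add (g.add h))
  | add_comm {X Y} (f g : Diag X Y) : Rel (f.add g) (g.add f)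
  | zero_add {X Y} (f : Diag X Y) : Rel ((zero X Y).add f) f
  | neg_add {X Y} (f : Diag X Y) : Rel ((f.smul (-1)).add f) (zero X Y)
  | one_smul {X Y} (f : Diag X Y) : Rel (f.smul 1) f
  | mul_smul {X Y} (r s : ℂ) (f : Diag X Y) : Rel (f.smul (r * s)) ((f.smul s).smul r)
  | smul_add {X Y} (r : ℂ) (f g : Diag X Y) : Rel ((f.add g).smul r) ((f.smul r).add (g.smul r))
  | add_smul {X Y} (r s : ℂ) (f : Diag X Y) : Rel (f.smul (r + s)) ((f.smul r).add (f.smul s))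
  -- composition and tensor product are bilinear
  | add_comp {X Y Z} (f f' : Diag X Y) (g : Diag Y Z) :
      Rel ((f.add f').comp g) ((f.comp g).add (f'.comp g))
  | comp_add {X Y Z} (f : Diag X Y) (g g' : Diag Y Z) :
      Rel (f.comp (g.add g')) ((f.comp g).add (f.comp g'))
  | smul_comp {X Y Z} (r : ℂ) (f : Diag X Y) (g : Diag Y Z) :
      Rel ((f.smul r).comp g) ((f.comp g).smul r)
  | comp_smul {X Y Z} (r : ℂ) (f : Diag X Y) (g : Diag Y Z) :
      Rel (f.comp (g.smul r)) ((f.comp g).smul r)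
  | add_tens {X Y X' Y'} (f f' : Diag X X') (g : Diag Y Y') :
      Rel ((f.add f').tens g) ((f.tens g).add (f'.tens g))
  | tens_add {X Y X' Y'} (f : Diag X X') (g g' : Diag Y Y') :
      Rel (f.tens (g.add g')) ((f.tens g).add (f.tens g'))
  | smul_tens {X Y X' Y'} (r : ℂ) (f : Diag X X') (g : Diag Y Y') :
      Rel ((f.smul r).tens g) ((f.tens g).smul r)
  | tens_smul {X Y X' Y'} (r : ℂ) (f : Diag X X') (g : Diag Y Y') :
      Rel (f.tens (g.smul r)) ((f.tens g).smul r)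
  -- the axioms of a monoidal category
  | id_comp {X Y} (f : Diag X Y) : Rel ((ident X).comp f) f
  | comp_id {X Y} (f : Diag X Y) : Rel (f.comp (ident Y)) f
  | comp_assoc {W X Y Z} (f : Diag W X) (g : Diag X Y) (h : Diag Y Z) :
      Rel ((f.comp g).comp h) (f.comp (g.comp h))
  | id_tens_id (X Y) : Rel ((ident X).tens (ident Y)) (ident (tensor X Y))
  | tens_comp_tens {X Y Z X' Y' Z'} (f : Diag X Y) (f' : Diag X' Y') (g : Diag Y Z)
      (g' : Diag Y' Z') : Rel ((f.tens f').comp (g.tens g')) ((f.comp g).tens (f'.comp g'))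
  | assoc_assocInv (X Y Z) : Rel ((assoc X Y Z).comp (assocInv X Y Z)) (ident _)
  | assocInv_assoc (X Y Z) : Rel ((assocInv X Y Z).comp (assoc X Y Z)) (ident _)
  | lunit_lunitInv (X) : Rel ((lunit X).comp (lunitInv X)) (ident _)
  | lunitInv_lunit (X) : Rel ((lunitInv X).comp (lunit X)) (ident _)
  | runit_runitInv (X) : Rel ((runit X).comp (runitInv X)) (ident _)
  | runitInv_runit (X) : Rel ((runitInv X).comp (runit X)) (ident _)
  | assoc_natural {X Y Z X' Y' Z'} (f : Diag X X') (g : Diag Y Y') (h : Diag Z Z') :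
      Rel (((f.tens g).tens h).comp (assoc X' Y' Z')) ((assoc X Y Z).comp (f.tens (g.tens h)))
  | lunit_natural {X Y} (f : Diag X Y) :
      Rel (((ident one).tens f).comp (lunit Y)) ((lunit X).comp f)
  | runit_natural {X Y} (f : Diag X Y) :
      Rel ((f.tens (ident one)).comp (runit Y)) ((runit X).comp f)
  | pentagon (W X Y Z) :
      Rel (((assoc W X Y).tens (ident Z)).comp
          ((assoc W (tensor X Y) Z).comp ((ident W).tens (assoc X Y Z))))
        ((assoc (tensor W X) Y Z).comp (assoc W X (tensor Y Z)))
  | triangle (X Y) :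
      Rel ((assoc X one Y).comp ((ident X).tens (lunit Y))) ((runit X).tens (ident Y))
  -- planar isotopy: straightening of the four zigzags
  | zigzag_P_right : Rel
      ((runitInv P).comp <| ((ident P).tens cupQP).comp <| (assocInv P Q P).comp <|
        (capPQ.tens (ident P)).comp <| lunit P) (ident P)
  | zigzag_P_left : Rel
      ((lunitInv P).comp <| (cupPQ.tens (ident P)).comp <| (assoc P Q P).comp <|
        ((ident P).tens capQP).comp <| runit P) (ident P)
  | zigzag_Q_right : Rel
      ((runitInv Q).comp <| ((ident Q).tens cupPQ).comp <| (assocInv Q P Q).comp <|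
        (capQP.tens (ident Q)).comp <| lunit Q) (ident Q)
  | zigzag_Q_left : Rel
      ((lunitInv Q).comp <| (cupQP.tens (ident Q)).comp <| (assoc Q P Q).comp <|
        ((ident Q).tens capPQ).comp <| runit Q) (ident Q)
  -- planar isotopy: both half turns of the crossing give the same crossing of downward strands
  | crossing_cyclic : Rel (rotCCW crossingQP) (rotCW crossingPQ)
  -- the symmetric group relations
  | crossing_sq : Rel (crossing.comp crossing) (ident (tensor P P))
  | braid : Rel
      ((crossing.tens (ident P)).comp <| (assoc P P P).comp <| ((ident P).tens crossing).comp <|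
        (assocInv P P P).comp <| crossing.tens (ident P))
      ((assoc P P P).comp <| ((ident P).tens crossing).comp <| (assocInv P P P).comp <|
        (crossing.tens (ident P)).comp <| (assoc P P P).comp <| ((ident P).tens crossing).comp <|
        assocInv P P P)
  -- the two double crossings of strands of opposite directions
  | double_QP : Rel (crossingQP.comp crossingPQ)
      ((ident (tensor Q P)).add ((capQP.comp cupQP).smul (-1)))
  | double_PQ : Rel (crossingPQ.comp crossingQP) (ident (tensor P Q))
  -- a counterclockwise circle is one, a left curl is zero
  | circle : Rel (cupQP.comp capQP) (ident one)
  | left_curl : Rel leftCurl (zero P P)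

/-- Equality of diagrams modulo the relations. -/
instance diagSetoid (X Y : Obj) : Setoid (Diag X Y) := ⟨Rel, Rel.refl, Rel.symm, Rel.trans⟩

/-- The space of morphisms between two words. -/
def HomSpace (X Y : Obj) : Type := Quotient (diagSetoid X Y)

namespace HomSpace

/-- The morphism represented by a formal diagram. -/
def mk {X Y : Obj} (f : Diag X Y) : HomSpace X Y := Quotient.mk _ f

theorem sound {X Y : Obj} {f g : Diag X Y} (h : Rel f g) : mk f = mk g := Quotient.sound h

theorem ind {X Y : Obj} {p : HomSpace X Y → Prop} (h : ∀ f, p (mk f)) (x : HomSpace X Y) : p x :=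
  Quotient.ind h x

instance (X Y : Obj) : Zero (HomSpace X Y) := ⟨mk (Diag.zero X Y)⟩

instance (X Y : Obj) : Add (HomSpace X Y) :=
  ⟨Quotient.map₂ Diag.add (fun _ _ h _ _ h' => Rel.add_congr h h')⟩

instance (X Y : Obj) : SMul ℂ (HomSpace X Y) :=
  ⟨fun r => Quotient.map (Diag.smul r) (fun _ _ h => Rel.smul_congr r h)⟩

instance (X Y : Obj) : Neg (HomSpace X Y) := ⟨fun x => (-1 : ℂ) • x⟩

instance (X Y : Obj) : AddCommGroup (HomSpace X Y) where
  add_assoc x y z := by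
    induction x using ind; induction y using ind; induction z using ind
    exact sound (Rel.add_assoc _ _ _)
  add_comm x y := by
    induction x using ind; induction y using ind
    exact sound (Rel.add_comm _ _)
  zero_add x := by
    induction x using ind
    exact sound (Rel.zero_add _)
  add_zero x := by
    induction x using ind
    exact sound (Rel.trans (Rel.add_comm _ _) (Rel.zero_add _))
  neg_add_cancel x := by
    induction x using ind
    exact sound (Rel.neg_add _)
  nsmul := nsmulRec
  zsmul := zsmulRec

theorem smul_add' {X Y : Obj} (r : ℂ) (x y : HomSpace X Y) : r • (x + y) = r • x + r • y := by
  induction x using ind; induction y using ind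
  exact sound (Rel.smul_add r _ _)

theorem add_smul' {X Y : Obj} (r s : ℂ) (x : HomSpace X Y) : (r + s) • x = r • x + s • x := by
  induction x using ind
  exact sound (Rel.add_smul r s _)

instance (X Y : Obj) : Module ℂ (HomSpace X Y) where
  one_smul x := by
    induction x using ind
    exact sound (Rel.one_smul _)
  mul_smul r s x := by
    induction x using ind
    exact sound (Rel.mul_smul r s _)
  smul_add := smul_add'
  add_smul := add_smul'
  smul_zero r := by
    have h := smul_add' r (0 : HomSpace X Y) 0
    rw [add_zero] at h
    exact left_eq_add.1 h
  zero_smul x := by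
    have h := add_smul' 0 0 x
    rw [add_zero] at h
    exact left_eq_add.1 h

/-- Composition of morphisms. -/
def comp {X Y Z : Obj} : HomSpace X Y → HomSpace Y Z → HomSpace X Z :=
  Quotient.map₂ Diag.comp (fun _ _ h _ _ h' => Rel.comp_congr h h')

/-- Tensor product of morphisms. -/
def tens {X Y X' Y' : Obj} :
    HomSpace X X' → HomSpace Y Y' → HomSpace (Obj.tensor X Y) (Obj.tensor X' Y') :=
  Quotient.map₂ Diag.tens (fun _ _ h _ _ h' => Rel.tens_congr h h')

end HomSpace

open HomSpace

instance : Category Obj where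
  Hom := HomSpace
  id X := mk (Diag.ident X)
  comp f g := HomSpace.comp f g
  id_comp f := by
    induction f using ind
    exact sound (Rel.id_comp _)
  comp_id f := by
    induction f using ind
    exact sound (Rel.comp_id _)
  assoc f g h := by
    induction f using ind; induction g using ind; induction h using ind
    exact sound (Rel.comp_assoc _ _ _)

instance : Preadditive Obj where
  homGroup X Y := inferInstanceAs (AddCommGroup (HomSpace X Y))
  add_comp _ _ _ f f' g := by
    induction f using ind; induction f' using ind; induction g using ind
    exact sound (Rel.add_comp _ _ _)
  comp_add _ _ _ f g g' := by
    induction f using ind; induction g using ind; induction g' using ind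
    exact sound (Rel.comp_add _ _ _)

instance : Linear ℂ Obj where
  homModule X Y := inferInstanceAs (Module ℂ (HomSpace X Y))
  smul_comp _ _ _ r f g := by
    induction f using ind; induction g using ind
    exact sound (Rel.smul_comp r _ _)
  comp_smul _ _ _ f r g := by
    induction f using ind; induction g using ind
    exact sound (Rel.comp_smul r _ _)

instance : MonoidalCategoryStruct Obj where
  tensorObj := Obj.tensor
  tensorHom f g := HomSpace.tens f g
  whiskerLeft X _ _ f := HomSpace.tens (mk (Diag.ident X)) f
  whiskerRight f Y := HomSpace.tens f (mk (Diag.ident Y))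
  tensorUnit := Obj.one
  associator X Y Z :=
    ⟨mk (Diag.assoc X Y Z), mk (Diag.assocInv X Y Z), sound (Rel.assoc_assocInv X Y Z),
      sound (Rel.assocInv_assoc X Y Z)⟩
  leftUnitor X :=
    ⟨mk (Diag.lunit X), mk (Diag.lunitInv X), sound (Rel.lunit_lunitInv X),
      sound (Rel.lunitInv_lunit X)⟩
  rightUnitor X :=
    ⟨mk (Diag.runit X), mk (Diag.runitInv X), sound (Rel.runit_runitInv X),
      sound (Rel.runitInv_runit X)⟩

instance : MonoidalCategory Obj :=
  MonoidalCategory.ofTensorHom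
    (id_tensorHom_id := fun X Y => sound (Rel.id_tens_id X Y))
    (id_tensorHom := fun _ _ _ _ => rfl)
    (tensorHom_id := fun _ _ => rfl)
    (tensorHom_comp_tensorHom := by
      intro _ _ _ _ _ _ f f' g g'
      induction f using ind; induction f' using ind; induction g using ind; induction g' using ind
      exact sound (Rel.tens_comp_tens _ _ _ _))
    (associator_naturality := by
      intro _ _ _ _ _ _ f g h
      induction f using ind; induction g using ind; induction h using ind
      exact sound (Rel.assoc_natural _ _ _))
    (leftUnitor_naturality := by
      intro _ _ f
      induction f using ind
      exact sound (Rel.lunit_natural _))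
    (rightUnitor_naturality := by
      intro _ _ f
      induction f using ind
      exact sound (Rel.runit_natural _))
    (pentagon := fun W X Y Z => sound (Rel.pentagon W X Y Z))
    (triangle := fun X Y => sound (Rel.triangle X Y))

theorem tens_add' {X Y X' Y' : Obj} (f : HomSpace X X') (g g' : HomSpace Y Y') :
    HomSpace.tens f (g + g') = HomSpace.tens f g + HomSpace.tens f g' := by
  induction f using ind; induction g using ind; induction g' using ind
  exact sound (Rel.tens_add _ _ _)

theorem add_tens' {X Y X' Y' : Obj} (f f' : HomSpace X X') (g : HomSpace Y Y') :
    HomSpace.tens (f + f') g = HomSpace.tens f g + HomSpace.tens f' g := by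
  induction f using ind; induction f' using ind; induction g using ind
  exact sound (Rel.add_tens _ _ _)

instance : MonoidalPreadditive Obj where
  whiskerLeft_zero {X Y Z} := by
    have h := tens_add' (mk (Diag.ident X)) (0 : HomSpace Y Z) 0
    rw [add_zero] at h
    exact left_eq_add.1 h
  zero_whiskerRight {X Y Z} := by
    have h := add_tens' (0 : HomSpace Y Z) 0 (mk (Diag.ident X))
    rw [add_zero] at h
    exact left_eq_add.1 h
  whiskerLeft_add _ _ := tens_add' _ _ _
  add_whiskerRight _ _ := add_tens' _ _ _

instance : MonoidalLinear ℂ Obj where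
  whiskerLeft_smul _ _ _ r f := by
    induction f using ind
    exact sound (Rel.tens_smul r _ _)
  smul_whiskerRight r _ _ f _ := by
    induction f using ind
    exact sound (Rel.smul_tens r _ _)

/-- The additive Heisenberg category: formal finite direct sums of words in `P` and `Q`. -/
abbrev HPrime : Type 1 := Mat_ Obj

/-- The Heisenberg category: the Karoubi envelope of the additive Heisenberg category. -/
abbrev H : Type 1 := Idempotents.Karoubi HPrime

/-- The inclusion of the category of words in the Heisenberg category. -/
def incl : Obj ⥤ H := Mat_.embedding Obj ⋙ Idempotents.toKaroubi HPrime

/-- The algebra `Tr(H)`. -/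
abbrev TrH : Type 1 := CatTrace H

/-- The class in `Tr(H)` of an endomorphism of a word. -/
def cls {X : Obj} (f : X ⟶ X) : TrH := trClass (incl.map f)

/-- The dot on an upward strand: a curl on the right. -/
def dot : Obj.P ⟶ Obj.P := mk Diag.rightCurl

/-- `n` dots on an upward strand. -/
def dots : ℕ → (Obj.P ⟶ Obj.P)
  | 0 => 𝟙 Obj.P
  | n + 1 => dots n ≫ dot

/-- The clockwise circle with `n` dots, an endomorphism of the identity object. -/
def bubble (n : ℕ) : 𝟙_ Obj ⟶ 𝟙_ Obj :=
  mk Diag.cupPQ ≫ (dots n ▷ Obj.Q) ≫ mk Diag.capPQ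

/-- The element `c_n` of `Tr(H)`. -/
def c (n : ℕ) : TrH := cls (bubble n)

/-- The element `h_1 ⊗ 1`: the class of a single upward strand without dots. -/
def hOne : TrH := cls (𝟙 Obj.P)

/-- The element `h_{-1} ⊗ 1`: the class of a single downward strand without dots. -/
def hNegOne : TrH := cls (𝟙 Obj.Q)

end Heis

end

open CategoryTheory MonoidalCategory

noncomputable section

namespace Heis
open HomSpace

local notation "𝖯" => Obj.P
local notation "𝖰" => Obj.Q

/-! Formal direct sums and split idempotents add nothing to the trace, so `Tr(H)` is spanned by
classes of endomorphisms of words (`TrH_induction`). Since `𝖯𝖰 ⟶ 𝖰𝖯 ⟶ 𝖯𝖰` is the identity, every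
word is a retract, through `ins` and `rem`, of a word `O m n` with `m` downward strands followed by
`n` upward ones. By cyclicity every class is then the class of an endomorphism of some `O m n`
(`cls_mem_genAlg`). Checking the generating diagrams one by one (`standard_mk`, resting on
`Word.conj`) shows that this endomorphism is built from dots, crossings and circles on the upward
strands, crossings of the downward strands, and the innermost cap and cup.

A cup, a morphism without interaction between the two orientations, and a cap compose to a sum of
terms in which the cup and cap have disappeared or the cap comes first (`cup_cap_mid`). Hence every
morphism between standard words is a sum of terms with all caps before all cups (`Word.normal`).
Cyclicity carries the last cup of a term to the bottom and leaves an endomorphism of fewer strands.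
An endomorphism without cups has no caps either. So the classes without interaction suffice
(`Normal.cls_mem`), and these are products of a class of downward strands and a class of upward
strands (`cls_pure_mem`).

Both orientations give towers of degenerate affine Hecke algebras. In such a tower the first strand
may be assumed to cross at most once (`HeckeTower.dec_of_mem`), so all traces are generated by the
traces of single cycles with dots on one strand. These come from the single undotted strand in two
ways (`HeckeTower.Trace.loop_mem`). The commutator of a cycle carrying one dot with a free strand is
a multiple of the next longer undotted cycle (`cyc_x_one`). Multiplication by the sum of all dots
gives, up to products of shorter cycles, a nonzero multiple of the cycle with one more dot
(`dotCyc_sub_mem`). The sum of all dots is available because sliding the circles of `c 0 + c 1`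
through a strand leaves exactly an identity and two dots, up to sign (`gam_P`, `gam_Q`).

The circles remain. The commutator of `hNegOne` with the class of an upward strand carrying `k + 2`
dots is `(k + 2) • c k` plus products involving only earlier circles, so all `c k` follow by
induction (`c_mem`). -/

/-- The crossing, as a morphism of the category of words. -/
def crossingHom : 𝖯 ⊗ 𝖯 ⟶ 𝖯 ⊗ 𝖯 := mk Diag.crossing
/-- The cup `1 ⟶ QP`. -/
def cupQPHom : 𝟙_ Obj ⟶ 𝖰 ⊗ 𝖯 := mk Diag.cupQP
/-- The cap `QP ⟶ 1`. -/
def capQPHom : 𝖰 ⊗ 𝖯 ⟶ 𝟙_ Obj := mk Diag.capQP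
/-- The cup `1 ⟶ PQ`. -/
def cupPQHom : 𝟙_ Obj ⟶ 𝖯 ⊗ 𝖰 := mk Diag.cupPQ
/-- The cap `PQ ⟶ 1`. -/
def capPQHom : 𝖯 ⊗ 𝖰 ⟶ 𝟙_ Obj := mk Diag.capPQ

/-- Rotation by a quarter turn counterclockwise. -/
def rotCCWHom {X Y : Obj} (f : X ⊗ 𝖯 ⟶ 𝖯 ⊗ Y) : 𝖰 ⊗ X ⟶ Y ⊗ 𝖰 :=
  (ρ_ (𝖰 ⊗ X)).inv ≫ (𝖰 ⊗ X) ◁ cupPQHom ≫ (α_ (𝖰 ⊗ X) 𝖯 𝖰).inv ≫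
    (α_ 𝖰 X 𝖯).hom ▷ 𝖰 ≫ (𝖰 ◁ f) ▷ 𝖰 ≫ (α_ 𝖰 𝖯 Y).inv ▷ 𝖰 ≫ (capQPHom ▷ Y) ▷ 𝖰 ≫
    (λ_ Y).hom ▷ 𝖰

/-- Rotation by a quarter turn clockwise. -/
def rotCWHom {X Y : Obj} (f : 𝖯 ⊗ X ⟶ Y ⊗ 𝖯) : X ⊗ 𝖰 ⟶ 𝖰 ⊗ Y :=
  (λ_ (X ⊗ 𝖰)).inv ≫ cupQPHom ▷ (X ⊗ 𝖰) ≫ (α_ 𝖰 𝖯 (X ⊗ 𝖰)).hom ≫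
    𝖰 ◁ (α_ 𝖯 X 𝖰).inv ≫ 𝖰 ◁ (f ▷ 𝖰) ≫ 𝖰 ◁ (α_ Y 𝖯 𝖰).hom ≫ 𝖰 ◁ (Y ◁ capPQHom) ≫
    𝖰 ◁ (ρ_ Y).hom

/-- The crossing `QP ⟶ PQ`. -/
def crossQP : 𝖰 ⊗ 𝖯 ⟶ 𝖯 ⊗ 𝖰 := rotCCWHom crossingHom
/-- The crossing `PQ ⟶ QP`. -/
def crossPQ : 𝖯 ⊗ 𝖰 ⟶ 𝖰 ⊗ 𝖯 := rotCWHom crossingHom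
/-- The crossing of two downward strands. -/
def crossQQ : 𝖰 ⊗ 𝖰 ⟶ 𝖰 ⊗ 𝖰 := rotCCWHom crossQP

theorem crossQQ_eq : crossQQ = rotCWHom crossPQ := sound Rel.crossing_cyclic

theorem dot_eq : dot = (ρ_ 𝖯).inv ≫ 𝖯 ◁ cupPQHom ≫ (α_ 𝖯 𝖯 𝖰).inv ≫ crossingHom ▷ 𝖰 ≫
    (α_ 𝖯 𝖯 𝖰).hom ≫ 𝖯 ◁ capPQHom ≫ (ρ_ 𝖯).hom := rfl

/-! ### The generators as operators on words -/

/-- The word `Z` to the right of the active strands is a parameter, so that all words are bracketed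
to the right and associators occur only inside these definitions. Naturality in `Z` then plays the
part of the interchange law. -/
def S (Z : Obj) : 𝖯 ⊗ 𝖯 ⊗ Z ⟶ 𝖯 ⊗ 𝖯 ⊗ Z := (α_ _ _ _).inv ≫ crossingHom ▷ Z ≫ (α_ _ _ _).hom
def X (Z : Obj) : 𝖯 ⊗ Z ⟶ 𝖯 ⊗ Z := dot ▷ Z
def η (Z : Obj) : Z ⟶ 𝖰 ⊗ 𝖯 ⊗ Z := (λ_ Z).inv ≫ cupQPHom ▷ Z ≫ (α_ _ _ _).hom
def ε (Z : Obj) : 𝖰 ⊗ 𝖯 ⊗ Z ⟶ Z := (α_ _ _ _).inv ≫ capQPHom ▷ Z ≫ (λ_ Z).hom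
def η' (Z : Obj) : Z ⟶ 𝖯 ⊗ 𝖰 ⊗ Z := (λ_ Z).inv ≫ cupPQHom ▷ Z ≫ (α_ _ _ _).hom
def ε' (Z : Obj) : 𝖯 ⊗ 𝖰 ⊗ Z ⟶ Z := (α_ _ _ _).inv ≫ capPQHom ▷ Z ≫ (λ_ Z).hom
def T (Z : Obj) : 𝖯 ⊗ 𝖰 ⊗ Z ⟶ 𝖰 ⊗ 𝖯 ⊗ Z := (α_ _ _ _).inv ≫ crossPQ ▷ Z ≫ (α_ _ _ _).hom
def T' (Z : Obj) : 𝖰 ⊗ 𝖯 ⊗ Z ⟶ 𝖯 ⊗ 𝖰 ⊗ Z := (α_ _ _ _).inv ≫ crossQP ▷ Z ≫ (α_ _ _ _).hom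
def U (Z : Obj) : 𝖰 ⊗ 𝖰 ⊗ Z ⟶ 𝖰 ⊗ 𝖰 ⊗ Z := (α_ _ _ _).inv ≫ crossQQ ▷ Z ≫ (α_ _ _ _).hom

variable {Z W : Obj}

/-- The interchange law: a diagram on the two leftmost strands commutes with anything to their
right. Together with its variants for cups and caps it gives the naturality of all operators below.
-/
theorem whisk_nat {A B A' B' : Obj} (g : A ⊗ B ⟶ A' ⊗ B') (f : Z ⟶ W) :
    A ◁ B ◁ f ≫ ((α_ A B W).inv ≫ g ▷ W ≫ (α_ A' B' W).hom) =
      ((α_ A B Z).inv ≫ g ▷ Z ≫ (α_ A' B' Z).hom) ≫ A' ◁ B' ◁ f := by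
  rw [associator_inv_naturality_right_assoc, whisker_exchange_assoc]
  simp

theorem cup_nat {A B : Obj} (g : 𝟙_ Obj ⟶ A ⊗ B) (f : Z ⟶ W) :
    f ≫ ((λ_ W).inv ≫ g ▷ W ≫ (α_ A B W).hom) =
      ((λ_ Z).inv ≫ g ▷ Z ≫ (α_ A B Z).hom) ≫ A ◁ B ◁ f := by
  rw [leftUnitor_inv_naturality_assoc, whisker_exchange_assoc]
  simp

theorem cap_nat {A B : Obj} (g : A ⊗ B ⟶ 𝟙_ Obj) (f : Z ⟶ W) :
    A ◁ B ◁ f ≫ ((α_ A B W).inv ≫ g ▷ W ≫ (λ_ W).hom) =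
      ((α_ A B Z).inv ≫ g ▷ Z ≫ (λ_ Z).hom) ≫ f := by
  rw [associator_inv_naturality_right_assoc, whisker_exchange_assoc]
  simp

theorem S_nat (f : Z ⟶ W) : 𝖯 ◁ 𝖯 ◁ f ≫ S W = S Z ≫ 𝖯 ◁ 𝖯 ◁ f := whisk_nat _ f
theorem X_nat (f : Z ⟶ W) : 𝖯 ◁ f ≫ X W = X Z ≫ 𝖯 ◁ f := whisker_exchange dot f
theorem η_nat (f : Z ⟶ W) : f ≫ η W = η Z ≫ 𝖰 ◁ 𝖯 ◁ f := cup_nat _ f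
theorem ε_nat (f : Z ⟶ W) : 𝖰 ◁ 𝖯 ◁ f ≫ ε W = ε Z ≫ f := cap_nat _ f
theorem η'_nat (f : Z ⟶ W) : f ≫ η' W = η' Z ≫ 𝖯 ◁ 𝖰 ◁ f := cup_nat _ f
theorem ε'_nat (f : Z ⟶ W) : 𝖯 ◁ 𝖰 ◁ f ≫ ε' W = ε' Z ≫ f := cap_nat _ f
theorem T_nat (f : Z ⟶ W) : 𝖯 ◁ 𝖰 ◁ f ≫ T W = T Z ≫ 𝖰 ◁ 𝖯 ◁ f := whisk_nat _ f
theorem T'_nat (f : Z ⟶ W) : 𝖰 ◁ 𝖯 ◁ f ≫ T' W = T' Z ≫ 𝖯 ◁ 𝖰 ◁ f := whisk_nat _ f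
theorem U_nat (f : Z ⟶ W) : 𝖰 ◁ 𝖰 ◁ f ≫ U W = U Z ≫ 𝖰 ◁ 𝖰 ◁ f := whisk_nat _ f

/-! ### The defining relations in operator form. -/

theorem S_sq (Z : Obj) : S Z ≫ S Z = 𝟙 _ := by
  have h : crossingHom ≫ crossingHom = 𝟙 _ := sound Rel.crossing_sq
  calc S Z ≫ S Z = (α_ _ _ _).inv ≫ (crossingHom ≫ crossingHom) ▷ Z ≫ (α_ _ _ _).hom := by
        unfold S; monoidal
    _ = _ := by rw [h]; monoidal

theorem zigP' (Z : Obj) : 𝖯 ◁ η Z ≫ ε' (𝖯 ⊗ Z) = 𝟙 _ := by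
  have h : (ρ_ 𝖯).inv ≫ 𝖯 ◁ cupQPHom ≫ (α_ 𝖯 𝖰 𝖯).inv ≫ capPQHom ▷ 𝖯 ≫ (λ_ 𝖯).hom = 𝟙 𝖯 :=
    sound Rel.zigzag_P_right
  calc _ = ((ρ_ 𝖯).inv ≫ 𝖯 ◁ cupQPHom ≫ (α_ 𝖯 𝖰 𝖯).inv ≫ capPQHom ▷ 𝖯 ≫ (λ_ 𝖯).hom) ▷ Z := by
        unfold η ε'; monoidal
    _ = _ := by rw [h]; monoidal

theorem zigP (Z : Obj) : η' (𝖯 ⊗ Z) ≫ 𝖯 ◁ ε Z = 𝟙 _ := by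
  have h : (λ_ 𝖯).inv ≫ cupPQHom ▷ 𝖯 ≫ (α_ 𝖯 𝖰 𝖯).hom ≫ 𝖯 ◁ capQPHom ≫ (ρ_ 𝖯).hom = 𝟙 𝖯 :=
    sound Rel.zigzag_P_left
  calc _ = ((λ_ 𝖯).inv ≫ cupPQHom ▷ 𝖯 ≫ (α_ 𝖯 𝖰 𝖯).hom ≫ 𝖯 ◁ capQPHom ≫ (ρ_ 𝖯).hom) ▷ Z := by
        unfold η' ε; monoidal
    _ = _ := by rw [h]; monoidal

theorem zigQ (Z : Obj) : 𝖰 ◁ η' Z ≫ ε (𝖰 ⊗ Z) = 𝟙 _ := by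
  have h : (ρ_ 𝖰).inv ≫ 𝖰 ◁ cupPQHom ≫ (α_ 𝖰 𝖯 𝖰).inv ≫ capQPHom ▷ 𝖰 ≫ (λ_ 𝖰).hom = 𝟙 𝖰 :=
    sound Rel.zigzag_Q_right
  calc _ = ((ρ_ 𝖰).inv ≫ 𝖰 ◁ cupPQHom ≫ (α_ 𝖰 𝖯 𝖰).inv ≫ capQPHom ▷ 𝖰 ≫ (λ_ 𝖰).hom) ▷ Z := by
        unfold η' ε; monoidal
    _ = _ := by rw [h]; monoidal

theorem zigQ' (Z : Obj) : η (𝖰 ⊗ Z) ≫ 𝖰 ◁ ε' Z = 𝟙 _ := by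
  have h : (λ_ 𝖰).inv ≫ cupQPHom ▷ 𝖰 ≫ (α_ 𝖰 𝖯 𝖰).hom ≫ 𝖰 ◁ capPQHom ≫ (ρ_ 𝖰).hom = 𝟙 𝖰 :=
    sound Rel.zigzag_Q_left
  calc _ = ((λ_ 𝖰).inv ≫ cupQPHom ▷ 𝖰 ≫ (α_ 𝖰 𝖯 𝖰).hom ≫ 𝖰 ◁ capPQHom ≫ (ρ_ 𝖰).hom) ▷ Z := by
        unfold η ε'; monoidal
    _ = _ := by rw [h]; monoidal

theorem T'_eq (Z : Obj) : T' Z = 𝖰 ◁ 𝖯 ◁ η' Z ≫ 𝖰 ◁ S (𝖰 ⊗ Z) ≫ ε (𝖯 ⊗ 𝖰 ⊗ Z) := by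
  unfold T' crossQP rotCCWHom S η' ε; monoidal

theorem T_eq (Z : Obj) : T Z = η (𝖯 ⊗ 𝖰 ⊗ Z) ≫ 𝖰 ◁ S (𝖰 ⊗ Z) ≫ 𝖰 ◁ 𝖯 ◁ ε' Z := by
  unfold T crossPQ rotCWHom S η ε'; monoidal

theorem U_eq (Z : Obj) : U Z = 𝖰 ◁ 𝖰 ◁ η' Z ≫ 𝖰 ◁ T' (𝖰 ⊗ Z) ≫ ε (𝖰 ⊗ 𝖰 ⊗ Z) := by
  unfold U crossQQ rotCCWHom T' η' ε; monoidal

theorem U_eq' (Z : Obj) : U Z = η (𝖰 ⊗ 𝖰 ⊗ Z) ≫ 𝖰 ◁ T (𝖰 ⊗ Z) ≫ 𝖰 ◁ 𝖰 ◁ ε' Z := by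
  unfold U; rw [crossQQ_eq]; unfold rotCWHom T η ε'; monoidal

theorem X_eq (Z : Obj) : X Z = 𝖯 ◁ η' Z ≫ S (𝖰 ⊗ Z) ≫ 𝖯 ◁ ε' Z := by
  unfold X; rw [dot_eq]; unfold S η' ε'; monoidal

theorem T_T' (Z : Obj) : T Z ≫ T' Z = 𝟙 _ := by
  have h : crossPQ ≫ crossQP = 𝟙 _ := sound Rel.double_PQ
  calc _ = (α_ _ _ _).inv ≫ (crossPQ ≫ crossQP) ▷ Z ≫ (α_ _ _ _).hom := by
        unfold T T'; monoidal
    _ = _ := by rw [h]; monoidal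

theorem T'_T (Z : Obj) : T' Z ≫ T Z = 𝟙 _ - ε Z ≫ η Z := by
  have h : crossQP ≫ crossPQ = 𝟙 _ + (-1 : ℂ) • (capQPHom ≫ cupQPHom) := sound Rel.double_QP
  calc _ = (α_ _ _ _).inv ≫ (crossQP ≫ crossPQ) ▷ Z ≫ (α_ _ _ _).hom := by
        unfold T T'; monoidal
    _ = 𝟙 _ + (-1 : ℂ) • ((α_ _ _ _).inv ≫ (capQPHom ≫ cupQPHom) ▷ Z ≫ (α_ _ _ _).hom) := by
        rw [h]
        simp only [MonoidalPreadditive.add_whiskerRight, MonoidalLinear.smul_whiskerRight,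
          Preadditive.add_comp, Preadditive.comp_add, Linear.smul_comp, Linear.comp_smul]
        simp
    _ = 𝟙 _ + (-1 : ℂ) • (ε Z ≫ η Z) := by
        congr 2; unfold η ε; monoidal
    _ = _ := by rw [neg_one_smul, sub_eq_add_neg]

theorem η_ε (Z : Obj) : η Z ≫ ε Z = 𝟙 _ := by
  have h : cupQPHom ≫ capQPHom = 𝟙 _ := sound Rel.circle
  calc _ = (λ_ _).inv ≫ (cupQPHom ≫ capQPHom) ▷ Z ≫ (λ_ _).hom := by
        unfold η ε; monoidal
    _ = _ := by rw [h]; monoidal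

theorem left_curl (Z : Obj) : η (𝖯 ⊗ Z) ≫ 𝖰 ◁ S Z ≫ ε (𝖯 ⊗ Z) = 0 := by
  have h : (λ_ 𝖯).inv ≫ cupQPHom ▷ 𝖯 ≫ (α_ 𝖰 𝖯 𝖯).hom ≫ 𝖰 ◁ crossingHom ≫ (α_ 𝖰 𝖯 𝖯).inv ≫
      capQPHom ▷ 𝖯 ≫ (λ_ 𝖯).hom = 0 := sound Rel.left_curl
  calc _ = ((λ_ 𝖯).inv ≫ cupQPHom ▷ 𝖯 ≫ (α_ 𝖰 𝖯 𝖯).hom ≫ 𝖰 ◁ crossingHom ≫ (α_ 𝖰 𝖯 𝖯).inv ≫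
      capQPHom ▷ 𝖯 ≫ (λ_ 𝖯).hom) ▷ Z := by
        unfold η ε S; monoidal
    _ = _ := by rw [h, MonoidalPreadditive.zero_whiskerRight]

theorem S_braid (Z : Obj) :
    S (𝖯 ⊗ Z) ≫ 𝖯 ◁ S Z ≫ S (𝖯 ⊗ Z) = 𝖯 ◁ S Z ≫ S (𝖯 ⊗ Z) ≫ 𝖯 ◁ S Z := by
  have h : crossingHom ▷ 𝖯 ≫ (α_ 𝖯 𝖯 𝖯).hom ≫ 𝖯 ◁ crossingHom ≫ (α_ 𝖯 𝖯 𝖯).inv ≫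
      crossingHom ▷ 𝖯 = (α_ 𝖯 𝖯 𝖯).hom ≫ 𝖯 ◁ crossingHom ≫ (α_ 𝖯 𝖯 𝖯).inv ≫ crossingHom ▷ 𝖯 ≫
      (α_ 𝖯 𝖯 𝖯).hom ≫ 𝖯 ◁ crossingHom ≫ (α_ 𝖯 𝖯 𝖯).inv := sound Rel.braid
  calc _ = 𝖯 ◁ (α_ 𝖯 𝖯 Z).inv ≫ (α_ 𝖯 (𝖯 ⊗ 𝖯) Z).inv ≫ (α_ 𝖯 𝖯 𝖯).inv ▷ Z ≫
        (crossingHom ▷ 𝖯 ≫ (α_ 𝖯 𝖯 𝖯).hom ≫ 𝖯 ◁ crossingHom ≫ (α_ 𝖯 𝖯 𝖯).inv ≫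
          crossingHom ▷ 𝖯) ▷ Z ≫ (α_ 𝖯 𝖯 𝖯).hom ▷ Z ≫ (α_ 𝖯 (𝖯 ⊗ 𝖯) Z).hom ≫
            𝖯 ◁ (α_ 𝖯 𝖯 Z).hom := by
        unfold S; monoidal
    _ = _ := by rw [h]; unfold S; monoidal

end Heis

namespace Heis
open HomSpace
local notation "𝖯" => Obj.P
local notation "𝖰" => Obj.Q

variable {Z W V : Obj}

/-! ### The two adjunctions -/

/-- By the zigzags, `η'` and `ε` are unit and counit making `𝖰 ◁ _` left adjoint to `𝖯 ◁ _`, while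
`η` and `ε'` make `𝖯 ◁ _` left adjoint to `𝖰 ◁ _`. The rotated crossings are mates under these
adjunctions, so each relation for them can be read off from one for `S`. -/
theorem transpose_cup' (f : Z ⟶ 𝖯 ⊗ W) : η' Z ≫ 𝖯 ◁ (𝖰 ◁ f ≫ ε W) = f := by
  rw [whiskerLeft_comp, ← reassoc_of% η'_nat f, zigP, Category.comp_id]

theorem transpose_cap (f : 𝖰 ⊗ Z ⟶ W) : 𝖰 ◁ (η' Z ≫ 𝖯 ◁ f) ≫ ε W = f := by
  rw [whiskerLeft_comp, Category.assoc, ε_nat f, reassoc_of% zigQ Z]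

theorem transpose_cap' (f : 𝖯 ⊗ Z ⟶ W) : 𝖯 ◁ (η Z ≫ 𝖰 ◁ f) ≫ ε' W = f := by
  rw [whiskerLeft_comp, Category.assoc, ε'_nat f, reassoc_of% zigP' Z]

theorem T'_transpose (Z : Obj) : T' Z = 𝖰 ◁ (𝖯 ◁ η' Z ≫ S (𝖰 ⊗ Z)) ≫ ε (𝖯 ⊗ 𝖰 ⊗ Z) := by
  rw [T'_eq, whiskerLeft_comp, Category.assoc]

theorem T_transpose (Z : Obj) : T Z = η (𝖯 ⊗ 𝖰 ⊗ Z) ≫ 𝖰 ◁ (S (𝖰 ⊗ Z) ≫ 𝖯 ◁ ε' Z) := by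
  rw [T_eq, whiskerLeft_comp]

theorem U_transpose (Z : Obj) : U Z = 𝖰 ◁ (𝖰 ◁ η' Z ≫ T' (𝖰 ⊗ Z)) ≫ ε (𝖰 ⊗ 𝖰 ⊗ Z) := by
  rw [U_eq, whiskerLeft_comp, Category.assoc]

theorem U_transpose' (Z : Obj) : U Z = η (𝖰 ⊗ 𝖰 ⊗ Z) ≫ 𝖰 ◁ (T (𝖰 ⊗ Z) ≫ 𝖰 ◁ ε' Z) := by
  rw [U_eq', whiskerLeft_comp]

/-! ### Strands passing cups and caps -/

theorem η'_T' (Z : Obj) : η' (𝖯 ⊗ Z) ≫ 𝖯 ◁ T' Z = 𝖯 ◁ η' Z ≫ S (𝖰 ⊗ Z) := by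
  rw [T'_transpose, transpose_cup']

theorem T_ε' (Z : Obj) : 𝖯 ◁ T Z ≫ ε' (𝖯 ⊗ Z) = S (𝖰 ⊗ Z) ≫ 𝖯 ◁ ε' Z := by
  rw [T_transpose, transpose_cap']

theorem U_ε' (Z : Obj) : 𝖯 ◁ U Z ≫ ε' (𝖰 ⊗ Z) = T (𝖰 ⊗ Z) ≫ 𝖰 ◁ ε' Z := by
  rw [U_transpose', transpose_cap']

/-- `T'` is `S` with one strand bent by a cup; the cap on the right-hand side straightens the bend
again. -/
theorem S_ε (Z : Obj) : 𝖰 ◁ S Z ≫ ε (𝖯 ⊗ Z) = T' (𝖯 ⊗ Z) ≫ 𝖯 ◁ ε Z := by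
  have h : (𝖯 ◁ η' (𝖯 ⊗ Z) ≫ S (𝖰 ⊗ 𝖯 ⊗ Z)) ≫ 𝖯 ◁ 𝖯 ◁ ε Z = S Z := by
    rw [Category.assoc, ← S_nat, ← whiskerLeft_comp_assoc, zigP, whiskerLeft_id, Category.id_comp]
  rw [T'_transpose, Category.assoc, ← ε_nat, ← whiskerLeft_comp_assoc, h]

theorem T_S_ε (Z : Obj) : T (𝖯 ⊗ Z) ≫ 𝖰 ◁ S Z ≫ ε (𝖯 ⊗ Z) = 𝖯 ◁ ε Z := by
  rw [S_ε, reassoc_of% T_T']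

theorem η_T (Z : Obj) : 𝖯 ◁ η Z ≫ T (𝖯 ⊗ Z) = η (𝖯 ⊗ Z) ≫ 𝖰 ◁ S Z := by
  have h : 𝖯 ◁ 𝖯 ◁ η Z ≫ S (𝖰 ⊗ 𝖯 ⊗ Z) ≫ 𝖯 ◁ ε' (𝖯 ⊗ Z) = S Z := by
    rw [reassoc_of% S_nat, ← whiskerLeft_comp, zigP', whiskerLeft_id, Category.comp_id]
  rw [T_transpose, reassoc_of% η_nat, ← whiskerLeft_comp, h]

theorem η_U (Z : Obj) : 𝖰 ◁ η Z ≫ U (𝖯 ⊗ Z) = η (𝖰 ⊗ Z) ≫ 𝖰 ◁ T Z := by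
  have h : 𝖯 ◁ 𝖰 ◁ η Z ≫ T (𝖰 ⊗ 𝖯 ⊗ Z) ≫ 𝖰 ◁ ε' (𝖯 ⊗ Z) = T Z := by
    rw [reassoc_of% T_nat, ← whiskerLeft_comp, zigP', whiskerLeft_id, Category.comp_id]
  rw [U_transpose', reassoc_of% η_nat, ← whiskerLeft_comp, h]

theorem T'_ε (Z : Obj) : 𝖰 ◁ T' Z ≫ ε (𝖰 ⊗ Z) = U (𝖯 ⊗ Z) ≫ 𝖰 ◁ ε Z := by
  have h : (𝖰 ◁ η' (𝖯 ⊗ Z) ≫ T' (𝖰 ⊗ 𝖯 ⊗ Z)) ≫ 𝖯 ◁ 𝖰 ◁ ε Z = T' Z := by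
    rw [Category.assoc, ← T'_nat, ← whiskerLeft_comp_assoc, zigP, whiskerLeft_id, Category.id_comp]
  rw [U_transpose, Category.assoc, ← ε_nat, ← whiskerLeft_comp_assoc, h]

/-! ### Curls -/

/-- Rewriting `T` as a bent `S` exposes a left curl under the cap. -/
theorem T_curl (Z : Obj) : T Z ≫ ε Z = 0 := by
  rw [T_transpose, Category.assoc, whiskerLeft_comp, Category.assoc, ε_nat,
    reassoc_of% left_curl, Limits.zero_comp]

theorem curl_T' (Z : Obj) : η Z ≫ T' Z = 0 := by
  rw [T'_transpose, whiskerLeft_comp, Category.assoc, ← reassoc_of% η_nat, left_curl,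
    Limits.comp_zero]

/-- A cup of the orientation `𝖯𝖰`, brought to the orientation `𝖰𝖯`, acquires a right curl. This is
how dots arise when diagrams are put in standard position. -/
theorem η'_T (Z : Obj) : η' Z ≫ T Z = η Z ≫ 𝖰 ◁ X Z := by
  rw [T_transpose, reassoc_of% η_nat, ← whiskerLeft_comp, X_eq]

theorem T'_ε' (Z : Obj) : T' Z ≫ ε' Z = 𝖰 ◁ X Z ≫ ε Z := by
  rw [T'_transpose, Category.assoc, ← ε_nat, ← whiskerLeft_comp_assoc, X_eq, Category.assoc]

theorem curl_U (Z : Obj) : 𝖰 ◁ η Z ≫ U (𝖯 ⊗ Z) ≫ 𝖰 ◁ ε Z = 0 := by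
  rw [reassoc_of% η_U, ← whiskerLeft_comp, T_curl, MonoidalPreadditive.whiskerLeft_zero, Limits.comp_zero]

/-! ### Triple points -/

/-- The braid relation with one strand bent downward. Bending a second and then a third strand turns
it into `P_U_T_T` and `U_braid`. -/
theorem S_T_T (Z : Obj) : S (𝖰 ⊗ Z) ≫ 𝖯 ◁ T Z ≫ T (𝖯 ⊗ Z) = 𝖯 ◁ T Z ≫ T (𝖯 ⊗ Z) ≫ 𝖰 ◁ S Z := by
  have h : 𝖯 ◁ T Z ≫ T (𝖯 ⊗ Z) =
      η (𝖯 ⊗ 𝖯 ⊗ 𝖰 ⊗ Z) ≫ 𝖰 ◁ (S (𝖯 ⊗ 𝖰 ⊗ Z) ≫ 𝖯 ◁ S (𝖰 ⊗ Z) ≫ 𝖯 ◁ 𝖯 ◁ ε' Z) := by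
    rw [T_transpose (𝖯 ⊗ Z), reassoc_of% η_nat, ← whiskerLeft_comp, reassoc_of% S_nat,
      ← whiskerLeft_comp, T_ε', whiskerLeft_comp 𝖯]
  rw [← Category.assoc (𝖯 ◁ T Z), h, reassoc_of% η_nat, Category.assoc]
  simp only [whiskerLeft_comp, Category.assoc]
  rw [← whiskerLeft_comp 𝖰 (𝖯 ◁ 𝖯 ◁ ε' Z), S_nat]
  simp only [← whiskerLeft_comp]
  rw [reassoc_of% S_braid, whiskerLeft_comp 𝖯 (S (𝖰 ⊗ Z))]

theorem P_U_T_T (Z : Obj) :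
    𝖯 ◁ U Z ≫ T (𝖰 ⊗ Z) ≫ 𝖰 ◁ T Z = T (𝖰 ⊗ Z) ≫ 𝖰 ◁ T Z ≫ U (𝖯 ⊗ Z) := by
  have hL : 𝖯 ◁ U Z ≫ T (𝖰 ⊗ Z) ≫ 𝖰 ◁ T Z = η (𝖯 ⊗ 𝖰 ⊗ 𝖰 ⊗ Z) ≫
      𝖰 ◁ (S (𝖰 ⊗ 𝖰 ⊗ Z) ≫ 𝖯 ◁ T (𝖰 ⊗ Z) ≫ T (𝖯 ⊗ 𝖰 ⊗ Z) ≫ 𝖰 ◁ 𝖯 ◁ ε' Z) := by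
    rw [U_transpose']
    simp only [whiskerLeft_comp, Category.assoc]
    rw [reassoc_of% T_nat, reassoc_of% T_nat, reassoc_of% η_T, ← whiskerLeft_comp 𝖰 (𝖯 ◁ 𝖰 ◁ ε' Z),
      T_nat, whiskerLeft_comp]
  have hR : T (𝖰 ⊗ Z) ≫ 𝖰 ◁ T Z ≫ U (𝖯 ⊗ Z) = η (𝖯 ⊗ 𝖰 ⊗ 𝖰 ⊗ Z) ≫
      𝖰 ◁ (𝖯 ◁ T (𝖰 ⊗ Z) ≫ T (𝖯 ⊗ 𝖰 ⊗ Z) ≫ 𝖰 ◁ S (𝖰 ⊗ Z) ≫ 𝖰 ◁ 𝖯 ◁ ε' Z) := by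
    rw [U_transpose' (𝖯 ⊗ Z), reassoc_of% η_nat, reassoc_of% η_nat, ← whiskerLeft_comp,
      ← whiskerLeft_comp, reassoc_of% T_nat, ← whiskerLeft_comp, T_ε']
    simp only [whiskerLeft_comp]
  rw [hL, hR, reassoc_of% S_T_T]

theorem U_braid (Z : Obj) :
    U (𝖰 ⊗ Z) ≫ 𝖰 ◁ U Z ≫ U (𝖰 ⊗ Z) = 𝖰 ◁ U Z ≫ U (𝖰 ⊗ Z) ≫ 𝖰 ◁ U Z := by
  have h : 𝖰 ◁ U Z ≫ U (𝖰 ⊗ Z) =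
      η (𝖰 ⊗ 𝖰 ⊗ 𝖰 ⊗ Z) ≫ 𝖰 ◁ (T (𝖰 ⊗ 𝖰 ⊗ Z) ≫ 𝖰 ◁ T (𝖰 ⊗ Z) ≫ 𝖰 ◁ 𝖰 ◁ ε' Z) := by
    rw [U_transpose' (𝖰 ⊗ Z), reassoc_of% η_nat, ← whiskerLeft_comp, reassoc_of% T_nat,
      ← whiskerLeft_comp, U_ε']
    simp only [whiskerLeft_comp]
  rw [← Category.assoc (𝖰 ◁ U Z), h, reassoc_of% η_nat, Category.assoc]
  simp only [whiskerLeft_comp, Category.assoc]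
  rw [← whiskerLeft_comp 𝖰 (𝖰 ◁ 𝖰 ◁ ε' Z), U_nat]
  simp only [← whiskerLeft_comp]
  rw [whiskerLeft_comp 𝖰 (T (𝖰 ⊗ Z)) (𝖰 ◁ ε' Z), reassoc_of% P_U_T_T]

/-! ### Dots -/

/-- Write the dot as a right curl whose loop encloses a downward strand next to the second upward
strand, and split the identity of that `𝖰𝖯` as `T' ≫ T + ε ≫ η`. In the first term the braid
relation pulls the second strand through the curl. In the second term the zigzags straighten
everything to one crossing. -/
theorem X_slide (Z : Obj) : X (𝖯 ⊗ Z) = S Z ≫ 𝖯 ◁ X Z ≫ S Z + S Z := by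
  have h1 : 𝖯 ◁ 𝖯 ◁ (T' Z ≫ T Z) + 𝖯 ◁ 𝖯 ◁ (ε Z ≫ η Z) = 𝟙 _ := by
    rw [T'_T, ← MonoidalPreadditive.whiskerLeft_add, ← MonoidalPreadditive.whiskerLeft_add,
      sub_add_cancel, whiskerLeft_id, whiskerLeft_id]
  have h2 : 𝖯 ◁ η' (𝖯 ⊗ Z) ≫ S (𝖰 ⊗ 𝖯 ⊗ Z) ≫ 𝖯 ◁ 𝖯 ◁ (T' Z ≫ T Z) ≫ 𝖯 ◁ ε' (𝖯 ⊗ Z) =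
      S Z ≫ 𝖯 ◁ X Z ≫ S Z := by
    rw [X_eq]
    simp only [whiskerLeft_comp, Category.assoc]
    rw [← reassoc_of% S_nat, ← whiskerLeft_comp 𝖯 (𝖯 ◁ T Z), T_ε',
      ← whiskerLeft_comp_assoc 𝖯 (η' (𝖯 ⊗ Z)), η'_T']
    simp only [whiskerLeft_comp, Category.assoc]
    rw [← reassoc_of% S_braid, reassoc_of% S_nat, S_nat]
  have h3 : 𝖯 ◁ η' (𝖯 ⊗ Z) ≫ S (𝖰 ⊗ 𝖯 ⊗ Z) ≫ 𝖯 ◁ 𝖯 ◁ (ε Z ≫ η Z) ≫ 𝖯 ◁ ε' (𝖯 ⊗ Z) = S Z := by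
    simp only [whiskerLeft_comp, Category.assoc]
    rw [← reassoc_of% S_nat, ← whiskerLeft_comp_assoc, zigP, ← whiskerLeft_comp, zigP']
    simp
  rw [X_eq, ← h2, ← h3, ← Preadditive.comp_add, ← Preadditive.comp_add, ← Preadditive.add_comp, h1,
    Category.id_comp]

theorem X_S (Z : Obj) : X (𝖯 ⊗ Z) ≫ S Z = S Z ≫ 𝖯 ◁ X Z + 𝟙 _ := by
  rw [X_slide, Preadditive.add_comp, Category.assoc, Category.assoc, S_sq, Category.comp_id]

theorem S_X (Z : Obj) : S Z ≫ X (𝖯 ⊗ Z) = 𝖯 ◁ X Z ≫ S Z + 𝟙 _ := by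
  rw [X_slide, Preadditive.comp_add, reassoc_of% S_sq, S_sq]

/-- The mate of `X_S`: bending turns the identity term there into a cap followed by a cup. Likewise
`T_X` is the mate of `S_X`. -/
theorem X_T' (Z : Obj) : 𝖰 ◁ X Z ≫ T' Z = T' Z ≫ X (𝖰 ⊗ Z) + ε Z ≫ η' Z := by
  rw [T'_transpose, ← whiskerLeft_comp_assoc, ← reassoc_of% X_nat, X_S, Preadditive.comp_add,
    MonoidalPreadditive.whiskerLeft_add, Preadditive.add_comp, Category.comp_id, ε_nat,
    Category.assoc]
  simp only [whiskerLeft_comp, Category.assoc, ε_nat]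

theorem T_X (Z : Obj) : T Z ≫ 𝖰 ◁ X Z = X (𝖰 ⊗ Z) ≫ T Z + ε' Z ≫ η Z := by
  rw [T_transpose, Category.assoc, ← whiskerLeft_comp, Category.assoc, X_nat, reassoc_of% S_X,
    Preadditive.add_comp, MonoidalPreadditive.whiskerLeft_add, Preadditive.comp_add,
    Category.id_comp, ← η_nat, reassoc_of% η_nat, ← whiskerLeft_comp, Category.assoc]

/-- The dot on a downward strand, the mate of the dot on an upward strand. -/
def Y (Z : Obj) : 𝖰 ⊗ Z ⟶ 𝖰 ⊗ Z := 𝖰 ◁ (η' Z ≫ X (𝖰 ⊗ Z)) ≫ ε (𝖰 ⊗ Z)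

theorem Y_nat (f : Z ⟶ W) : 𝖰 ◁ f ≫ Y W = Y Z ≫ 𝖰 ◁ f := by
  unfold Y
  rw [← whiskerLeft_comp_assoc, reassoc_of% η'_nat, X_nat, Category.assoc, ← ε_nat,
    ← whiskerLeft_comp_assoc, Category.assoc]

theorem Y_ε (Z : Obj) : Y (𝖯 ⊗ Z) ≫ ε Z = 𝖰 ◁ X Z ≫ ε Z := by
  unfold Y
  rw [Category.assoc, ← ε_nat, ← whiskerLeft_comp_assoc, Category.assoc, ← X_nat,
    reassoc_of% zigP]

/-- Sliding a crossing along two nested caps is a half turn. With `cancel_ε_ε` this carries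
relations from upward to downward strands. -/
theorem S_ε_ε (Z : Obj) : 𝖰 ◁ 𝖰 ◁ S Z ≫ 𝖰 ◁ ε (𝖯 ⊗ Z) ≫ ε Z =
    U (𝖯 ⊗ 𝖯 ⊗ Z) ≫ 𝖰 ◁ ε (𝖯 ⊗ Z) ≫ ε Z := by
  rw [← whiskerLeft_comp_assoc, S_ε, whiskerLeft_comp_assoc, ε_nat, reassoc_of% T'_ε]

theorem zigQQ (Z : Obj) : 𝖰 ◁ 𝖰 ◁ (η' Z ≫ 𝖯 ◁ η' (𝖰 ⊗ Z)) ≫ 𝖰 ◁ ε (𝖯 ⊗ 𝖰 ⊗ 𝖰 ⊗ Z) ≫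
    ε (𝖰 ⊗ 𝖰 ⊗ Z) = 𝟙 _ := by
  simp only [whiskerLeft_comp, Category.assoc]
  rw [← whiskerLeft_comp_assoc 𝖰 (𝖰 ◁ 𝖯 ◁ η' (𝖰 ⊗ Z)), ε_nat, whiskerLeft_comp_assoc, zigQ,
    Category.comp_id, ← whiskerLeft_comp, zigQ, whiskerLeft_id]

/-- Natural operators on two downward strands are determined by their composites with caps. -/
theorem cancel_ε_ε {f g : ∀ Z, 𝖰 ⊗ 𝖰 ⊗ Z ⟶ 𝖰 ⊗ 𝖰 ⊗ Z}
    (hf : ∀ {Z W : Obj} (e : Z ⟶ W), 𝖰 ◁ 𝖰 ◁ e ≫ f W = f Z ≫ 𝖰 ◁ 𝖰 ◁ e)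
    (hg : ∀ {Z W : Obj} (e : Z ⟶ W), 𝖰 ◁ 𝖰 ◁ e ≫ g W = g Z ≫ 𝖰 ◁ 𝖰 ◁ e)
    (h : ∀ Z, f (𝖯 ⊗ 𝖯 ⊗ Z) ≫ 𝖰 ◁ ε (𝖯 ⊗ Z) ≫ ε Z = g (𝖯 ⊗ 𝖯 ⊗ Z) ≫ 𝖰 ◁ ε (𝖯 ⊗ Z) ≫ ε Z)
    (Z : Obj) : f Z = g Z := by
  rw [← Category.comp_id (f Z), ← Category.comp_id (g Z), ← zigQQ Z, ← reassoc_of% hf,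
    ← reassoc_of% hg, h]

theorem U_sq (Z : Obj) : U Z ≫ U Z = 𝟙 _ := by
  refine cancel_ε_ε (f := fun Z => U Z ≫ U Z) (g := fun Z => 𝟙 _) ?_ ?_ ?_ Z
  · intro Z W e
    rw [reassoc_of% U_nat, U_nat, Category.assoc]
  · intros; simp
  · intro Z
    rw [Category.assoc, ← S_ε_ε, ← reassoc_of% U_nat, ← S_ε_ε, ← whiskerLeft_comp_assoc,
      ← whiskerLeft_comp, S_sq]
    simp

/-- Nested caps pair the left downward strand with the right upward one, so the half turn of `X_S`
exchanges the two strands. This accounts for the sign opposite to that of `X_S`. -/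
theorem Y_U (Z : Obj) : Y (𝖰 ⊗ Z) ≫ U Z = U Z ≫ 𝖰 ◁ Y Z - 𝟙 _ := by
  rw [eq_sub_iff_add_eq]
  have hX (Z : Obj) : 𝖰 ◁ 𝖰 ◁ X (𝖯 ⊗ Z) ≫ 𝖰 ◁ ε (𝖯 ⊗ Z) ≫ ε Z =
      𝖰 ◁ Y (𝖯 ⊗ 𝖯 ⊗ Z) ≫ 𝖰 ◁ ε (𝖯 ⊗ Z) ≫ ε Z := by
    rw [← whiskerLeft_comp_assoc, ← Y_ε, whiskerLeft_comp_assoc]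
  have hY (Z : Obj) : 𝖰 ◁ 𝖰 ◁ 𝖯 ◁ X Z ≫ 𝖰 ◁ ε (𝖯 ⊗ Z) ≫ ε Z =
      Y (𝖰 ⊗ 𝖯 ⊗ 𝖯 ⊗ Z) ≫ 𝖰 ◁ ε (𝖯 ⊗ Z) ≫ ε Z := by
    rw [← whiskerLeft_comp_assoc, ε_nat, whiskerLeft_comp_assoc, ← Y_ε, reassoc_of% Y_nat]
  refine cancel_ε_ε (f := fun Z => Y (𝖰 ⊗ Z) ≫ U Z + 𝟙 _) (g := fun Z => U Z ≫ 𝖰 ◁ Y Z) ?_ ?_ ?_ Z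
  · intro Z W e
    rw [Preadditive.add_comp, Preadditive.comp_add, reassoc_of% Y_nat, U_nat]
    simp
  · intro Z W e
    rw [reassoc_of% U_nat, ← whiskerLeft_comp, Y_nat, whiskerLeft_comp, Category.assoc]
  · intro Z
    have h := congrArg (fun f => 𝖰 ◁ 𝖰 ◁ f ≫ 𝖰 ◁ ε (𝖯 ⊗ Z) ≫ ε Z) (X_S Z)
    simp only [MonoidalPreadditive.whiskerLeft_add, whiskerLeft_comp, Preadditive.add_comp,
      Category.assoc, whiskerLeft_id, Category.id_comp] at h ⊢
    rw [S_ε_ε, hY, reassoc_of% Y_nat, S_ε_ε] at h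
    rw [← h, ← hX, reassoc_of% U_nat]

end Heis

namespace Heis
open HomSpace
local notation "𝖯" => Obj.P
local notation "𝖰" => Obj.Q

variable {Z W V : Obj}

/-! ### Bubbles -/

/-- `n` dots on an upward strand, as an operator. -/
def Xs (n : ℕ) (Z : Obj) : 𝖯 ⊗ Z ⟶ 𝖯 ⊗ Z := dots n ▷ Z

theorem whiskerLeft_sub' (A : Obj) (f g : Z ⟶ W) : A ◁ (f - g) = A ◁ f - A ◁ g := by
  rw [eq_sub_iff_add_eq, ← MonoidalPreadditive.whiskerLeft_add, sub_add_cancel]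

theorem Xs_zero (Z : Obj) : Xs 0 Z = 𝟙 _ := by simp [Xs, dots]

theorem Xs_succ (n : ℕ) (Z : Obj) : Xs (n + 1) Z = Xs n Z ≫ X Z := by
  simp [Xs, dots, X, comp_whiskerRight]

theorem Xs_succ' (n : ℕ) (Z : Obj) : Xs (n + 1) Z = X Z ≫ Xs n Z := by
  induction n with
  | zero => rw [Xs_succ, Xs_zero, Category.id_comp, Category.comp_id]
  | succ n ih => rw [Xs_succ, ih, Category.assoc, ← Xs_succ, ih]

theorem Xs_add (m n : ℕ) (Z : Obj) : Xs (m + n) Z = Xs m Z ≫ Xs n Z := by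
  induction n with
  | zero => rw [Xs_zero, Category.comp_id, add_zero]
  | succ n ih => rw [← add_assoc, Xs_succ, ih, Category.assoc, ← Xs_succ]

theorem Xs_nat (n : ℕ) (f : Z ⟶ W) : 𝖯 ◁ f ≫ Xs n W = Xs n Z ≫ 𝖯 ◁ f :=
  whisker_exchange (dots n) f

/-- The clockwise circle with `n` dots, on the left of a word. -/
def bub (n : ℕ) (Z : Obj) : Z ⟶ Z := η' Z ≫ Xs n (𝖰 ⊗ Z) ≫ ε' Z

/-- The counterclockwise circle with `n` dots, on the left of a word. -/
def bubC (n : ℕ) (Z : Obj) : Z ⟶ Z := η Z ≫ 𝖰 ◁ Xs n Z ≫ ε Z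

theorem bub_nat (n : ℕ) (f : Z ⟶ W) : f ≫ bub n W = bub n Z ≫ f := by
  unfold bub
  rw [reassoc_of% η'_nat, reassoc_of% Xs_nat, ε'_nat]; simp

theorem bubC_zero (Z : Obj) : bubC 0 Z = 𝟙 _ := by
  unfold bubC; rw [Xs_zero, whiskerLeft_id, Category.id_comp, η_ε]

/-- Each dot that passes the crossing splits off an identity. In the term where this happens at the
dot number `i`, the remaining `n - 1` dots are divided between the two strands. `Xs_T'` and `T_Xs`
have the same form, with turnbacks in place of identities. -/
theorem S_Xs (n : ℕ) (Z : Obj) : S Z ≫ 𝖯 ◁ Xs n Z = Xs n (𝖯 ⊗ Z) ≫ S Z -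
    ∑ i ∈ Finset.range n, Xs i (𝖯 ⊗ Z) ≫ 𝖯 ◁ Xs (n - 1 - i) Z := by
  have h1 : S Z ≫ 𝖯 ◁ X Z = X (𝖯 ⊗ Z) ≫ S Z - 𝟙 _ := by rw [X_S]; abel
  induction n with
  | zero => simp [Xs_zero]
  | succ n ih =>
    rw [Xs_succ n Z, whiskerLeft_comp, reassoc_of% ih, Preadditive.sub_comp, Category.assoc, h1,
      Preadditive.comp_sub, Xs_succ n (𝖯 ⊗ Z), Category.comp_id, Finset.sum_range_succ, Preadditive.sum_comp,
      Category.assoc, sub_sub, add_comm (Xs n (𝖯 ⊗ Z))]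
    congr 2
    · refine Finset.sum_congr rfl fun i hi => ?_
      rw [Finset.mem_range] at hi
      rw [Category.assoc, ← whiskerLeft_comp, ← Xs_succ]
      congr 3; omega
    · simp [Xs_zero]

theorem Xs_T' (n : ℕ) (Z : Obj) : 𝖰 ◁ Xs n Z ≫ T' Z = T' Z ≫ Xs n (𝖰 ⊗ Z) +
    ∑ i ∈ Finset.range n, 𝖰 ◁ Xs i Z ≫ ε Z ≫ η' Z ≫ Xs (n - 1 - i) (𝖰 ⊗ Z) := by
  induction n with
  | zero => simp [Xs_zero]
  | succ n ih =>
    rw [Xs_succ n Z, whiskerLeft_comp, Category.assoc, X_T', Preadditive.comp_add, reassoc_of% ih,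
      Preadditive.add_comp, Category.assoc, ← Xs_succ, Finset.sum_range_succ, Preadditive.sum_comp,
      add_assoc]
    congr 2
    · refine Finset.sum_congr rfl fun i hi => ?_
      rw [Finset.mem_range] at hi
      simp only [Category.assoc]
      rw [← Xs_succ]
      congr 4; omega
    · simp [Xs_zero]

theorem T_Xs (n : ℕ) (Z : Obj) : T Z ≫ 𝖰 ◁ Xs n Z = Xs n (𝖰 ⊗ Z) ≫ T Z +
    ∑ i ∈ Finset.range n, Xs i (𝖰 ⊗ Z) ≫ ε' Z ≫ η Z ≫ 𝖰 ◁ Xs (n - 1 - i) Z := by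
  induction n with
  | zero => simp [Xs_zero]
  | succ n ih =>
    have h : (∑ i ∈ Finset.range n, Xs i (𝖰 ⊗ Z) ≫ ε' Z ≫ η Z ≫ 𝖰 ◁ Xs (n - 1 - i) Z) ≫ 𝖰 ◁ X Z =
        ∑ i ∈ Finset.range n, Xs i (𝖰 ⊗ Z) ≫ ε' Z ≫ η Z ≫ 𝖰 ◁ Xs (n - i) Z := by
      rw [Preadditive.sum_comp]
      refine Finset.sum_congr rfl fun i hi => ?_
      rw [Finset.mem_range] at hi
      simp only [Category.assoc]
      rw [← whiskerLeft_comp, ← Xs_succ, show n - 1 - i + 1 = n - i by omega]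
    rw [Xs_succ n Z, whiskerLeft_comp, reassoc_of% ih, Preadditive.add_comp, Category.assoc, T_X,
      h, Preadditive.comp_add, Xs_succ n (𝖰 ⊗ Z), Finset.sum_range_succ, Category.assoc]
    simp only [Nat.add_sub_cancel, Nat.sub_self, Xs_zero, whiskerLeft_id, Category.comp_id]
    abel

/-- The counterclockwise circles in terms of the clockwise ones. -/
theorem bubC_succ (n : ℕ) (Z : Obj) : bubC (n + 1) Z =
    ∑ i ∈ Finset.range n, bubC i Z ≫ bub (n - 1 - i) Z := by
  unfold bubC bub
  -- The last dot is turned into a crossing under the other cap, and the other `n` dots slide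
  -- through it. The term in which all of them pass contains a left curl and vanishes.
  rw [Xs_succ, whiskerLeft_comp, Category.assoc, ← T'_ε', reassoc_of% Xs_T', Preadditive.add_comp,
    Preadditive.comp_add, Category.assoc, reassoc_of% curl_T', Limits.zero_comp, zero_add,
    Preadditive.sum_comp, Preadditive.comp_sum]
  simp

/-- A right curl with `n` dots on the curl. -/
theorem curl_Xs (n : ℕ) (Z : Obj) :
    𝖯 ◁ η' Z ≫ S (𝖰 ⊗ Z) ≫ 𝖯 ◁ Xs n (𝖰 ⊗ Z) ≫ 𝖯 ◁ ε' Z = Xs (n + 1) Z -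
      ∑ i ∈ Finset.range n, Xs i Z ≫ 𝖯 ◁ bub (n - 1 - i) Z := by
  rw [reassoc_of% S_Xs, Preadditive.sub_comp, Preadditive.comp_sub, Preadditive.sum_comp,
    Preadditive.comp_sum, Category.assoc, reassoc_of% Xs_nat, Xs_succ, X_eq]
  congr 1
  refine Finset.sum_congr rfl fun i _ => ?_
  rw [Category.assoc, reassoc_of% Xs_nat, bub]
  simp only [whiskerLeft_comp]

/-- Moving a clockwise circle through an upward strand. -/
theorem bub_slide (n : ℕ) (Z : Obj) : bub n (𝖯 ⊗ Z) = 𝖯 ◁ bub n Z + Xs n Z +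
    ∑ i ∈ Finset.range n, (Xs (n - 1 - i + 1) Z -
      ∑ j ∈ Finset.range (n - 1 - i), Xs j Z ≫ 𝖯 ◁ bub (n - 1 - i - 1 - j) Z) ≫ Xs i Z := by
  have h1 : T' Z ≫ T Z = 𝟙 _ - ε Z ≫ η Z := T'_T Z
  -- The circle overlapping the strand from the left: resolving the double crossing `T' ≫ T` gives
  -- the free circle minus the strand that has absorbed the dots.
  have h2 : 𝖯 ◁ η' Z ≫ S (𝖰 ⊗ Z) ≫ Xs n (𝖯 ⊗ 𝖰 ⊗ Z) ≫ S (𝖰 ⊗ Z) ≫ 𝖯 ◁ ε' Z =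
      bub n (𝖯 ⊗ Z) - Xs n Z := by
    rw [← T_ε', ← reassoc_of% η'_T', reassoc_of% Xs_nat, ← whiskerLeft_comp_assoc, h1,
      whiskerLeft_sub', Preadditive.sub_comp, Preadditive.comp_sub,
      Preadditive.comp_sub, whiskerLeft_id, Category.id_comp, whiskerLeft_comp_assoc,
      ← reassoc_of% Xs_nat, reassoc_of% zigP, zigP',
      Category.comp_id, bub]
  -- The circle to the right of the strand is pulled over it by inserting `S ≫ S = 𝟙`; moving the
  -- dots to the outer strand then costs the sum in `S_Xs`.
  have h3 : 𝖯 ◁ bub n Z = 𝖯 ◁ η' Z ≫ S (𝖰 ⊗ Z) ≫ S (𝖰 ⊗ Z) ≫ 𝖯 ◁ Xs n (𝖰 ⊗ Z) ≫ 𝖯 ◁ ε' Z := by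
    rw [reassoc_of% S_sq, bub]; simp
  rw [h3, reassoc_of% S_Xs, Preadditive.sub_comp, Preadditive.comp_sub, Preadditive.comp_sub,
    Category.assoc, h2, Preadditive.sum_comp, Preadditive.comp_sum, Preadditive.comp_sum]
  rw [sub_sub, add_assoc, ← sub_eq_iff_eq_add]
  congr 2
  refine Finset.sum_congr rfl fun i _ => ?_
  rw [← curl_Xs]
  simp only [Category.assoc]
  rw [Xs_nat, reassoc_of% Xs_nat]

end Heis

/-! ### Reduction of the trace of the envelopes to the trace of the category of words -/

section

universe v u
variable {C : Type u} [Category.{v} C] [Preadditive C] [Linear ℂ C]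

theorem trClass_add {X : C} (f g : X ⟶ X) : trClass (f + g) = trClass f + trClass g :=
  map_add (trClassLin X) f g

theorem trClass_smul {X : C} (r : ℂ) (f : X ⟶ X) : trClass (r • f) = r • trClass f :=
  map_smul (trClassLin X) r f

theorem trClass_sum {X : C} {ι : Type*} (s : Finset ι) (f : ι → (X ⟶ X)) :
    trClass (∑ i ∈ s, f i) = ∑ i ∈ s, trClass (f i) :=
  map_sum (trClassLin X) f s

-- An endomorphism of the image of an idempotent factors through the inclusion and projection, and
-- cyclicity moves it to the ambient object.
open Idempotents in
theorem trClass_karoubi {A : Karoubi C} (f : A ⟶ A) :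
    trClass f = trClass ((toKaroubi C).map f.f) := by
  have h : f = A.decompId_i ≫ ((toKaroubi C).map f.f ≫ A.decompId_p) := by
    ext; simp
  have h2 : ((toKaroubi C).map f.f ≫ A.decompId_p) ≫ A.decompId_i = (toKaroubi C).map f.f := by
    ext; simp
  rw [← h2, ← trClass_comm, ← h]

end

namespace Heis
open HomSpace

/-- The class of an endomorphism of an object of the additive envelope. -/
def clsMat {M : HPrime} (f : M ⟶ M) : TrH := trClass ((Idempotents.toKaroubi HPrime).map f)

theorem clsMat_comm {M N : HPrime} (f : M ⟶ N) (g : N ⟶ M) : clsMat (f ≫ g) = clsMat (g ≫ f) := by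
  unfold clsMat
  rw [Functor.map_comp, Functor.map_comp, trClass_comm]

theorem clsMat_sum {M : HPrime} {ι : Type*} (s : Finset ι) (f : ι → (M ⟶ M)) :
    clsMat (∑ i ∈ s, f i) = ∑ i ∈ s, clsMat (f i) := by
  unfold clsMat
  rw [Functor.map_sum, trClass_sum]

-- Insert the decomposition of the identity into projections and inclusions of the summands, and
-- apply cyclicity to each term.
open scoped Classical in
theorem clsMat_eq {M : HPrime} (f : M ⟶ M) :
    clsMat f = ∑ i, cls (f i i) := by
  let ι (i : M.ι) : (Mat_.embedding Obj).obj (M.X i) ⟶ M :=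
    MatEnv.mono (M := (Mat_.embedding Obj).obj (M.X i)) (fun _ => i) (fun _ => 𝟙 (M.X i))
  let π (i : M.ι) : M ⟶ (Mat_.embedding Obj).obj (M.X i) :=
    fun j _ => if h : j = i then eqToHom (congrArg M.X h) else 0
  have h1 (i : M.ι) : ι i ≫ f ≫ π i = (Mat_.embedding Obj).map (f i i) := by
    ext ⟨⟩ ⟨⟩
    refine (MatEnv.mono_comp (M := (Mat_.embedding Obj).obj (M.X i)) _ _ _ _ _).trans ?_
    refine (Category.id_comp _).trans ?_
    refine (Finset.sum_eq_single (s := Finset.univ) (f := fun j => f i j ≫ π i j PUnit.unit)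
      i ?_ ?_).trans ?_
    rotate_left 2
    · simp only [π, dite_true]
      exact Category.comp_id _
    · intro j _ hj; simp [π, hj]
    · simp
  have h2 : ∑ i, π i ≫ ι i = 𝟙 M := by
    ext j k
    have h3 : (∑ i, π i ≫ ι i) j k = ∑ i, (π i ≫ ι i) j k :=
      map_sum (AddMonoidHom.mk' (fun e : M ⟶ M => e j k) fun _ _ => rfl) _ _
    have h5 (i : M.ι) : (π i ≫ ι i) j k = π i j PUnit.unit ≫ ι i PUnit.unit k := by
      rw [Mat_.comp_apply]
      exact Fintype.sum_unique (ι := PUnit) _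
    rw [h3, Finset.sum_eq_single j]
    · rw [h5]
      by_cases hk : j = k
      · subst hk
        rw [Mat_.id_apply_self]
        simp only [π, ι, MatEnv.mono, dite_true]
        exact (Category.id_comp _).trans (Category.id_comp _)
      · rw [Mat_.id_apply_of_ne _ _ _ hk]
        simp [π, ι, MatEnv.mono, hk]
    · intro i _ hi
      rw [h5]
      simp [π, hi.symm]
    · simp
  have h4 : f = ∑ i, (f ≫ π i) ≫ ι i := by
    simp only [Category.assoc]
    rw [← Preadditive.comp_sum, h2, Category.comp_id]
  conv_lhs => rw [h4]
  rw [clsMat_sum]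
  refine Finset.sum_congr rfl fun i _ => ?_
  rw [clsMat_comm, h1]
  rfl

theorem TrH_induction {p : TrH → Prop} (h0 : p 0) (hadd : ∀ x y, p x → p y → p (x + y))
    (hc : ∀ (X : Obj) (f : X ⟶ X), p (cls f)) (x : TrH) : p x := by
  refine catTrace_induction h0 hadd (fun A f => ?_) x
  rw [trClass_karoubi]
  change p (clsMat f.f)
  rw [clsMat_eq]
  exact Finset.sum_induction _ p hadd h0 fun i _ => hc _ _

theorem cls_comm {X Y : Obj} (f : X ⟶ Y) (g : Y ⟶ X) : cls (f ≫ g) = cls (g ≫ f) := by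
  unfold cls
  rw [Functor.map_comp, Functor.map_comp, trClass_comm]

theorem cls_conj {X Y : Obj} (i : X ≅ Y) (f : X ⟶ X) (g : Y ⟶ Y) (h : f ≫ i.hom = i.hom ≫ g) :
    cls f = cls g := by
  have h1 : f = i.hom ≫ (g ≫ i.inv) := by rw [← Category.assoc, ← h]; simp
  rw [h1, cls_comm]; simp

theorem cls_add {X : Obj} (f g : X ⟶ X) : cls (f + g) = cls f + cls g := by
  unfold cls; rw [← trClass_add]; rfl

theorem cls_smul {X : Obj} (r : ℂ) (f : X ⟶ X) : cls (r • f) = r • cls f := by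
  unfold cls; rw [← trClass_smul]; rfl

/-- The embedding of words is monoidal only up to isomorphism: a tensor product of one-entry tuples
is indexed by pairs. The class is therefore compared along the reindexing `i`. -/
theorem cls_tensor {X Y : Obj} (f : X ⟶ X) (g : Y ⟶ Y) : cls (f ⊗ₘ g) = cls f * cls g := by
  change _ = trMul (trClass (incl.map f)) (trClass (incl.map g))
  rw [trMul_trClass]
  let i : (Mat_.embedding Obj).obj (X ⊗ Y) ≅
      MatEnv.tObj ((Mat_.embedding Obj).obj X) ((Mat_.embedding Obj).obj Y) :=
    MatEnv.monoIso (M := (Mat_.embedding Obj).obj (X ⊗ Y))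
      (N := MatEnv.tObj ((Mat_.embedding Obj).obj X) ((Mat_.embedding Obj).obj Y))
      (fun _ => (PUnit.unit, PUnit.unit)) (Equiv.prodPUnit PUnit).symm.bijective
      (fun _ => Iso.refl (X ⊗ Y))
  have hi : 𝟙 _ ≫ i.hom = i.hom ≫ (𝟙 ((Mat_.embedding Obj).obj X) ⊗ₘ
      𝟙 ((Mat_.embedding Obj).obj Y)) := by
    rw [id_tensorHom_id]
    exact (Category.id_comp _).trans (Category.comp_id _).symm
  refine trClass_conj (KarEnv.restrIso (P := incl.obj (X ⊗ Y)) (Q := incl.obj X ⊗ incl.obj Y) i hi)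
    _ _ ?_
  refine Idempotents.Karoubi.hom_ext _ _ ?_
  change (Mat_.embedding Obj).map (f ⊗ₘ g) ≫ 𝟙 _ ≫ i.hom =
    (𝟙 _ ≫ i.hom) ≫ MatEnv.tHom ((Mat_.embedding Obj).map f) ((Mat_.embedding Obj).map g)
  rw [Category.id_comp]
  ext ⟨⟩ ⟨⟨⟩, ⟨⟩⟩
  refine (MatEnv.comp_mono (K := (Mat_.embedding Obj).obj (X ⊗ Y))
    (M := (Mat_.embedding Obj).obj (X ⊗ Y))
    (N := MatEnv.tObj ((Mat_.embedding Obj).obj X) ((Mat_.embedding Obj).obj Y)) _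
    (fun _ => (PUnit.unit, PUnit.unit)) (Equiv.prodPUnit PUnit).symm.injective
    (fun _ => 𝟙 (X ⊗ Y)) PUnit.unit PUnit.unit).trans ?_
  refine Eq.trans ?_ (MatEnv.mono_comp (M := (Mat_.embedding Obj).obj (X ⊗ Y))
    (N := MatEnv.tObj ((Mat_.embedding Obj).obj X) ((Mat_.embedding Obj).obj Y))
    (K := MatEnv.tObj ((Mat_.embedding Obj).obj X) ((Mat_.embedding Obj).obj Y))
    (fun _ => (PUnit.unit, PUnit.unit)) (fun _ => 𝟙 (X ⊗ Y)) _ PUnit.unit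
    (PUnit.unit, PUnit.unit)).symm
  exact (Category.comp_id (f ⊗ₘ g)).trans (Category.id_comp (f ⊗ₘ g)).symm

theorem cls_id_one : cls (𝟙 (𝟙_ Obj)) = 1 := by
  unfold cls
  rw [CategoryTheory.Functor.map_id]
  rfl
end Heis

/-! ### Towers of degenerate affine Hecke algebras -/

/-- A tower of algebras with elements that satisfy the relations of the degenerate affine Hecke
algebras. The map `sh n` adds a strand in front, `x n` is a dot on the first strand and `s n` is
the crossing of the first two strands. -/
structure HeckeTower (E : ℕ → Type*) [∀ n, Ring (E n)] [∀ n, Algebra ℂ (E n)] where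
  sh : ∀ n, E n →ₐ[ℂ] E (n + 1)
  x : ∀ n, E (n + 1)
  s : ∀ n, E (n + 2)
  e : ℂ
  e_ne : e ≠ 0
  s_sq : ∀ n, s n * s n = 1
  braid : ∀ n, s (n + 1) * sh _ (s n) * s (n + 1) = sh _ (s n) * s (n + 1) * sh _ (s n)
  s_sh : ∀ n (a : E n), s n * sh _ (sh _ a) = sh _ (sh _ a) * s n
  x_sh : ∀ n (a : E n), x n * sh _ a = sh _ a * x n
  x_s : ∀ n, x (n + 1) * s n = s n * sh _ (x n) + e • 1

namespace HeckeTower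

variable {E : ℕ → Type*} [∀ n, Ring (E n)] [∀ n, Algebra ℂ (E n)] (H : HeckeTower E)

theorem s_x (n : ℕ) : H.s n * H.x (n + 1) = H.sh _ (H.x n) * H.s n + H.e • 1 := by
  have h := congrArg (fun a => H.s n * a * H.s n) (H.x_s n)
  simp only [mul_add, add_mul, ← mul_assoc, H.s_sq, one_mul, mul_smul_comm, smul_mul_assoc,
    mul_one] at h
  rw [mul_assoc, H.s_sq, mul_one] at h
  exact h

theorem x_pow_sh (n k : ℕ) (a : E n) : H.x n ^ k * H.sh _ a = H.sh _ a * H.x n ^ k :=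
  (Commute.pow_left (H.x_sh n a) k)

/-- The subalgebras generated by dots, crossings and a given subalgebra at the bottom. -/
def D (B : Subalgebra ℂ (E 0)) : ∀ n, Subalgebra ℂ (E n)
  | 0 => B
  | 1 => Algebra.adjoin ℂ (H.sh 0 '' B ∪ {H.x 0})
  | n + 2 => Algebra.adjoin ℂ (H.sh (n + 1) '' (D B (n + 1)) ∪ {H.x (n + 1), H.s n})

variable {H} {B : Subalgebra ℂ (E 0)}

theorem sh_mem {n : ℕ} {a : E n} (ha : a ∈ H.D B n) : H.sh n a ∈ H.D B (n + 1) := by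
  cases n with
  | zero => exact Algebra.subset_adjoin (Or.inl ⟨a, ha, rfl⟩)
  | succ n => exact Algebra.subset_adjoin (Or.inl ⟨a, ha, rfl⟩)

theorem x_mem (n : ℕ) : H.x n ∈ H.D B (n + 1) := by
  cases n with
  | zero => exact Algebra.subset_adjoin (Or.inr rfl)
  | succ n => exact Algebra.subset_adjoin (Or.inr (Or.inl rfl))

theorem s_mem (n : ℕ) : H.s n ∈ H.D B (n + 2) :=
  Algebra.subset_adjoin (Or.inr (Or.inr rfl))

/-! ### Elements in which the first strand crosses at most once. -/

variable (H B) in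
/-- The elements that are sums of elements in which the first strand is either separated from the
other ones or crosses only once. -/
inductive Dec : ∀ n, E (n + 1) → Prop
  | mono {n : ℕ} {a : E n} (ha : a ∈ H.D B n) (k : ℕ) : Dec n (H.sh n a * H.x n ^ k)
  | cross {n : ℕ} {a b : E (n + 1)} (ha : a ∈ H.D B (n + 1)) (hb : b ∈ H.D B (n + 1)) :
      Dec (n + 1) (H.sh _ a * H.s n * H.sh _ b)
  | add {n : ℕ} {a b : E (n + 1)} (ha : Dec n a) (hb : Dec n b) : Dec n (a + b)

namespace Dec

theorem ind {p : ∀ n, E (n + 1) → Prop}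
    (mono : ∀ n, ∀ a ∈ H.D B n, ∀ k, p n (H.sh n a * H.x n ^ k))
    (cross : ∀ n, ∀ a ∈ H.D B (n + 1), ∀ b ∈ H.D B (n + 1),
      p (n + 1) (H.sh _ a * H.s n * H.sh _ b))
    (add : ∀ n a b, p n a → p n b → p n (a + b)) {n : ℕ} {a : E (n + 1)} (h : Dec H B n a) :
    p n a := by
  induction h with
  | mono ha k => exact mono _ _ ha k
  | cross ha hb => exact cross _ _ ha _ hb
  | add _ _ h1 h2 => exact add _ _ _ h1 h2

theorem smul {n : ℕ} {a : E (n + 1)} (r : ℂ) (h : Dec H B n a) : Dec H B n (r • a) := by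
  induction h with
  | mono ha k =>
    rw [← smul_mul_assoc, ← map_smul]
    exact mono (Subalgebra.smul_mem _ ha r) k
  | cross ha hb =>
    rw [← smul_mul_assoc, ← smul_mul_assoc, ← map_smul]
    exact cross (Subalgebra.smul_mem _ ha r) hb
  | add _ _ h1 h2 => rw [smul_add]; exact h1.add h2

theorem sub {n : ℕ} {a b : E (n + 1)} (ha : Dec H B n a) (hb : Dec H B n b) :
    Dec H B n (a - b) := by
  rw [sub_eq_add_neg, ← neg_one_smul ℂ b]
  exact ha.add (hb.smul _)

theorem mul_sh {n : ℕ} {a : E (n + 1)} {b : E n} (h : Dec H B n a) (hb : b ∈ H.D B n) :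
    Dec H B n (a * H.sh n b) := by
  induction h with
  | mono ha k =>
    rw [mul_assoc, x_pow_sh, ← mul_assoc, ← map_mul]
    exact mono (mul_mem ha hb) k
  | cross ha hc =>
    rw [mul_assoc, ← map_mul]
    exact cross ha (mul_mem hc hb)
  | add _ _ h1 h2 => rw [add_mul]; exact (h1 hb).add (h2 hb)

theorem sh {n : ℕ} {a : E n} (ha : a ∈ H.D B n) : Dec H B n (H.sh n a) := by
  simpa using mono (H := H) ha 0

theorem mul_x {n : ℕ} {a : E (n + 1)} (h : Dec H B n a) : Dec H B n (a * H.x n) := by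
  induction h with
  | mono ha k =>
    rw [mul_assoc, ← pow_succ]
    exact mono ha _
  | @cross n a b ha hb =>
    rw [mul_assoc, ← x_sh, ← mul_assoc, mul_assoc (H.sh _ a), s_x, mul_add, add_mul, ← mul_assoc,
      ← map_mul]
    refine (cross (mul_mem ha (x_mem n)) hb).add ?_
    rw [mul_smul_comm, mul_one, smul_mul_assoc, ← map_mul]
    exact (sh (mul_mem ha hb)).smul _
  | add _ _ h1 h2 => rw [add_mul]; exact h1.add h2

theorem mono_mul_s {n : ℕ} {a : E (n + 1)} (ha : a ∈ H.D B (n + 1)) (k : ℕ) :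
    Dec H B (n + 1) (H.sh _ a * H.x (n + 1) ^ k * H.s n) := by
  induction k with
  | zero => simpa using cross ha (one_mem _)
  | succ k ih =>
    rw [pow_succ, mul_assoc, mul_assoc (H.x (n + 1) ^ k), x_s, mul_add, mul_add, ← mul_assoc,
      ← mul_assoc]
    refine Dec.add ?_ ?_
    · exact ih.mul_sh (x_mem n)
    · rw [mul_smul_comm, mul_smul_comm, mul_one]
      exact (mono ha k).smul _

/-- Replacing the final `sh (x n) * s n` by `s n * x (n + 1) - e` moves a dot to the far right and
leaves one dot fewer between the two crossings. -/
theorem s_pow_s {n : ℕ} {a : E (n + 1)} (ha : a ∈ H.D B (n + 1)) (k : ℕ) :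
    Dec H B (n + 1) (H.sh _ a * H.s n * H.sh _ (H.x n) ^ k * H.s n) := by
  induction k with
  | zero => rw [pow_zero, mul_one, mul_assoc, s_sq, mul_one]; exact sh ha
  | succ k ih =>
    have h : H.sh _ (H.x n) * H.s n = H.s n * H.x (n + 1) - H.e • 1 := by rw [s_x]; abel
    rw [pow_succ, mul_assoc, mul_assoc (H.sh _ (H.x n) ^ k), h, mul_sub, mul_sub, ← mul_assoc,
      ← mul_assoc]
    refine Dec.sub ih.mul_x ?_
    rw [mul_smul_comm, mul_smul_comm, mul_one, ← map_pow]
    exact (cross ha (pow_mem (x_mem n) k)).smul _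

/-- Here the first strand crosses twice. If the second strand is separated from the others inside
`b`, only its dots lie between the crossings. If it crosses once there, the braid relation leaves a
single crossing of the first strand. -/
theorem cross_mul_s {n : ℕ} {a b : E (n + 1)} (ha : a ∈ H.D B (n + 1)) (hb : Dec H B n b) :
    Dec H B (n + 1) (H.sh _ a * H.s n * H.sh _ b * H.s n) := by
  induction hb with
  | @mono n d hd k =>
    rw [map_mul, ← mul_assoc, mul_assoc (H.sh _ a), s_sh, ← mul_assoc, ← map_mul, map_pow]
    exact s_pow_s (mul_mem ha (sh_mem hd)) k
  | @cross n d f hd hf =>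
    have h : H.sh _ a * H.s (n + 1) * H.sh _ (H.sh _ d * H.s n * H.sh _ f) * H.s (n + 1) =
        H.sh _ (a * H.sh _ d * H.s n) * H.s (n + 1) * H.sh _ (H.s n * H.sh _ f) := by
      simp only [map_mul, ← mul_assoc]
      rw [mul_assoc (H.sh _ a) (H.s (n + 1)), s_sh]
      simp only [mul_assoc]
      rw [← s_sh]
      simp only [← mul_assoc]
      rw [mul_assoc _ (H.s (n + 1)) (H.sh _ (H.s n)), mul_assoc _ _ (H.s (n + 1)), braid]
      simp only [← mul_assoc]
    rw [h]
    exact cross (mul_mem (mul_mem ha (sh_mem hd)) (s_mem n)) (mul_mem (s_mem n) (sh_mem hf))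
  | add _ _ h1 h2 => rw [map_add, mul_add, add_mul]; exact (h1 ha).add (h2 ha)

theorem mul_s {n : ℕ} (hn : ∀ b ∈ H.D B (n + 1), Dec H B n b) {a : E (n + 2)}
    (h : Dec H B (n + 1) a) : Dec H B (n + 1) (a * H.s n) := by
  -- Generalized over the index, to allow induction on `Dec`; on a single strand there is no
  -- crossing and nothing is claimed.
  have key (m : ℕ) (a : E (m + 1)) (h : Dec H B m a) : match m, a with
      | 0, _ => True
      | n + 1, a => (∀ b ∈ H.D B (n + 1), Dec H B n b) → Dec H B (n + 1) (a * H.s n) := by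
    induction h with
    | @mono n _ ha k =>
      cases n with
      | zero => trivial
      | succ n => exact fun _ => mono_mul_s ha k
    | cross ha hb => exact fun hn => cross_mul_s ha (hn _ hb)
    | @add n _ _ _ _ h1 h2 =>
      cases n with
      | zero => trivial
      | succ n => intro hn; rw [add_mul]; exact (h1 hn).add (h2 hn)
  exact key (n + 1) a h hn

end Dec

/-- The sums in question contain `1` and are stable under right multiplication by every generator.
Stability under the crossing needs the decomposition with one strand fewer, hence the induction on
`n`. -/
theorem dec_of_mem {n : ℕ} {a : E (n + 1)} (ha : a ∈ H.D B (n + 1)) : Dec H B n a := by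
  have key (n : ℕ) (S : Set (E (n + 1))) (h : ∀ y ∈ S, ∀ z, Dec H B n z → Dec H B n (z * y))
      (a : E (n + 1)) (ha : a ∈ Algebra.adjoin ℂ S) : Dec H B n a := by
    have h1 : ∀ z, Dec H B n z → Dec H B n (z * a) := by
      induction ha using Algebra.adjoin_induction with
      | mem y hy => exact h y hy
      | algebraMap r =>
        intro z hz
        rw [Algebra.algebraMap_eq_smul_one, mul_smul_comm, mul_one]
        exact hz.smul r
      | add _ _ _ _ h1 h2 => intro z hz; rw [mul_add]; exact (h1 z hz).add (h2 z hz)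
      | mul _ _ _ _ h1 h2 => intro z hz; rw [← mul_assoc]; exact h2 _ (h1 z hz)
    simpa using h1 1 (by simpa using Dec.sh (H := H) (one_mem (H.D B n)))
  induction n with
  | zero =>
    refine key _ _ ?_ a ha
    rintro _ (⟨b, hb, rfl⟩ | rfl) z hz
    · exact hz.mul_sh hb
    · exact hz.mul_x
  | succ n ih =>
    refine key _ _ ?_ a ha
    rintro _ (⟨b, hb, rfl⟩ | rfl | rfl) z hz
    · exact hz.mul_sh hb
    · exact hz.mul_x
    · exact hz.mul_s (fun b hb => ih hb)

/-- A family of traces on a tower of algebras. -/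
structure Trace (_H : HeckeTower E) (M : Type*) [AddCommGroup M] [Module ℂ M] where
  tr : ∀ n, E n →ₗ[ℂ] M
  tr_comm : ∀ n (a b : E n), tr n (a * b) = tr n (b * a)

namespace Trace

variable {M : Type*} [AddCommGroup M] [Module ℂ M] (τ : Trace H M)

/-- The trace of the product of an element with a cycle that links `j` new strands with the first
strand. -/
def cyc : ℕ → ∀ n, E (n + 1) →ₗ[ℂ] M
  | 0, n => τ.tr (n + 1)
  | j + 1, n => cyc j (n + 1) ∘ₗ LinearMap.mulRight ℂ (H.s n) ∘ₗ (H.sh (n + 1)).toLinearMap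

theorem cyc_succ (j n : ℕ) (a : E (n + 1)) :
    τ.cyc (j + 1) n a = τ.cyc j (n + 1) (H.sh _ a * H.s n) := rfl

theorem cyc_comm (j n : ℕ) (a : E (n + 1)) (b : E n) :
    τ.cyc j n (a * H.sh n b) = τ.cyc j n (H.sh n b * a) := by
  induction j generalizing n with
  | zero => exact τ.tr_comm _ _ _
  | succ j ih =>
    rw [cyc_succ, cyc_succ, map_mul (H.sh _), map_mul (H.sh _), mul_assoc, ← s_sh, ← mul_assoc, ih, mul_assoc]

/-- By cyclicity `b` can be moved around to `a`. The single crossing of the first strand then joins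
the cycle, which gains one strand. -/
theorem cyc_cross (j n : ℕ) (a b : E (n + 1)) :
    τ.cyc j (n + 1) (H.sh _ a * H.s n * H.sh _ b) = τ.cyc (j + 1) n (b * a) := by
  rw [cyc_comm, cyc_succ, map_mul (H.sh _), mul_assoc]

/-- The trace of a single cycle with dots on its first strand. -/
def loop (j k : ℕ) : M := τ.cyc j 0 (H.x 0 ^ k)

/-! ### Cycles with a dot, and the commutator of a dotted cycle with a free strand. -/

section Cycles

variable (H)

/-- The cycle of `j + 1` strands. -/
def cycle : ∀ j, E (j + 1)
  | 0 => 1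
  | j + 1 => H.sh _ (cycle j) * H.s j

/-- The cycle of the first `j + 1` of `j + 2` strands. -/
def cycle' : ∀ j, E (j + 2)
  | 0 => 1
  | j + 1 => H.sh _ (cycle' j) * H.s (j + 1)

/-- The crossing of the last two of `j + 2` strands. -/
def lastCross : ∀ j, E (j + 2)
  | 0 => H.s 0
  | j + 1 => H.sh _ (lastCross j)

/-- The dot on the last of `j + 1` strands. -/
def lastDot : ∀ j, E (j + 1)
  | 0 => H.x 0
  | j + 1 => H.sh _ (lastDot j)

/-- The dot on the last but one of `j + 2` strands. -/
def lastDot' : ∀ j, E (j + 2)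
  | 0 => H.x 1
  | j + 1 => H.sh _ (lastDot' j)

theorem lastDot'_eq (j : ℕ) : lastDot' H j =
    lastCross H j * H.sh _ (lastDot H j) * lastCross H j + H.e • lastCross H j := by
  induction j with
  | zero =>
    have h := congrArg (· * H.s 0) (H.x_s 0)
    simpa [add_mul, mul_assoc, H.s_sq, lastDot', lastDot, lastCross] using h
  | succ j ih => simp only [lastDot', lastCross, lastDot]; rw [ih]; simp

theorem lastCross_cycle' (j : ℕ) : lastCross H j * cycle' H j = cycle H (j + 1) := by
  induction j with
  | zero => simp [lastCross, cycle', cycle]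
  | succ j ih => rw [lastCross, cycle', ← mul_assoc, ← map_mul, ih, cycle.eq_2 H (j + 1)]

theorem cycle'_dot (j : ℕ) :
    cycle' H j * H.sh _ (lastDot H j) = H.sh _ (lastDot H j) * cycle' H j := by
  induction j with
  | zero => simp [cycle']
  | succ j ih =>
    rw [cycle', lastDot, mul_assoc, H.s_sh, ← mul_assoc, ← map_mul, ih, map_mul, mul_assoc]

theorem isUnit_cycle' (j : ℕ) : IsUnit (cycle' H j) := by
  induction j with
  | zero => exact isUnit_one
  | succ j ih => exact (ih.map (H.sh (j + 2))).mul ⟨⟨_, _, H.s_sq (j + 1), H.s_sq (j + 1)⟩, rfl⟩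

/-- Both sides are the square of the long cycle `lastCross * cycle'`. As `cycle'` is invertible, the
cycle of the last strands is thus conjugate to that of the first strands with the last two strands
exchanged. -/
theorem cycle'_sh_cycle (j : ℕ) : cycle' H j * H.sh _ (cycle H j) =
    lastCross H j * cycle' H j * lastCross H j * cycle' H j := by
  induction j with
  | zero => simp [cycle, cycle', lastCross, H.s_sq]
  | succ j ih =>
    have h : H.s (j + 1) * H.sh _ (cycle H (j + 1)) * H.s (j + 1) =
        H.sh _ (cycle H (j + 1)) * H.s (j + 1) * H.sh _ (H.s j) := by
      rw [cycle, map_mul, ← mul_assoc, H.s_sh, mul_assoc, mul_assoc, ← mul_assoc (H.s (j + 1)),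
        H.braid, ← mul_assoc, ← mul_assoc]
    have h1 : cycle' H (j + 1) * H.sh _ (cycle H (j + 1)) =
        H.sh _ (cycle' H j * H.sh _ (cycle H j)) * H.s (j + 1) * H.sh _ (H.s j) := by
      rw [cycle', cycle, map_mul, mul_assoc, ← mul_assoc (H.s (j + 1)), H.s_sh, map_mul]
      simp only [mul_assoc]
    have h2 : lastCross H (j + 1) * cycle' H (j + 1) * lastCross H (j + 1) * cycle' H (j + 1) =
        H.sh _ (lastCross H j * cycle' H j) *
          (H.s (j + 1) * H.sh _ (lastCross H j * cycle' H j) * H.s (j + 1)) := by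
      simp only [lastCross, cycle', map_mul, mul_assoc]
    rw [h1, h2, lastCross_cycle', h, ih, mul_assoc (lastCross H j * cycle' H j), lastCross_cycle']
    simp only [map_mul, mul_assoc]

variable {H}

theorem cyc_eq_tr (f : ∀ j, E (j + 1)) (hf : ∀ j, f (j + 1) = H.sh _ (f j) * H.s j)
    (i j n : ℕ) (h : j + i = n) : τ.cyc i j (f j) = τ.tr (n + 1) (f n) := by
  induction i generalizing j with
  | zero => obtain rfl : j = n := h; rfl
  | succ i ih => rw [cyc_succ, ← hf, ih (j + 1) (by omega)]

theorem cyc_eq_tr' (f : ∀ j, E (j + 2)) (hf : ∀ j, f (j + 1) = H.sh _ (f j) * H.s (j + 1))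
    (i j n : ℕ) (h : j + i = n) : τ.cyc i (j + 1) (f j) = τ.tr (n + 2) (f n) := by
  induction i generalizing j with
  | zero => obtain rfl : j = n := h; rfl
  | succ i ih => rw [cyc_succ, ← hf, ih (j + 1) (by omega)]

theorem loop_zero (j : ℕ) : τ.loop j 0 = τ.tr (j + 1) (cycle H j) := by
  rw [← τ.cyc_eq_tr (cycle H) (fun _ => rfl) j 0 j (by omega), loop, pow_zero, cycle]

theorem loop_one (j : ℕ) : τ.loop j 1 = τ.tr (j + 1) (lastDot H j * cycle H j) := by
  rw [← τ.cyc_eq_tr (fun j => lastDot H j * cycle H j) (fun j => ?_) j 0 j (by omega), loop,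
    pow_one, cycle, lastDot, mul_one]
  rw [cycle, lastDot, map_mul, mul_assoc]

/-- On the left is a cycle with a dot on its last strand, followed by a free strand. Sliding the dot
across the crossing with the free strand costs `e` times the long cycle. The rest is conjugate, by
`cycle'` and `lastCross`, to the same dotted cycle with the free strand in front. -/
theorem cyc_x_one (j : ℕ) : τ.cyc j 1 (H.x 1) =
    τ.tr (j + 2) (H.sh _ (lastDot H j * cycle H j)) + H.e • τ.loop (j + 1) 0 := by
  have h1 : τ.cyc j 1 (H.x 1) = τ.tr (j + 2) (lastDot' H j * cycle' H j) := by
    rw [← τ.cyc_eq_tr' (fun j => lastDot' H j * cycle' H j) (fun j => ?_) j 0 j (by omega),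
      cycle', lastDot', mul_one]
    rw [cycle', lastDot', map_mul, mul_assoc]
  obtain ⟨u, hu⟩ := isUnit_cycle' H j
  have h2 : H.sh _ (lastDot H j * cycle H j) =
      ↑u⁻¹ * (H.sh _ (lastDot H j) * lastCross H j * cycle' H j * lastCross H j * u) := by
    rw [Units.eq_inv_mul_iff_mul_eq, map_mul, hu, ← mul_assoc, cycle'_dot, mul_assoc,
      cycle'_sh_cycle]
    simp only [mul_assoc]
  rw [h1, h2, τ.tr_comm _ (↑u⁻¹ : E (j + 2)), mul_assoc _ (u : E (j + 2)), Units.mul_inv, mul_one,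
    τ.tr_comm _ _ (lastCross H j), loop_zero, ← lastCross_cycle', lastDot'_eq, add_mul, map_add, smul_mul_assoc, map_smul]
  simp only [mul_assoc]

end Cycles

/-! ### Generation of all traces from the single strand and the sum of the dots. -/

section Generation

/-- The sum of the dots on all strands. -/
def dotSum (H : HeckeTower E) : ∀ n, E n
  | 0 => 0
  | n + 1 => H.x n + H.sh n (dotSum H n)

-- `m` is the product of the trace algebra or its opposite, according to the side on which a tower
-- adds strands. `hprod` is asked only on `D B n`: for downward strands a general natural
-- transformation need not come from an endomorphism of a word.
variable (A : Submodule ℂ M) (m : M → M → M) (hm : ∀ a ∈ A, ∀ b ∈ A, m a b ∈ A)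
  (hprod : ∀ j n k, ∀ d ∈ H.D B n,
    τ.cyc j n (H.sh n d * H.x n ^ k) = m (τ.loop j k) (τ.tr n d))
  (hdot : ∀ n (f : E n), τ.tr n f ∈ A → τ.tr n (dotSum H n * f) ∈ A)
  (hA : τ.loop 0 0 ∈ A)

-- By `dec_of_mem`, the strand carrying the cycle either separates, splitting off a factor `loop j
-- k`, or crosses once, and then the cycle absorbs one of the remaining strands. Induction on the
-- number of those strands works once all cycle lengths are treated together.
include hm hprod in
theorem cyc_mem_of_loop_mem (hB : ∀ b ∈ B, τ.tr 0 b ∈ A) (h : ∀ j k, τ.loop j k ∈ A) :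
    ∀ n, ∀ d ∈ H.D B n, τ.tr n d ∈ A := by
  have key (n : ℕ) (hn : ∀ d ∈ H.D B n, τ.tr n d ∈ A) (a : E (n + 1)) (ha : Dec H B n a)
      (hn' : ∀ l, n = l + 1 → ∀ j, ∀ d ∈ H.D B (l + 1), τ.cyc j l d ∈ A) (j : ℕ) :
      τ.cyc j n a ∈ A := by
    induction ha with
    | mono ha k => rw [hprod _ _ _ _ ha]; exact hm _ (h j k) _ (hn _ ha)
    | cross ha hb => rw [cyc_cross]; exact hn' _ rfl _ _ (mul_mem hb ha)
    | add _ _ h1 h2 => rw [map_add]; exact add_mem (h1 hn hn') (h2 hn hn')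
  have main (n : ℕ) : (∀ d ∈ H.D B n, τ.tr n d ∈ A) ∧
      ∀ j, ∀ d ∈ H.D B (n + 1), τ.cyc j n d ∈ A := by
    induction n with
    | zero => exact ⟨hB, fun j d hd => key 0 hB d (dec_of_mem hd) (by simp) j⟩
    | succ n ih =>
      refine ⟨fun d hd => ih.2 0 d hd, fun j d hd => key (n + 1) (fun d hd => ih.2 0 d hd) d
        (dec_of_mem hd) ?_ j⟩
      intro l hl
      obtain rfl : n = l := by omega
      exact ih.2
  exact fun n => (main n).1

/-- The trace of the product of an element, a cycle and the sum of the dots on all strands. -/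
def dotCyc : ℕ → ∀ n, E (n + 1) → M
  | 0, n => fun a => τ.tr (n + 1) (dotSum H (n + 1) * a)
  | j + 1, n => fun a => dotCyc j (n + 1) (H.sh _ a * H.s n)

include hdot in
theorem dotCyc_mem (j n : ℕ) (a : E (n + 1)) (ha : τ.cyc j n a ∈ A) : τ.dotCyc j n a ∈ A := by
  induction j generalizing n with
  | zero => exact hdot _ _ ha
  | succ j ih => exact ih _ _ ha

-- Up to lower terms, every dot on the cycle contributes equally. Moving a dot past the crossing
-- that links it to the next strand costs `e` times a product in which the cycle has been cut in
-- two, and these products lie in `A` by assumption.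
include hm hprod in
theorem dotCyc_sub_mem (j n : ℕ) (a : E (n + 1)) (ha : a ∈ H.D B (n + 1))
    (h : ∀ i < j, τ.cyc i n a ∈ A) (h' : ∀ i < j, τ.loop i 0 ∈ A) :
    τ.dotCyc j n a - ((j + 1 : ℂ) • τ.cyc j n (H.x n * a) +
      τ.cyc j n (H.sh n (dotSum H n) * a)) ∈ A := by
  induction j generalizing n with
  | zero =>
    convert A.zero_mem using 1
    simp only [dotCyc, dotSum, cyc, add_mul, map_add]
    simp
  | succ j ih =>
    have h1 := ih (n + 1) (H.sh _ a * H.s n) (mul_mem (sh_mem ha) (s_mem n))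
      (fun i hi => h (i + 1) (by omega)) (fun i hi => h' i (by omega))
    have h2 : τ.cyc j (n + 1) (H.x (n + 1) * (H.sh _ a * H.s n)) =
        τ.cyc (j + 1) n (H.x n * a) + H.e • m (τ.loop j 0) (τ.cyc 0 n a) := by
      rw [← mul_assoc, x_sh, mul_assoc, x_s, mul_add, mul_smul_comm, mul_one, map_add, map_smul,
        ← mul_assoc, cyc_cross]
      have h3 := hprod j (n + 1) 0 a ha
      rw [pow_zero, mul_one] at h3
      rw [h3]; rfl
    have h3 : τ.cyc j (n + 1) (H.sh _ (dotSum H (n + 1)) * (H.sh _ a * H.s n)) =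
        τ.cyc (j + 1) n (H.x n * a) + τ.cyc (j + 1) n (H.sh n (dotSum H n) * a) := by
      rw [← mul_assoc, ← map_mul, dotSum, add_mul, map_add, add_mul, map_add]; rfl
    have h4 : m (τ.loop j 0) (τ.cyc 0 n a) ∈ A :=
      hm _ (h' j (by omega)) _ (h 0 (by omega))
    rw [h2, h3] at h1
    -- The inductive hypothesis has `j + 1` dots on the strand just added, and each costs one copy
    -- of `e • m _ _`.
    have h5 := A.add_mem h1 (A.smul_mem ((j + 1 : ℂ) * H.e) h4)
    convert h5 using 1
    simp only [dotCyc]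
    push_cast
    module

-- Induction on the length and then on the number of dots. The longer undotted cycle is `e⁻¹` times
-- a commutator by `cyc_x_one`. A further dot comes from the sum of all dots, where its coefficient
-- `j + 1` is invertible in `ℂ`.
include hm hprod hdot hA in
theorem loop_mem (j k : ℕ) : τ.loop j k ∈ A := by
  induction j using Nat.strong_induction_on generalizing k with
  | _ j ih =>
  have h0 : τ.loop j 0 ∈ A := by
    cases j with
    | zero => exact hA
    | succ j =>
      -- `h1` evaluates the dotted cycle with the free strand behind it, `h2` with the free strand
      -- in front.
      have h1 := hprod j 1 1 1 (one_mem _)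
      have hmem (j : ℕ) : lastDot H j * cycle H j ∈ H.D B (j + 1) := by
        refine mul_mem ?_ ?_
        · induction j with
          | zero => exact x_mem 0
          | succ j hj => exact sh_mem hj
        · induction j with
          | zero => exact one_mem _
          | succ j hj => exact mul_mem (sh_mem hj) (s_mem _)
      have h2 := hprod 0 (j + 1) 0 _ (hmem j)
      rw [pow_zero, mul_one] at h2
      rw [map_one, one_mul, pow_one, cyc_x_one] at h1
      have h3 : τ.tr 1 1 = τ.loop 0 0 := by rw [loop_zero]; rfl
      rw [h3] at h1
      rw [← loop_one] at h2
      change τ.tr (j + 2) _ = _ at h2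
      rw [h2] at h1
      have h4 : H.e • τ.loop (j + 1) 0 ∈ A := by
        rw [eq_sub_of_add_eq' h1]
        exact sub_mem (hm _ (ih j (by omega) 1) _ hA) (hm _ hA _ (ih j (by omega) 1))
      have h5 := A.smul_mem H.e⁻¹ h4
      rwa [smul_smul, inv_mul_cancel₀ H.e_ne, one_smul] at h5
  induction k with
  | zero => exact h0
  | succ k ihk =>
    have h1 := τ.dotCyc_sub_mem A m hm hprod j 0 (H.x 0 ^ k) (pow_mem (x_mem 0) k)
      (fun i hi => ih i hi k) (fun i hi => ih i hi 0)
    have h2 := τ.dotCyc_mem A hdot j 0 (H.x 0 ^ k) ihk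
    have h3 := sub_mem h2 h1
    rw [sub_sub_cancel, dotSum, map_zero, zero_mul, map_zero, add_zero, ← pow_succ'] at h3
    have h4 : (j + 1 : ℂ) ≠ 0 := by exact_mod_cast Nat.succ_ne_zero j
    have h5 := A.smul_mem (j + 1 : ℂ)⁻¹ h3
    rwa [smul_smul, inv_mul_cancel₀ h4, one_smul] at h5

include hm hprod hdot hA in
theorem tr_mem (hB : ∀ b ∈ B, τ.tr 0 b ∈ A) (n : ℕ) (d : E n) (hd : d ∈ H.D B n) :
    τ.tr n d ∈ A :=
  τ.cyc_mem_of_loop_mem A m hm hprod hB (τ.loop_mem A m hm hprod hdot hA) n d hd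

end Generation

end Trace

end HeckeTower

namespace Heis

open HomSpace

local notation "𝖯" => Obj.P
local notation "𝖰" => Obj.Q

/-! ### Bubbles in the trace -/

/-- The clockwise circle with `n` dots, on the right of a word. -/
def bubR (n : ℕ) (Z : Obj) : Z ⟶ Z := (ρ_ Z).inv ≫ Z ◁ bubble n ≫ (ρ_ Z).hom

theorem bub_eq (n : ℕ) (Z : Obj) : bub n Z = (λ_ Z).inv ≫ bubble n ▷ Z ≫ (λ_ Z).hom := by
  have h : bubble n = cupPQHom ≫ dots n ▷ 𝖰 ≫ capPQHom := rfl
  rw [h]; unfold bub η' Xs ε'; monoidal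

theorem bubR_tensor (n : ℕ) (A Z : Obj) : bubR n (A ⊗ Z) = A ◁ bubR n Z := by
  unfold bubR; monoidal

theorem bub_unit (n : ℕ) : bub n (𝟙_ Obj) = bubble n := by
  rw [bub_eq]; monoidal

theorem bubR_unit (n : ℕ) : bubR n (𝟙_ Obj) = bub n (𝟙_ Obj) := by
  rw [bub_unit]; unfold bubR; monoidal

theorem cls_bub {Z : Obj} (n : ℕ) (f : Z ⟶ Z) : cls (bub n Z ≫ f) = c n * cls f := by
  rw [c, ← cls_tensor]
  refine (cls_conj (λ_ Z) _ _ ?_).symm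
  rw [bub_eq, MonoidalCategory.tensorHom_def]; simp

theorem cls_bubR {Z : Obj} (n : ℕ) (f : Z ⟶ Z) : cls (bubR n Z ≫ f) = cls f * c n := by
  rw [c, ← cls_tensor]
  refine (cls_conj (ρ_ Z) _ _ ?_).symm
  rw [bubR, MonoidalCategory.tensorHom_def']; simp

theorem cls_sub {Z : Obj} (f g : Z ⟶ Z) : cls (f - g) = cls f - cls g := by
  rw [eq_sub_iff_add_eq, ← cls_add, sub_add_cancel]

theorem cls_zero (Z : Obj) : cls (0 : Z ⟶ Z) = 0 := by
  rw [← sub_self (𝟙 Z), cls_sub, sub_self]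

theorem cls_sum {ι : Type*} (s : Finset ι) {Z : Obj} (f : ι → (Z ⟶ Z)) :
    cls (∑ i ∈ s, f i) = ∑ i ∈ s, cls (f i) := by
  classical
  induction s using Finset.induction_on with
  | empty => exact cls_zero Z
  | insert a s ha ih => rw [Finset.sum_insert ha, Finset.sum_insert ha, cls_add, ih]

/-- The class of an endomorphism, as a linear map. -/
def clsLin (Z : Obj) : End Z →ₗ[ℂ] TrH where
  toFun f := cls f
  map_add' f g := cls_add f g
  map_smul' r f := cls_smul r f

theorem cls_unit_comp (f g : 𝟙_ Obj ⟶ 𝟙_ Obj) : cls (f ≫ g) = cls f * cls g := by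
  rw [← cls_tensor]
  refine (cls_conj (λ_ (𝟙_ Obj)) _ _ ?_).symm
  rw [MonoidalCategory.tensorHom_def, Category.assoc, leftUnitor_naturality, unitors_equal,
    rightUnitor_naturality_assoc]

/-- The sum of the clockwise circles with no dots and with one dot. -/
def gam (Z : Obj) : Z ⟶ Z := bub 0 Z + bub 1 Z
/-- The sum of the clockwise circles with no dots and with one dot, on the right of a word. -/
def gamR (Z : Obj) : Z ⟶ Z := bubR 0 Z + bubR 1 Z

theorem gam_nat {Z W : Obj} (f : Z ⟶ W) : f ≫ gam W = gam Z ≫ f := by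
  unfold gam
  rw [Preadditive.comp_add, Preadditive.add_comp, bub_nat, bub_nat]

theorem cls_gam {Z : Obj} (f : Z ⟶ Z) : cls (gam Z ≫ f) = (c 0 + c 1) * cls f := by
  rw [gam, Preadditive.add_comp, cls_add, cls_bub, cls_bub, add_mul]

theorem cls_gamR {Z : Obj} (f : Z ⟶ Z) : cls (gamR Z ≫ f) = cls f * (c 0 + c 1) := by
  rw [gamR, Preadditive.add_comp, cls_add, cls_bubR, cls_bubR, mul_add]

/-- In `bub_slide` the undotted circle leaves an identity and the circle with one dot leaves two
dots. With at most one dot no term has a circle trapped beside a strand, so the commutator with `c 0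
+ c 1` counts strands and adds dots, nothing else. -/
theorem gam_P (Z : Obj) : gam (𝖯 ⊗ Z) = 𝖯 ◁ gam Z + 𝟙 _ + (2 : ℂ) • X Z := by
  have h1 : Xs 1 Z = X Z := by rw [Xs_succ, Xs_zero, Category.id_comp]
  rw [gam, bub_slide, bub_slide, gam, MonoidalPreadditive.whiskerLeft_add]
  simp only [Finset.range_zero, Finset.sum_empty, Finset.range_one, Finset.sum_singleton, Xs_zero,
    h1, add_zero, Nat.sub_self, zero_add, sub_zero, Category.comp_id, two_smul]
  abel

/-- Apply `gam_P` to `𝖯 ⊗ 𝖰 ⊗ Z` and bend the upward strand with `η'` and `ε`: the circle ends up on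
the other side, which reverses the signs. -/
theorem gam_Q (Z : Obj) : gam (𝖰 ⊗ Z) = 𝖰 ◁ gam Z - 𝟙 _ - (2 : ℂ) • Y Z := by
  have h1 : 𝖯 ◁ gam (𝖰 ⊗ Z) = gam (𝖯 ⊗ 𝖰 ⊗ Z) - 𝟙 _ - (2 : ℂ) • X (𝖰 ⊗ Z) := by
    rw [gam_P]; abel
  rw [← transpose_cap (gam (𝖰 ⊗ Z)), h1]
  simp only [Preadditive.comp_sub, whiskerLeft_sub', Preadditive.sub_comp, Linear.comp_smul,
    MonoidalLinear.whiskerLeft_smul, Linear.smul_comp, Category.comp_id]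
  rw [zigQ, ← Y, gam_nat, whiskerLeft_comp, Category.assoc, zigQ, Category.comp_id]

theorem gamR_tensor (A Z : Obj) : gamR (A ⊗ Z) = A ◁ gamR Z := by
  rw [gamR, bubR_tensor, bubR_tensor, gamR, MonoidalPreadditive.whiskerLeft_add]

theorem gamR_unit : gamR (𝟙_ Obj) = gam (𝟙_ Obj) := by
  rw [gamR, bubR_unit, bubR_unit, gam]

/-- The subalgebra generated by the three elements. -/
def genAlg : Subalgebra ℂ TrH := Algebra.adjoin ℂ {hNegOne, hOne, c 0 + c 1}

theorem hNegOne_mem : hNegOne ∈ genAlg := Algebra.subset_adjoin (by simp)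
theorem hOne_mem : hOne ∈ genAlg := Algebra.subset_adjoin (by simp)
theorem gam_mem : c 0 + c 1 ∈ genAlg := Algebra.subset_adjoin (by simp)

/-! ### Upward strands -/

/-- The word with `n` upward strands. -/
def Ps : ℕ → Obj
  | 0 => 𝟙_ Obj
  | n + 1 => 𝖯 ⊗ Ps n

/-- Adding a strand on the left. -/
def addP (Z : Obj) : End Z →ₐ[ℂ] End (𝖯 ⊗ Z) where
  toFun f := 𝖯 ◁ f
  map_one' := whiskerLeft_id _ _
  map_mul' f g := whiskerLeft_comp _ _ _
  map_zero' := MonoidalPreadditive.whiskerLeft_zero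
  map_add' f g := MonoidalPreadditive.whiskerLeft_add _ _
  commutes' r := by
    rw [Algebra.algebraMap_eq_smul_one, Algebra.algebraMap_eq_smul_one]
    exact (MonoidalLinear.whiskerLeft_smul _ r _).trans (congrArg _ (whiskerLeft_id _ _))

/-- The tower of endomorphism algebras of upward strands. -/
def towerP : HeckeTower (fun n => End (Ps n)) where
  sh n := addP (Ps n)
  x n := X (Ps n)
  s n := S (Ps n)
  e := 1
  e_ne := one_ne_zero
  s_sq n := S_sq (Ps n)
  braid n := S_braid (Ps n)
  s_sh n a := S_nat (Z := Ps n) a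
  x_sh n a := X_nat (Z := Ps n) a
  x_s n := (S_X (Ps n)).trans (congrArg _ (one_smul ℂ (𝟙 (𝖯 ⊗ 𝖯 ⊗ Ps n))).symm)

/-- The class of an endomorphism of upward strands. -/
def traceP : towerP.Trace TrH where
  tr n := clsLin (Ps n)
  tr_comm n a b := cls_comm (X := Ps n) (Y := Ps n) b a

/-- The class of the composition of an endomorphism with a cycle that links `j` new strands with
the first strand. -/
def cycP : ℕ → ∀ Z : Obj, (𝖯 ⊗ Z ⟶ 𝖯 ⊗ Z) → TrH
  | 0, _ => fun f => cls f
  | j + 1, Z => fun f => cycP j (𝖯 ⊗ Z) (S Z ≫ 𝖯 ◁ f)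

theorem cycP_eq (j n : ℕ) (f : 𝖯 ⊗ Ps n ⟶ 𝖯 ⊗ Ps n) : traceP.cyc j n f = cycP j (Ps n) f := by
  induction j generalizing n with
  | zero => rfl
  | succ j ih => exact ih (n + 1) _

/-- The crossings of the cycle involve only new strands on the left, so the factor `d` on the right
is untouched. The isomorphism `i` accounts for the bracketing, and `h` is propagated from each step
to the next. -/
theorem cycP_tensor (j : ℕ) {Z' Z W : Obj} (i : Z' ≅ Z ⊗ W) (f' : 𝖯 ⊗ Z' ⟶ 𝖯 ⊗ Z')
    (f : 𝖯 ⊗ Z ⟶ 𝖯 ⊗ Z) (d : W ⟶ W)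
    (h : f' ≫ 𝖯 ◁ i.hom ≫ (α_ 𝖯 Z W).inv = (𝖯 ◁ i.hom ≫ (α_ 𝖯 Z W).inv) ≫ (f ⊗ₘ d)) :
    cycP j Z' f' = cycP j Z f * cls d := by
  induction j generalizing Z' Z with
  | zero =>
    rw [cycP, cycP, ← cls_tensor]
    exact cls_conj (whiskerLeftIso 𝖯 i ≪≫ (α_ 𝖯 Z W).symm) _ _ h
  | succ j ih =>
    refine ih (whiskerLeftIso 𝖯 i ≪≫ (α_ 𝖯 Z W).symm) _ _ ?_
    have h1 : (S Z ≫ 𝖯 ◁ f) ⊗ₘ d = S Z ▷ W ≫ (α_ _ _ _).hom ≫ 𝖯 ◁ (f ⊗ₘ d) ≫ (α_ _ _ _).inv := by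
      rw [MonoidalCategory.tensorHom_def, MonoidalCategory.tensorHom_def]; simp
    have h2 : (α_ 𝖯 𝖯 (Z ⊗ W)).inv ≫ crossingHom ▷ (Z ⊗ W) =
      𝖯 ◁ (α_ 𝖯 Z W).inv ≫ (α_ 𝖯 (𝖯 ⊗ Z) W).inv ≫ S Z ▷ W ≫ (α_ 𝖯 (𝖯 ⊗ Z) W).hom ≫
        𝖯 ◁ (α_ 𝖯 Z W).hom ≫ (α_ _ _ _).inv := by
      unfold S; monoidal
    have h3 : S (Z ⊗ W) = 𝖯 ◁ (α_ 𝖯 Z W).inv ≫ (α_ 𝖯 (𝖯 ⊗ Z) W).inv ≫ S Z ▷ W ≫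
        (α_ 𝖯 (𝖯 ⊗ Z) W).hom ≫ 𝖯 ◁ (α_ 𝖯 Z W).hom := by
      unfold S; monoidal
    have h4 := congrArg (fun t => S Z' ≫ 𝖯 ◁ t ≫ (α_ _ _ _).inv) h
    simp only [whiskerLeft_comp, Category.assoc] at h4
    rw [h1]
    simp only [Iso.trans_hom, whiskerLeftIso_hom, Iso.symm_hom, whiskerLeft_comp, Category.assoc]
    rw [h4, ← reassoc_of% S_nat, h3]
    simp

theorem clsP_prod (j n k : ℕ) (d : End (Ps n)) :
    traceP.cyc j n (towerP.sh n d * towerP.x n ^ k) = traceP.loop j k * traceP.tr n d := by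
  have hx (n : ℕ) : towerP.x n ^ k = (Xs k (Ps n) : End (𝖯 ⊗ Ps n)) := by
    induction k with
    | zero => rw [pow_zero, Xs_zero]; rfl
    | succ k ih => rw [pow_succ, ih, Xs_succ']; rfl
  rw [HeckeTower.Trace.loop, hx, hx]
  refine (cycP_eq _ _ _).trans ((cycP_tensor j (λ_ (Ps n)).symm _ (Xs k (𝟙_ Obj)) d ?_).trans
    (congrArg (· * _) (cycP_eq j 0 _).symm))
  change (Xs k (Ps n) ≫ 𝖯 ◁ d) ≫ _ = _
  unfold Xs
  rw [MonoidalCategory.tensorHom_def]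
  simp

/-- The sum of the dots on `n` upward strands. -/
def dotsP : ∀ n, Ps n ⟶ Ps n
  | 0 => 0
  | n + 1 => (X (Ps n) + 𝖯 ◁ dotsP n : 𝖯 ⊗ Ps n ⟶ 𝖯 ⊗ Ps n)

theorem dotSumP (n : ℕ) : HeckeTower.Trace.dotSum towerP n = dotsP n := by
  induction n with
  | zero => rfl
  | succ n ih => rw [HeckeTower.Trace.dotSum, ih]; rfl

theorem gam_Ps (n : ℕ) : gam (Ps n) = gamR (Ps n) + (n : ℂ) • 𝟙 _ + (2 : ℂ) • dotsP n := by
  induction n with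
  | zero =>
    rw [dotsP, Nat.cast_zero, zero_smul, smul_zero, add_zero, add_zero]
    exact gamR_unit.symm
  | succ n ih =>
    change gam (𝖯 ⊗ Ps n) = (gamR (𝖯 ⊗ Ps n) + ((n + 1 : ℕ) : ℂ) • 𝟙 (𝖯 ⊗ Ps n) +
      (2 : ℂ) • (X (Ps n) + 𝖯 ◁ dotsP n) : 𝖯 ⊗ Ps n ⟶ 𝖯 ⊗ Ps n)
    rw [gam_P, ih, gamR_tensor, MonoidalPreadditive.whiskerLeft_add,
      MonoidalPreadditive.whiskerLeft_add, MonoidalLinear.whiskerLeft_smul,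
      MonoidalLinear.whiskerLeft_smul, whiskerLeft_id]
    push_cast
    module

/-- Solving `hx` for `x` shows that multiplication by `x` is, on classes, a combination of the
commutator with `c 0 + c 1` and the identity. -/
theorem cls_dots_mem {Z : Obj} {x : Z ⟶ Z} {r s : ℂ} (hs : s ≠ 0)
    (hx : gam Z = gamR Z + r • 𝟙 _ + s • x) (f : Z ⟶ Z) (hf : cls f ∈ genAlg) :
    cls (f ≫ x) ∈ genAlg := by
  have h1 : x = s⁻¹ • (gam Z - gamR Z - r • 𝟙 _) := by
    rw [hx, add_assoc, add_sub_cancel_left, add_sub_cancel_left, smul_smul,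
      inv_mul_cancel₀ hs, one_smul]
  rw [cls_comm, h1, Linear.smul_comp, Preadditive.sub_comp, Preadditive.sub_comp, Linear.smul_comp,
    Category.id_comp, cls_smul, cls_sub, cls_sub, cls_smul, cls_gam, cls_gamR]
  exact Subalgebra.smul_mem _ (sub_mem (sub_mem (mul_mem gam_mem hf) (mul_mem hf gam_mem))
    (Subalgebra.smul_mem _ hf _)) _

theorem clsP_dotSum_mem (n : ℕ) (f : End (Ps n)) (hf : traceP.tr n f ∈ genAlg) :
    traceP.tr n (HeckeTower.Trace.dotSum towerP n * f) ∈ genAlg := by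
  rw [dotSumP]
  exact cls_dots_mem two_ne_zero (gam_Ps n) f hf

/-- The bottom algebra is trivial here because the circles are not yet known to lie in `genAlg`;
dotted cycles do not need them, and `c_mem` depends on this. -/
theorem loopP_mem (j k : ℕ) : traceP.loop j k ∈ genAlg :=
  traceP.loop_mem (B := ⊥) (Subalgebra.toSubmodule genAlg) (· * ·) (fun _ ha _ hb => genAlg.mul_mem ha hb)
    (fun j n k d _ => clsP_prod j n k d) clsP_dotSum_mem (by
      have h : traceP.loop 0 0 = cls (𝟙 (𝖯 ⊗ 𝟙_ Obj)) := rfl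
      have h2 : cls (𝟙 (𝖯 ⊗ 𝟙_ Obj)) = hOne := cls_conj (ρ_ 𝖯) _ _ (by simp)
      rw [h, h2]
      exact hOne_mem) j k

theorem cls_Xs (k : ℕ) : cls (Xs k (𝟙_ Obj)) = traceP.loop 0 k := by
  have h : towerP.x 0 ^ k = (Xs k (𝟙_ Obj) : End (𝖯 ⊗ 𝟙_ Obj)) := by
    induction k with
    | zero => rw [pow_zero, Xs_zero]; rfl
    | succ k ih => rw [pow_succ, ih, Xs_succ']; rfl
  rw [HeckeTower.Trace.loop, h]; rfl

/-! ### The clockwise circles -/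

theorem cls_bubC_bub (p q : ℕ) : cls (bubC p (𝟙_ Obj) ≫ bub q (𝟙_ Obj)) =
    cls (bubC p (𝟙_ Obj)) * c q := by
  rw [cls_unit_comp, bub_unit, c]

/-- Split the identity of `𝖰𝖯` as `T' ≫ T + ε ≫ η`. The second term closes up to a counterclockwise
circle. In the first the dots slide through `T`, cyclicity cancels `T'` against `T`, and each
turnback left by a dot closes up to circles. -/
theorem cls_Q_Xs (a : ℕ) : cls (𝖰 ◁ Xs a (𝟙_ Obj)) = cls (Xs a (𝖰 ⊗ 𝟙_ Obj)) +
    (∑ i ∈ Finset.range a, ∑ q ∈ Finset.range (a - 1 - i),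
      cls (bubC q (𝟙_ Obj)) * c (a - 1 - i - 1 - q + i)) + cls (bubC a (𝟙_ Obj)) := by
  have h1 : 𝖰 ◁ Xs a (𝟙_ Obj) = T' (𝟙_ Obj) ≫ T (𝟙_ Obj) ≫ 𝖰 ◁ Xs a (𝟙_ Obj) +
      ε (𝟙_ Obj) ≫ η (𝟙_ Obj) ≫ 𝖰 ◁ Xs a (𝟙_ Obj) := by
    rw [reassoc_of% T'_T, Preadditive.sub_comp, Category.id_comp, Category.assoc, sub_add_cancel]
  rw [h1, cls_add, cls_comm (ε (𝟙_ Obj)), Category.assoc, ← bubC, T_Xs, Preadditive.comp_add,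
    cls_add, cls_comm (T' (𝟙_ Obj)), Category.assoc, T_T', Category.comp_id, Preadditive.comp_sum,
    cls_sum]
  congr 2
  refine Finset.sum_congr rfl fun i _ => ?_
  have h2 (m : ℕ) : η (𝟙_ Obj) ≫ 𝖰 ◁ Xs m (𝟙_ Obj) ≫ T' (𝟙_ Obj) =
      ∑ q ∈ Finset.range m, bubC q (𝟙_ Obj) ≫ η' (𝟙_ Obj) ≫ Xs (m - 1 - q) _ := by
    rw [Xs_T', Preadditive.comp_add, reassoc_of% curl_T', Limits.zero_comp, zero_add,
      Preadditive.comp_sum]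
    simp only [bubC, Category.assoc]
  have h3 : cls (T' (𝟙_ Obj) ≫ Xs i (𝖰 ⊗ 𝟙_ Obj) ≫ ε' (𝟙_ Obj) ≫ η (𝟙_ Obj) ≫
      𝖰 ◁ Xs (a - 1 - i) (𝟙_ Obj)) = cls ((η (𝟙_ Obj) ≫ 𝖰 ◁ Xs (a - 1 - i) (𝟙_ Obj) ≫
        T' (𝟙_ Obj)) ≫ Xs i (𝖰 ⊗ 𝟙_ Obj) ≫ ε' (𝟙_ Obj)) := by
    have h4 := cls_comm (T' (𝟙_ Obj) ≫ Xs i (𝖰 ⊗ 𝟙_ Obj) ≫ ε' (𝟙_ Obj))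
      (η (𝟙_ Obj) ≫ 𝖰 ◁ Xs (a - 1 - i) (𝟙_ Obj))
    simpa only [Category.assoc] using h4
  rw [h3, h2, Preadditive.sum_comp, cls_sum]
  refine Finset.sum_congr rfl fun q _ => ?_
  rw [← cls_bubC_bub, bub, Xs_add]
  simp only [Category.assoc]

/-- By `bubC_succ`, a counterclockwise circle with `p` dots involves only clockwise circles with at
most `p - 2` dots; hence the bound `n + 2`. -/
theorem cls_bubC_mem {n : ℕ} (h : ∀ k < n, c k ∈ genAlg) :
    ∀ p < n + 2, cls (bubC p (𝟙_ Obj)) ∈ genAlg := by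
  intro p
  induction p using Nat.strong_induction_on with
  | _ p ih =>
    intro hp
    cases p with
    | zero => rw [bubC_zero, cls_id_one]; exact one_mem _
    | succ p =>
      rw [bubC_succ, cls_sum]
      refine sum_mem fun i hi => ?_
      have := Finset.mem_range.1 hi
      rw [cls_bubC_bub]
      exact mul_mem (ih i (by omega) (by omega)) (h _ (by omega))

/-- Take `k + 2` dots in `cls_Q_Xs`. The circle `c k` stands alone `k + 1` times in the double sum
and once in the counterclockwise circle. All other terms are products with circles already in
`genAlg`. -/
theorem c_mem (k : ℕ) : c k ∈ genAlg := by
  induction k using Nat.strong_induction_on with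
  | _ k ih =>
  have hC := cls_bubC_mem ih
  have hX : cls (Xs (k + 2) (𝟙_ Obj)) ∈ genAlg := by rw [cls_Xs]; exact loopP_mem _ _
  have h1 : cls (𝖰 ◁ Xs (k + 2) (𝟙_ Obj)) = hNegOne * cls (Xs (k + 2) (𝟙_ Obj)) := by
    rw [hNegOne, ← cls_tensor, id_tensorHom]
  have h2 : cls (Xs (k + 2) (𝖰 ⊗ 𝟙_ Obj)) = cls (Xs (k + 2) (𝟙_ Obj)) * hNegOne := by
    rw [hNegOne, ← cls_tensor, tensorHom_id]
    refine cls_conj (whiskerLeftIso 𝖯 (ρ_ 𝖰 ≪≫ (λ_ 𝖰).symm) ≪≫ (α_ 𝖯 (𝟙_ Obj) 𝖰).symm) _ _ ?_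
    unfold Xs
    simp
  have h3 := cls_Q_Xs (k + 2)
  have hterm : ∀ q, q ≠ 0 → q < k + 1 → cls (bubC q (𝟙_ Obj)) * c (k - q) ∈ genAlg :=
    fun q h0 hq => mul_mem (hC q (by omega)) (ih _ (by omega))
  have h4 : cls (bubC (k + 2) (𝟙_ Obj)) - c k ∈ genAlg := by
    rw [bubC_succ, cls_sum, Finset.sum_range_succ']
    simp only [cls_bubC_bub]
    rw [bubC_zero, cls_id_one, one_mul, show k + 1 - 1 - 0 = k by omega, add_sub_cancel_right]
    refine sum_mem fun i hi => ?_
    have := Finset.mem_range.1 hi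
    exact hterm (i + 1) (by omega) (by omega)
  have h5 : (∑ i ∈ Finset.range (k + 2), ∑ q ∈ Finset.range (k + 2 - 1 - i),
      cls (bubC q (𝟙_ Obj)) * c (k + 2 - 1 - i - 1 - q + i)) - (k + 1 : ℂ) • c k ∈ genAlg := by
    -- The last outer index has an empty inner sum; each of the other `k + 1` contributes one `c k`,
    -- from `q = 0`.
    rw [Finset.sum_range_succ, show k + 2 - 1 - (k + 1) = 0 by omega, Finset.range_zero,
      Finset.sum_empty, add_zero]
    have h6 : (k + 1 : ℂ) • c k = ∑ i ∈ Finset.range (k + 1), c k := by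
      rw [Finset.sum_const, Finset.card_range, ← Nat.cast_smul_eq_nsmul ℂ]; push_cast; rfl
    rw [h6, ← Finset.sum_sub_distrib]
    refine sum_mem fun i hi => ?_
    have := Finset.mem_range.1 hi
    rw [show k + 2 - 1 - i = (k - i) + 1 by omega, Finset.sum_range_succ', bubC_zero, cls_id_one,
      one_mul, show k - i + 1 - 1 - 0 + i = k by omega, add_sub_cancel_right]
    refine sum_mem fun q hq => ?_
    have := Finset.mem_range.1 hq
    have h7 := hterm (q + 1) (by omega) (by omega)
    rwa [show k - i + 1 - 1 - (q + 1) + i = k - (q + 1) by omega]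
  have h6 : (k + 2 : ℂ) • c k ∈ genAlg := by
    have h7 := sub_mem (sub_mem (sub_mem (mul_mem hNegOne_mem hX) (mul_mem hX hNegOne_mem)) h4) h5
    rw [← h1, ← h2, h3] at h7
    convert h7 using 1
    module
  have h7 : (k + 2 : ℂ) ≠ 0 := by exact_mod_cast (by omega : k + 2 ≠ 0)
  have h8 := genAlg.smul_mem h6 (k + 2 : ℂ)⁻¹
  rwa [smul_smul, inv_mul_cancel₀ h7, one_smul] at h8

/-- The algebra generated by the clockwise circles. -/
def bubAlg : Subalgebra ℂ (End (Ps 0)) := Algebra.adjoin ℂ (Set.range fun n => bub n (Ps 0))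

theorem cls_bubAlg_mem (b : End (Ps 0)) (hb : b ∈ bubAlg) : cls b ∈ genAlg := by
  induction hb using Algebra.adjoin_induction with
  | mem x hx =>
    obtain ⟨n, rfl⟩ := hx
    change cls (bub n (𝟙_ Obj)) ∈ _
    rw [bub_unit]
    exact c_mem n
  | algebraMap r =>
    rw [Algebra.algebraMap_eq_smul_one]
    refine (cls_smul r (𝟙 (𝟙_ Obj))).symm ▸ genAlg.smul_mem ?_ r
    rw [cls_id_one]; exact one_mem _
  | add x y _ _ h1 h2 => exact (cls_add x y).symm ▸ add_mem h1 h2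
  | mul x y _ _ h1 h2 => exact (cls_unit_comp y x).symm ▸ mul_mem h2 h1

/-- The algebra of endomorphisms of upward strands generated by dots, crossings and circles. -/
abbrev algP (n : ℕ) : Subalgebra ℂ (End (Ps n)) := towerP.D bubAlg n

theorem cls_algP_mem (n : ℕ) (d : End (Ps n)) (hd : d ∈ algP n) : cls d ∈ genAlg :=
  traceP.cyc_mem_of_loop_mem (B := bubAlg) (Subalgebra.toSubmodule genAlg) (· * ·)
    (fun _ ha _ hb => genAlg.mul_mem ha hb) (fun j n k d _ => clsP_prod j n k d) cls_bubAlg_mem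
    loopP_mem n d hd

theorem Xs_mem_algP (k n : ℕ) : (Xs k (Ps n) : End (𝖯 ⊗ Ps n)) ∈ algP (n + 1) := by
  have h : (Xs k (Ps n) : End (𝖯 ⊗ Ps n)) = towerP.x n ^ k := by
    induction k with
    | zero => rw [pow_zero, Xs_zero]; rfl
    | succ k ih => rw [pow_succ, ← ih, Xs_succ']; rfl
  rw [h]
  exact pow_mem (HeckeTower.x_mem n) k

theorem whiskerLeft_mem_algP {n : ℕ} {d : End (Ps n)} (hd : d ∈ algP n) :
    (𝖯 ◁ d : End (𝖯 ⊗ Ps n)) ∈ algP (n + 1) := HeckeTower.sh_mem hd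

theorem bub_mem_algP (k n : ℕ) : (bub k (Ps n) : End (Ps n)) ∈ algP n := by
  induction n generalizing k with
  | zero => exact Algebra.subset_adjoin ⟨k, rfl⟩
  | succ n ih =>
    change (bub k (𝖯 ⊗ Ps n) : End (𝖯 ⊗ Ps n)) ∈ algP (n + 1)
    have hb (k : ℕ) : (𝖯 ◁ bub k (Ps n) : End (𝖯 ⊗ Ps n)) ∈ algP (n + 1) :=
      whiskerLeft_mem_algP (ih k)
    rw [bub_slide]
    refine (algP (n + 1)).add_mem ((algP (n + 1)).add_mem (hb k) (Xs_mem_algP _ n))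
      (sum_mem (S := algP (n + 1)) fun i _ => (algP (n + 1)).mul_mem (Xs_mem_algP _ n)
        ((algP (n + 1)).sub_mem (Xs_mem_algP _ n)
          (sum_mem (S := algP (n + 1)) fun j _ => (algP (n + 1)).mul_mem (hb _) (Xs_mem_algP _ n))))

end Heis

namespace Heis

open HomSpace

local notation "𝖯" => Obj.P
local notation "𝖰" => Obj.Q

/-! ### Downward strands -/

/-- The functor that adds `n` downward strands on the left. -/
def F : ℕ → Obj ⥤ Obj
  | 0 => 𝟭 Obj
  | n + 1 => tensorLeft 𝖰 ⋙ F n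

instance F_additive (n : ℕ) : (F n).Additive := by
  induction n with
  | zero => exact inferInstanceAs (𝟭 Obj).Additive
  | succ n ih => exact inferInstanceAs (tensorLeft 𝖰 ⋙ F n).Additive

instance F_linear (n : ℕ) : (F n).Linear ℂ := by
  induction n with
  | zero => exact inferInstanceAs ((𝟭 Obj).Linear ℂ)
  | succ n ih =>
    have : (tensorLeft 𝖰).Linear ℂ := inferInstance
    exact inferInstanceAs ((tensorLeft 𝖰 ⋙ F n).Linear ℂ)

/-- Adding a strand on the right of the downward strands. -/
def addQ (G : Obj ⥤ Obj) : End G →ₐ[ℂ] End (tensorLeft 𝖰 ⋙ G) where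
  toFun f := Functor.whiskerLeft (tensorLeft 𝖰) f
  map_one' := rfl
  map_mul' _ _ := rfl
  map_zero' := rfl
  map_add' _ _ := rfl
  commutes' _ := rfl

/-- The dot on a downward strand, as a natural transformation. -/
def YNat : tensorLeft 𝖰 ⟶ tensorLeft 𝖰 where
  app := Y
  naturality _ _ f := Y_nat f

/-- The crossing of two downward strands, as a natural transformation. -/
def UNat : tensorLeft 𝖰 ⋙ tensorLeft 𝖰 ⟶ tensorLeft 𝖰 ⋙ tensorLeft 𝖰 where
  app := U
  naturality _ _ f := U_nat f

/-- The dot on the last downward strand. -/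
def dotQ (G : Obj ⥤ Obj) : End (tensorLeft 𝖰 ⋙ G) := Functor.whiskerRight YNat G

/-- The crossing of the last two downward strands. -/
def crossQ (G : Obj ⥤ Obj) : End (tensorLeft 𝖰 ⋙ tensorLeft 𝖰 ⋙ G) :=
  Functor.whiskerRight UNat G

/-- The tower of endomorphism algebras of downward strands. -/
def towerQ : HeckeTower (fun n => End (F n)) where
  sh n := addQ (F n)
  x n := dotQ (F n)
  s n := crossQ (F n)
  e := 1
  e_ne := one_ne_zero
  s_sq n := by
    refine NatTrans.ext (funext fun Z => ?_)
    exact ((F n).map_comp _ _).symm.trans ((congrArg _ (U_sq Z)).trans ((F n).map_id _))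
  braid n := by
    refine NatTrans.ext (funext fun Z => ?_)
    change (F n).map (𝖰 ◁ U Z) ≫ (F n).map (U (𝖰 ⊗ Z)) ≫ (F n).map (𝖰 ◁ U Z) =
      (F n).map (U (𝖰 ⊗ Z)) ≫ (F n).map (𝖰 ◁ U Z) ≫ (F n).map (U (𝖰 ⊗ Z))
    simp only [← Functor.map_comp, U_braid]
  -- Commutation with the strands further left is naturality of `a`; this is the reason for using
  -- natural transformations.
  s_sh n a := NatTrans.ext (funext fun Z => (a.naturality (U Z)).symm)
  x_sh n a := NatTrans.ext (funext fun Z => (a.naturality (Y Z)).symm)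
  x_s n := by
    refine NatTrans.ext (funext fun Z => ?_)
    change (F n).map (U Z) ≫ (F n).map (𝖰 ◁ Y Z) = (F n).map (Y (𝖰 ⊗ Z)) ≫ (F n).map (U Z) +
      (1 : ℂ) • 𝟙 ((F n).obj (𝖰 ⊗ 𝖰 ⊗ Z))
    rw [← Functor.map_comp, ← Functor.map_comp, Y_U, one_smul, Functor.map_sub,
      CategoryTheory.Functor.map_id, sub_add_cancel]

/-- The class of an endomorphism of downward strands. -/
def traceQ : towerQ.Trace TrH where
  tr _ :=
    { toFun f := cls (f.app (𝟙_ Obj))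
      map_add' _ _ := cls_add _ _
      map_smul' _ _ := cls_smul _ _ }
  tr_comm _ a b := cls_comm (b.app (𝟙_ Obj)) (a.app (𝟙_ Obj))

/-- The class of the composition of an endomorphism with a cycle that links `j` new strands with
the last strand. -/
def cycQ : ℕ → ∀ G : Obj ⥤ Obj, End (tensorLeft 𝖰 ⋙ G) → TrH
  | 0, _ => fun f => cls (f.app (𝟙_ Obj))
  | j + 1, G => fun f => cycQ j (tensorLeft 𝖰 ⋙ G) (addQ (tensorLeft 𝖰 ⋙ G) f * crossQ G)

theorem cycQ_eq (j n : ℕ) (f : End (F (n + 1))) : traceQ.cyc j n f = cycQ j (F n) f := by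
  induction j generalizing n with
  | zero => rfl
  | succ j ih => exact ih (n + 1) _

/-- The cycle lives on the innermost strands, inside the argument of `G`, so the outer factor `d`
splits off on the left; for upward strands it splits off on the right. -/
theorem cycQ_tensor (j : ℕ) {V : Obj} {G L : Obj ⥤ Obj} (i : ∀ Z, G.obj Z ≅ V ⊗ L.obj Z)
    (hi : ∀ {Z W : Obj} (e : Z ⟶ W), G.map e ≫ (i W).hom = (i Z).hom ≫ V ◁ L.map e)
    (f : End (tensorLeft 𝖰 ⋙ G)) (g : End (tensorLeft 𝖰 ⋙ L)) (d : V ⟶ V)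
    (h : ∀ Z, f.app Z ≫ (i (𝖰 ⊗ Z)).hom = (i (𝖰 ⊗ Z)).hom ≫ (d ⊗ₘ g.app Z)) :
    cycQ j G f = cls d * cycQ j L g := by
  induction j generalizing G L with
  | zero =>
    rw [cycQ, cycQ, ← cls_tensor]
    exact cls_conj (i (𝖰 ⊗ 𝟙_ Obj)) _ _ (h _)
  | succ j ih =>
    refine ih (G := tensorLeft 𝖰 ⋙ G) (L := tensorLeft 𝖰 ⋙ L) (fun Z => i (𝖰 ⊗ Z))
      (fun e => hi (𝖰 ◁ e)) _ _ fun Z => ?_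
    change (G.map (U Z) ≫ f.app (𝖰 ⊗ Z)) ≫ (i (𝖰 ⊗ 𝖰 ⊗ Z)).hom =
      (i (𝖰 ⊗ 𝖰 ⊗ Z)).hom ≫ (d ⊗ₘ (L.map (U Z) ≫ g.app (𝖰 ⊗ Z)))
    have h1 : (d ⊗ₘ (L.map (U Z) ≫ g.app (𝖰 ⊗ Z))) =
        V ◁ L.map (U Z) ≫ (d ⊗ₘ g.app (𝖰 ⊗ Z)) := by
      rw [MonoidalCategory.tensorHom_def', MonoidalCategory.tensorHom_def', whiskerLeft_comp,
        Category.assoc]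
    have h2 := h (𝖰 ⊗ Z)
    have h3 := congrArg (· ≫ (d ⊗ₘ g.app (𝖰 ⊗ Z))) (hi (U Z))
    rw [h1]
    refine (Category.assoc _ _ _).trans ((congrArg _ h2).trans ?_)
    exact (Category.assoc _ _ _).symm.trans (h3.trans (Category.assoc _ _ _))

/-! ### Natural transformations induced by endomorphisms of words. -/

/-- The natural transformations that come from an endomorphism of a word. -/
def IsLoc (G : Obj ⥤ Obj) (V : Obj) (i : ∀ Z, G.obj Z ⟶ V ⊗ Z) (f : End G) (d : V ⟶ V) : Prop :=
  ∀ Z, f.app Z ≫ i Z = i Z ≫ d ▷ Z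

section IsLoc

variable {G : Obj ⥤ Obj} {V : Obj} {i : ∀ Z, G.obj Z ⟶ V ⊗ Z}

theorem isLoc_add {f g : End G} {d e : V ⟶ V} (hf : IsLoc G V i f d) (hg : IsLoc G V i g e) :
    IsLoc G V i (f + g) (d + e) := by
  intro Z
  change (f.app Z + g.app Z) ≫ _ = _
  rw [Preadditive.add_comp, hf, hg, MonoidalPreadditive.add_whiskerRight, Preadditive.comp_add]

theorem isLoc_mul {f g : End G} {d e : V ⟶ V} (hf : IsLoc G V i f d) (hg : IsLoc G V i g e) :
    IsLoc G V i (f * g) (e ≫ d) := by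
  intro Z
  change (g.app Z ≫ f.app Z) ≫ _ = _
  rw [Category.assoc, hf, ← Category.assoc, hg, comp_whiskerRight, Category.assoc]

theorem isLoc_algebraMap (r : ℂ) : IsLoc G V i (algebraMap ℂ (End G) r) (r • 𝟙 V) := by
  intro Z
  change (r • 𝟙 (G.obj Z)) ≫ _ = _
  rw [MonoidalLinear.smul_whiskerRight, id_whiskerRight, Linear.smul_comp, Category.id_comp,
    Linear.comp_smul, Category.comp_id]

theorem isLoc_addQ {f : End G} {d : V ⟶ V} (hf : IsLoc G V i f d) :
    IsLoc (tensorLeft 𝖰 ⋙ G) (V ⊗ 𝖰) (fun Z => i (𝖰 ⊗ Z) ≫ (α_ V 𝖰 Z).inv) (addQ G f) (d ▷ 𝖰) := by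
  intro Z
  change f.app (𝖰 ⊗ Z) ≫ i (𝖰 ⊗ Z) ≫ (α_ V 𝖰 Z).inv = (i (𝖰 ⊗ Z) ≫ (α_ V 𝖰 Z).inv) ≫ d ▷ 𝖰 ▷ Z
  rw [← Category.assoc, hf]
  simp

theorem isLoc_dotQ (hi : ∀ {Z W : Obj} (e : Z ⟶ W), G.map e ≫ i W = i Z ≫ V ◁ e) :
    IsLoc (tensorLeft 𝖰 ⋙ G) (V ⊗ 𝖰) (fun Z => i (𝖰 ⊗ Z) ≫ (α_ V 𝖰 Z).inv) (dotQ G)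
      (V ◁ ((ρ_ 𝖰).inv ≫ Y (𝟙_ Obj) ≫ (ρ_ 𝖰).hom)) := by
  intro Z
  have h : Y Z = ((ρ_ 𝖰).inv ≫ Y (𝟙_ Obj) ≫ (ρ_ 𝖰).hom) ▷ Z := by
    unfold Y η' X ε; monoidal
  change G.map (Y Z) ≫ i (𝖰 ⊗ Z) ≫ (α_ V 𝖰 Z).inv = (i (𝖰 ⊗ Z) ≫ (α_ V 𝖰 Z).inv) ≫ _
  rw [← Category.assoc, hi, h]
  generalize (ρ_ 𝖰).inv ≫ Y (𝟙_ Obj) ≫ (ρ_ 𝖰).hom = y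
  simp

theorem isLoc_crossQ (hi : ∀ {Z W : Obj} (e : Z ⟶ W), G.map e ≫ i W = i Z ≫ V ◁ e) :
    IsLoc (tensorLeft 𝖰 ⋙ tensorLeft 𝖰 ⋙ G) ((V ⊗ 𝖰) ⊗ 𝖰)
      (fun Z => (i (𝖰 ⊗ 𝖰 ⊗ Z) ≫ (α_ V 𝖰 (𝖰 ⊗ Z)).inv) ≫ (α_ (V ⊗ 𝖰) 𝖰 Z).inv) (crossQ G)
      ((α_ V 𝖰 𝖰).hom ≫ V ◁ crossQQ ≫ (α_ V 𝖰 𝖰).inv) := by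
  intro Z
  change G.map (U Z) ≫ (i (𝖰 ⊗ 𝖰 ⊗ Z) ≫ (α_ V 𝖰 (𝖰 ⊗ Z)).inv) ≫ (α_ (V ⊗ 𝖰) 𝖰 Z).inv = _
  rw [Category.assoc, ← Category.assoc (G.map _), hi, Category.assoc, Category.assoc,
    Category.assoc]
  congr 1
  unfold U; monoidal

end IsLoc

/-- The word with `n` downward strands. -/
def Qs : ℕ → Obj
  | 0 => 𝟙_ Obj
  | n + 1 => Qs n ⊗ 𝖰

/-- The comparison of `F n` with a tensor product. -/
def FIso : ∀ n, ∀ Z, (F n).obj Z ≅ Qs n ⊗ Z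
  | 0, Z => (λ_ Z).symm
  | n + 1, Z => FIso n (𝖰 ⊗ Z) ≪≫ (α_ (Qs n) 𝖰 Z).symm

theorem FIso_nat (n : ℕ) {Z W : Obj} (e : Z ⟶ W) :
    (F n).map e ≫ (FIso n W).hom = (FIso n Z).hom ≫ Qs n ◁ e := by
  induction n generalizing Z W with
  | zero => exact leftUnitor_inv_naturality e
  | succ n ih =>
    change (F n).map (𝖰 ◁ e) ≫ (FIso n (𝖰 ⊗ W)).hom ≫ (α_ (Qs n) 𝖰 W).inv =
      ((FIso n (𝖰 ⊗ Z)).hom ≫ (α_ (Qs n) 𝖰 Z).inv) ≫ (Qs n ⊗ 𝖰) ◁ e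
    rw [reassoc_of% ih]; simp

/-- The subalgebra of the endomorphisms that come from an endomorphism of a word. -/
def locQ (n : ℕ) : Subalgebra ℂ (End (F n)) where
  carrier := {f | ∃ d, IsLoc (F n) (Qs n) (fun Z => (FIso n Z).hom) f d}
  mul_mem' := fun ⟨_, hd⟩ ⟨_, he⟩ => ⟨_, isLoc_mul hd he⟩
  add_mem' := fun ⟨_, hd⟩ ⟨_, he⟩ => ⟨_, isLoc_add hd he⟩
  algebraMap_mem' r := ⟨_, isLoc_algebraMap r⟩

/-- The algebra of endomorphisms of downward strands generated by dots and crossings. -/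
abbrev algQ (n : ℕ) : Subalgebra ℂ (End (F n)) := towerQ.D ⊥ n

/-- To factor a class, the part on the outer strands must be an endomorphism of a word. Dots and
crossings are such endomorphisms, and the property passes to the algebra they generate. -/
theorem algQ_le_locQ (n : ℕ) : algQ n ≤ locQ n := by
  have hx (n : ℕ) : towerQ.x n ∈ locQ (n + 1) := ⟨_, isLoc_dotQ (FIso_nat n)⟩
  have hs (n : ℕ) : towerQ.s n ∈ locQ (n + 2) := ⟨_, isLoc_crossQ (FIso_nat n)⟩
  have hsh (n : ℕ) (f : End (F n)) (hf : f ∈ locQ n) : towerQ.sh n f ∈ locQ (n + 1) := by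
    obtain ⟨d, hd⟩ := hf
    exact ⟨_, isLoc_addQ hd⟩
  induction n with
  | zero => exact bot_le
  | succ n ih =>
    cases n with
    | zero =>
      refine Algebra.adjoin_le ?_
      rintro _ (⟨a, ha, rfl⟩ | rfl)
      · exact hsh _ _ (ih ha)
      · exact hx 0
    | succ n =>
      refine Algebra.adjoin_le ?_
      rintro _ (⟨a, ha, rfl⟩ | rfl | rfl)
      · exact hsh _ _ (ih ha)
      · exact hx _
      · exact hs _

theorem tr_locQ {n : ℕ} {f : End (F n)} {d : Qs n ⟶ Qs n}
    (h : IsLoc (F n) (Qs n) (fun Z => (FIso n Z).hom) f d) : traceQ.tr n f = cls d := by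
  refine cls_conj (FIso n (𝟙_ Obj) ≪≫ ρ_ (Qs n)) _ _ ?_
  rw [Iso.trans_hom, reassoc_of% h (𝟙_ Obj), rightUnitor_naturality, Category.assoc]

theorem clsQ_prod (j n k : ℕ) (d : End (F n)) (hd : d ∈ algQ n) :
    traceQ.cyc j n (towerQ.sh n d * towerQ.x n ^ k) = traceQ.tr n d * traceQ.loop j k := by
  obtain ⟨e, he⟩ := algQ_le_locQ n hd
  rw [tr_locQ he, HeckeTower.Trace.loop, cycQ_eq, cycQ_eq]
  refine cycQ_tensor j (FIso n) (FIso_nat n) _ _ e fun Z => ?_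
  have h1 (n : ℕ) : (towerQ.x n ^ k).app Z = (F n).map (((towerQ.x 0) ^ k).app Z) := by
    induction k with
    | zero => exact ((F n).map_id _).symm
    | succ k ih =>
      rw [pow_succ, pow_succ]
      exact (congrArg (fun t => (F n).map (Y Z) ≫ t) ih).trans ((F n).map_comp _ _).symm
  change ((towerQ.x n ^ k).app Z ≫ d.app (𝖰 ⊗ Z)) ≫ _ = _
  rw [h1]
  have h2 (y : 𝖰 ⊗ Z ⟶ 𝖰 ⊗ Z) : ((F n).map y ≫ d.app (𝖰 ⊗ Z)) ≫ (FIso n (𝖰 ⊗ Z)).hom =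
      (FIso n (𝖰 ⊗ Z)).hom ≫ (e ⊗ₘ y) := by
    rw [Category.assoc, he (𝖰 ⊗ Z), reassoc_of% FIso_nat n y, MonoidalCategory.tensorHom_def']
  exact h2 _

/-- The sum of the dots on `n` downward strands. -/
def dotsQ : ∀ n, ∀ Z, (F n).obj Z ⟶ (F n).obj Z
  | 0 => fun _ => 0
  | n + 1 => fun Z => ((F n).map (Y Z) + dotsQ n (𝖰 ⊗ Z) :
      (F n).obj (𝖰 ⊗ Z) ⟶ (F n).obj (𝖰 ⊗ Z))

theorem dotSumQ (n : ℕ) (Z : Obj) : (HeckeTower.Trace.dotSum towerQ n).app Z = dotsQ n Z := by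
  induction n generalizing Z with
  | zero => rfl
  | succ n ih => exact congrArg ((F n).map (Y Z) + ·) (ih (𝖰 ⊗ Z))

theorem gamR_F (n : ℕ) (Z : Obj) : gamR ((F n).obj Z) = (F n).map (gamR Z) := by
  induction n generalizing Z with
  | zero => rfl
  | succ n ih => exact (ih (𝖰 ⊗ Z)).trans (congrArg _ (gamR_tensor 𝖰 Z))

theorem gam_F (n : ℕ) (Z : Obj) : gam ((F n).obj Z) =
    (F n).map (gam Z) + (-n : ℂ) • 𝟙 _ + (-2 : ℂ) • dotsQ n Z := by
  induction n generalizing Z with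
  | zero =>
    rw [dotsQ, Nat.cast_zero, neg_zero, zero_smul, smul_zero, add_zero, add_zero]
    rfl
  | succ n ih =>
    change gam ((F n).obj (𝖰 ⊗ Z)) = (F n).map (𝖰 ◁ gam Z) +
      (-(n + 1 : ℕ) : ℂ) • 𝟙 ((F n).obj (𝖰 ⊗ Z)) + (-2 : ℂ) • ((F n).map (Y Z) + dotsQ n (𝖰 ⊗ Z))
    rw [ih, gam_Q, Functor.map_sub, Functor.map_sub, Functor.map_smul, CategoryTheory.Functor.map_id]
    push_cast
    module

theorem clsQ_dotSum_mem (n : ℕ) (f : End (F n)) (hf : traceQ.tr n f ∈ genAlg) :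
    traceQ.tr n (HeckeTower.Trace.dotSum towerQ n * f) ∈ genAlg := by
  change cls (f.app _ ≫ (HeckeTower.Trace.dotSum towerQ n).app _) ∈ genAlg
  rw [dotSumQ]
  have h := gam_F n (𝟙_ Obj)
  rw [← gamR_unit, ← gamR_F] at h
  exact cls_dots_mem (by norm_num) h _ hf

/-- The product is the opposite one, since new strands appear to the right of the old ones. The
bottom algebra is trivial because the circles are kept with the upward strands. -/
theorem traceQ_mem (n : ℕ) (d : End (F n)) (hd : d ∈ algQ n) : traceQ.tr n d ∈ genAlg :=
  traceQ.tr_mem (B := ⊥) (Subalgebra.toSubmodule genAlg) (fun a b => b * a)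
    (fun _ ha _ hb => genAlg.mul_mem hb ha) clsQ_prod clsQ_dotSum_mem
    (by
      have h : traceQ.loop 0 0 = cls (𝟙 (𝖰 ⊗ 𝟙_ Obj)) := rfl
      have h2 : cls (𝟙 (𝖰 ⊗ 𝟙_ Obj)) = hNegOne := cls_conj (ρ_ 𝖰) _ _ (by simp)
      rw [h, h2]
      exact hNegOne_mem)
    (by
      intro b hb
      obtain ⟨r, rfl⟩ := Algebra.mem_bot.1 hb
      rw [Algebra.algebraMap_eq_smul_one, map_smul]
      refine genAlg.smul_mem ?_ r
      have h : traceQ.tr 0 1 = 1 := cls_id_one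
      rw [h]; exact one_mem _) n d hd

theorem cls_pure_mem {m n : ℕ} {a : End (F m)} {d : End (Ps n)} (ha : a ∈ algQ m)
    (hd : d ∈ algP n) : cls (a.app (Ps n) ≫ (F m).map d) ∈ genAlg := by
  obtain ⟨e, he⟩ := algQ_le_locQ m ha
  have h : cls (a.app (Ps n) ≫ (F m).map d) = cls (e ⊗ₘ d) := by
    refine cls_conj (FIso m (Ps n)) _ _ ?_
    rw [Category.assoc, FIso_nat, reassoc_of% he (Ps n), MonoidalCategory.tensorHom_def]
  rw [h, cls_tensor, ← tr_locQ he]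
  exact mul_mem (traceQ_mem m a ha) (cls_algP_mem n d hd)

end Heis

namespace Heis

open HomSpace

local notation "𝖯" => Obj.P
local notation "𝖰" => Obj.Q

/-! ### Closing one strand of each orientation -/

/-- The word with `m` downward strands followed by `n` upward strands. -/
abbrev O (m n : ℕ) : Obj := (F m).obj (Ps n)

/-- The cap that joins the innermost strands. -/
def cap (m n : ℕ) : O (m + 1) (n + 1) ⟶ O m n := (F m).map (ε (Ps n))
/-- The cup that creates two innermost strands. -/
def cup (m n : ℕ) : O m n ⟶ O (m + 1) (n + 1) := (F m).map (η (Ps n))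

/-- The morphisms in which the strands of different orientations do not interact. -/
def pureSpan (m n : ℕ) : Submodule ℂ (O m n ⟶ O m n) :=
  Submodule.span ℂ {f | ∃ a ∈ algQ m, ∃ d ∈ algP n, f = a.app (Ps n) ≫ (F m).map d}

theorem pure_mem {m n : ℕ} {a : End (F m)} {d : End (Ps n)} (ha : a ∈ algQ m) (hd : d ∈ algP n) :
    a.app (Ps n) ≫ (F m).map d ∈ pureSpan m n := Submodule.subset_span ⟨a, ha, d, hd, rfl⟩

theorem app_mem {m n : ℕ} {a : End (F m)} (ha : a ∈ algQ m) : a.app (Ps n) ∈ pureSpan m n := by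
  have h := pure_mem (n := n) ha (one_mem _)
  rw [show (1 : End (Ps n)) = 𝟙 (Ps n) from rfl, CategoryTheory.Functor.map_id,
    Category.comp_id] at h
  exact h

theorem map_mem {m n : ℕ} {d : End (Ps n)} (hd : d ∈ algP n) : (F m).map d ∈ pureSpan m n := by
  have h := pure_mem (m := m) (one_mem _) hd
  rw [show (1 : End (F m)) = 𝟙 (F m) from rfl, NatTrans.id_app, Category.id_comp] at h
  exact h

theorem id_mem (m n : ℕ) : 𝟙 (O m n) ∈ pureSpan m n := app_mem (one_mem _)

/-- Naturality moves the downward part of the second factor past the upward part of the first. -/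
theorem comp_mem {m n : ℕ} {f g : O m n ⟶ O m n} (hf : f ∈ pureSpan m n) (hg : g ∈ pureSpan m n) :
    f ≫ g ∈ pureSpan m n := by
  induction hf using Submodule.span_induction with
  | zero => rw [Limits.zero_comp]; exact zero_mem _
  | add x y _ _ h1 h2 => rw [Preadditive.add_comp]; exact add_mem h1 h2
  | smul r x _ h => rw [Linear.smul_comp]; exact Submodule.smul_mem _ r h
  | mem f hf =>
    obtain ⟨a, ha, d, hd, rfl⟩ := hf
    induction hg using Submodule.span_induction with
    | zero => rw [Limits.comp_zero]; exact zero_mem _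
    | add x y _ _ h1 h2 => rw [Preadditive.comp_add]; exact add_mem h1 h2
    | smul r x _ h => rw [Linear.comp_smul]; exact Submodule.smul_mem _ r h
    | mem g hg =>
      obtain ⟨b, hb, e, he, rfl⟩ := hg
      rw [Category.assoc, ← Category.assoc ((F m).map d), b.naturality, Category.assoc,
        ← Functor.map_comp, ← Category.assoc]
      exact pure_mem (a := b * a) (d := e * d) (mul_mem hb ha) (mul_mem he hd)

theorem cls_pureSpan_mem {m n : ℕ} {f : O m n ⟶ O m n} (hf : f ∈ pureSpan m n) :
    cls f ∈ genAlg := by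
  induction hf using Submodule.span_induction with
  | zero => rw [cls_zero]; exact zero_mem _
  | add x y _ _ h1 h2 => rw [cls_add]; exact add_mem h1 h2
  | smul r x _ h => rw [cls_smul]; exact genAlg.smul_mem h r
  | mem f hf =>
    obtain ⟨a, ha, d, hd, rfl⟩ := hf
    exact cls_pure_mem ha hd

theorem bubC_mem_algP (k n : ℕ) : (bubC k (Ps n) : End (Ps n)) ∈ algP n := by
  induction k using Nat.strong_induction_on with
  | _ k ih =>
  cases k with
  | zero => rw [bubC_zero]; exact one_mem _
  | succ k =>
    rw [bubC_succ]
    exact sum_mem (S := algP n) fun i hi => (algP n).mul_mem (bub_mem_algP _ n)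
      (ih i (Finset.mem_range.1 hi |>.trans (Nat.lt_succ_self k)))

theorem towerP_x_pow (k n : ℕ) : towerP.x n ^ k = (Xs k (Ps n) : End (𝖯 ⊗ Ps n)) := by
  induction k with
  | zero => rw [pow_zero, Xs_zero]; rfl
  | succ k ih => rw [pow_succ, ih, Xs_succ']; rfl

/-! ### Local moves for closing a pair of strands. -/

section

variable {Z : Obj}

theorem closeP_mono (k : ℕ) (a : Z ⟶ Z) :
    η Z ≫ 𝖰 ◁ (Xs k Z ≫ 𝖯 ◁ a) ≫ ε Z = bubC k Z ≫ a := by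
  rw [whiskerLeft_comp, Category.assoc, ε_nat, bubC, Category.assoc, Category.assoc]

/-- The closed strand crosses once and forms a left curl. -/
theorem closeP_cross (a b : 𝖯 ⊗ Z ⟶ 𝖯 ⊗ Z) :
    η (𝖯 ⊗ Z) ≫ 𝖰 ◁ (𝖯 ◁ b ≫ S Z ≫ 𝖯 ◁ a) ≫ ε (𝖯 ⊗ Z) = 0 := by
  rw [whiskerLeft_comp, Category.assoc, ← reassoc_of% η_nat, whiskerLeft_comp, Category.assoc,
    ε_nat, reassoc_of% left_curl, Limits.zero_comp, Limits.comp_zero]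

theorem closeP_add (a b : 𝖯 ⊗ Z ⟶ 𝖯 ⊗ Z) :
    η Z ≫ 𝖰 ◁ (a + b) ≫ ε Z = η Z ≫ 𝖰 ◁ a ≫ ε Z + η Z ≫ 𝖰 ◁ b ≫ ε Z := by
  rw [MonoidalPreadditive.whiskerLeft_add, Preadditive.add_comp, Preadditive.comp_add]

theorem closeU_mono (k : ℕ) (a : Z ⟶ Z) :
    𝖰 ◁ η Z ≫ U (𝖯 ⊗ Z) ≫ 𝖰 ◁ 𝖰 ◁ (Xs k Z ≫ 𝖯 ◁ a) ≫ 𝖰 ◁ ε Z =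
      (𝖰 ◁ η Z ≫ U (𝖯 ⊗ Z) ≫ 𝖰 ◁ 𝖰 ◁ Xs k Z ≫ 𝖰 ◁ ε Z) ≫ 𝖰 ◁ a := by
  simp only [Category.assoc, ← whiskerLeft_comp]
  rw [← ε_nat, whiskerLeft_comp_assoc]

/-- The closed strand meets both another downward and another upward strand. By `T_S_ε` these pull
apart into a cap followed by a cup, which is the source of the `turn` terms. -/
theorem closeU_cross (a b : 𝖯 ⊗ Z ⟶ 𝖯 ⊗ Z) :
    𝖰 ◁ η (𝖯 ⊗ Z) ≫ U (𝖯 ⊗ 𝖯 ⊗ Z) ≫ 𝖰 ◁ 𝖰 ◁ (𝖯 ◁ b ≫ S Z ≫ 𝖯 ◁ a) ≫ 𝖰 ◁ ε (𝖯 ⊗ Z) =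
      𝖰 ◁ b ≫ ε Z ≫ η Z ≫ 𝖰 ◁ a := by
  have h1 : 𝖰 ◁ η (𝖯 ⊗ Z) ≫ U (𝖯 ⊗ 𝖯 ⊗ Z) ≫ 𝖰 ◁ 𝖰 ◁ S Z ≫ 𝖰 ◁ ε (𝖯 ⊗ Z) = ε Z ≫ η Z := by
    rw [reassoc_of% η_U, ← whiskerLeft_comp, ← whiskerLeft_comp, T_S_ε, η_nat]
  have h2 : 𝖰 ◁ 𝖰 ◁ 𝖯 ◁ a ≫ 𝖰 ◁ ε (𝖯 ⊗ Z) = 𝖰 ◁ ε (𝖯 ⊗ Z) ≫ 𝖰 ◁ a := by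
    rw [← whiskerLeft_comp, ε_nat, whiskerLeft_comp]
  have h3 : 𝖰 ◁ η (𝖯 ⊗ Z) ≫ 𝖰 ◁ 𝖰 ◁ 𝖯 ◁ b = 𝖰 ◁ b ≫ 𝖰 ◁ η (𝖯 ⊗ Z) := by
    rw [← whiskerLeft_comp, ← η_nat, whiskerLeft_comp]
  simp only [whiskerLeft_comp, Category.assoc]
  rw [h2, ← reassoc_of% U_nat, reassoc_of% h3, reassoc_of% h1]

theorem closeU_add (a b : 𝖯 ⊗ Z ⟶ 𝖯 ⊗ Z) :
    𝖰 ◁ η Z ≫ U (𝖯 ⊗ Z) ≫ 𝖰 ◁ 𝖰 ◁ (a + b) ≫ 𝖰 ◁ ε Z =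
      𝖰 ◁ η Z ≫ U (𝖯 ⊗ Z) ≫ 𝖰 ◁ 𝖰 ◁ a ≫ 𝖰 ◁ ε Z +
      𝖰 ◁ η Z ≫ U (𝖯 ⊗ Z) ≫ 𝖰 ◁ 𝖰 ◁ b ≫ 𝖰 ◁ ε Z := by
  rw [MonoidalPreadditive.whiskerLeft_add, MonoidalPreadditive.whiskerLeft_add,
    Preadditive.add_comp, Preadditive.comp_add, Preadditive.comp_add]

/-- The dot slides through the cap onto a downward strand and then past `U`; the identity split off
there closes up to a counterclockwise circle. -/
theorem closeU_succ (k : ℕ) :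
    𝖰 ◁ η Z ≫ U (𝖯 ⊗ Z) ≫ 𝖰 ◁ 𝖰 ◁ Xs (k + 1) Z ≫ 𝖰 ◁ ε Z =
      Y Z ≫ (𝖰 ◁ η Z ≫ U (𝖯 ⊗ Z) ≫ 𝖰 ◁ 𝖰 ◁ Xs k Z ≫ 𝖰 ◁ ε Z) + 𝖰 ◁ bubC k Z := by
  have h1 : U (𝖯 ⊗ Z) ≫ 𝖰 ◁ Y (𝖯 ⊗ Z) = Y (𝖰 ⊗ 𝖯 ⊗ Z) ≫ U (𝖯 ⊗ Z) + 𝟙 _ := by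
    rw [Y_U, sub_add_cancel]
  have h2 : 𝖰 ◁ 𝖰 ◁ Xs (k + 1) Z ≫ 𝖰 ◁ ε Z =
      𝖰 ◁ Y (𝖯 ⊗ Z) ≫ 𝖰 ◁ 𝖰 ◁ Xs k Z ≫ 𝖰 ◁ ε Z := by
    rw [Xs_succ]
    simp only [← whiskerLeft_comp]
    rw [← reassoc_of% Y_nat, Y_ε, ← whiskerLeft_comp_assoc]
  rw [h2, reassoc_of% h1, Preadditive.add_comp, Preadditive.comp_add, Category.id_comp,
    Category.assoc, reassoc_of% Y_nat, bubC, whiskerLeft_comp, whiskerLeft_comp]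

end

theorem η_d_ε_mem_algP {n : ℕ} {d : 𝖯 ⊗ Ps n ⟶ 𝖯 ⊗ Ps n} (hd : towerP.Dec bubAlg n d) :
    (η (Ps n) ≫ 𝖰 ◁ d ≫ ε (Ps n) : End (Ps n)) ∈ algP n := by
  refine HeckeTower.Dec.ind (p := fun n (d : 𝖯 ⊗ Ps n ⟶ 𝖯 ⊗ Ps n) =>
    (η (Ps n) ≫ 𝖰 ◁ d ≫ ε (Ps n) : End (Ps n)) ∈ algP n) ?_ ?_ ?_ hd
  · intro n a ha k
    rw [towerP_x_pow]
    exact (congrArg (· ∈ algP n) (closeP_mono k a)).mpr ((algP n).mul_mem ha (bubC_mem_algP k n))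
  · intro n a _ b _
    exact (congrArg (· ∈ algP (n + 1)) (closeP_cross (Z := Ps n) a b)).mpr
      ((algP (n + 1)).zero_mem)
  · intro n a b h1 h2
    exact (congrArg (· ∈ algP n) (closeP_add (Z := Ps n) a b)).mpr ((algP n).add_mem h1 h2)

/-- The morphisms that are sums of morphisms without interaction and of morphisms that pass through
one cap followed by one cup. -/
inductive Mid : ∀ m n, (O m n ⟶ O m n) → Prop
  | pure {m n : ℕ} {f : O m n ⟶ O m n} (hf : f ∈ pureSpan m n) : Mid m n f
  | turn {m n : ℕ} {f g : O (m + 1) (n + 1) ⟶ O (m + 1) (n + 1)} (hf : f ∈ pureSpan (m + 1) (n + 1))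
      (hg : g ∈ pureSpan (m + 1) (n + 1)) : Mid (m + 1) (n + 1) (f ≫ cap m n ≫ cup m n ≫ g)
  | add {m n : ℕ} {f g : O m n ⟶ O m n} (hf : Mid m n f) (hg : Mid m n g) : Mid m n (f + g)

theorem Mid.comp {m n : ℕ} {f g : O m n ⟶ O m n} (hf : Mid m n f) (hg : g ∈ pureSpan m n) :
    Mid m n (f ≫ g) := by
  induction hf with
  | pure hf => exact pure (comp_mem hf hg)
  | turn hf hf' =>
    simp only [Category.assoc]
    exact turn hf (comp_mem hf' hg)
  | add _ _ h1 h2 => rw [Preadditive.add_comp]; exact (h1 hg).add (h2 hg)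

theorem Mid.precomp {m n : ℕ} {f g : O m n ⟶ O m n} (hf : Mid m n f) (hg : g ∈ pureSpan m n) :
    Mid m n (g ≫ f) := by
  induction hf with
  | pure hf => exact pure (comp_mem hg hf)
  | turn hf hf' =>
    rw [← Category.assoc]
    exact turn (comp_mem hg hf) hf'
  | add _ _ h1 h2 => rw [Preadditive.comp_add]; exact (h1 hg).add (h2 hg)

theorem Mid.smul {m n : ℕ} {f : O m n ⟶ O m n} (r : ℂ) (hf : Mid m n f) : Mid m n (r • f) := by
  have h := hf.comp (Submodule.smul_mem _ r (id_mem m n))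
  rwa [Linear.comp_smul, Category.comp_id] at h

/-- Without dots the closed strand is a curl and vanishes by `curl_U`; dots are then added one at a
time by `closeU_succ`. -/
theorem η_U_Xs_mem (m n k : ℕ) : (F m).map (𝖰 ◁ η (Ps n) ≫ U (𝖯 ⊗ Ps n) ≫
    𝖰 ◁ 𝖰 ◁ Xs k (Ps n) ≫ 𝖰 ◁ ε (Ps n)) ∈ pureSpan (m + 1) n := by
  induction k with
  | zero =>
    have h : 𝖰 ◁ η (Ps n) ≫ U (𝖯 ⊗ Ps n) ≫ 𝖰 ◁ 𝖰 ◁ Xs 0 (Ps n) ≫ 𝖰 ◁ ε (Ps n) = 0 := by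
      rw [Xs_zero, whiskerLeft_id, whiskerLeft_id, Category.id_comp, curl_U]
    rw [h, Functor.map_zero]
    exact zero_mem _
  | succ k ih =>
    rw [closeU_succ, Functor.map_add, Functor.map_comp]
    exact add_mem (comp_mem (app_mem (m := m + 1) (a := dotQ (F m)) (HeckeTower.x_mem m)) ih)
      (map_mem (m := m + 1) (bubC_mem_algP k n))

theorem map_comp_four (G : Obj ⥤ Obj) {A B C D E : Obj} (f : A ⟶ B) (g : B ⟶ C) (h : C ⟶ D)
    (k : D ⟶ E) : G.map (f ≫ g ≫ h ≫ k) = G.map f ≫ G.map g ≫ G.map h ≫ G.map k := by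
  simp only [Functor.map_comp]

theorem η_U_d_mid {m n : ℕ} {d : 𝖯 ⊗ Ps n ⟶ 𝖯 ⊗ Ps n} (hd : towerP.Dec bubAlg n d) :
    Mid (m + 1) n ((F m).map (𝖰 ◁ η (Ps n) ≫ U (𝖯 ⊗ Ps n) ≫ 𝖰 ◁ 𝖰 ◁ d ≫ 𝖰 ◁ ε (Ps n))) := by
  refine HeckeTower.Dec.ind (p := fun n (d : 𝖯 ⊗ Ps n ⟶ 𝖯 ⊗ Ps n) => Mid (m + 1) n
    ((F m).map (𝖰 ◁ η (Ps n) ≫ U (𝖯 ⊗ Ps n) ≫ 𝖰 ◁ 𝖰 ◁ d ≫ 𝖰 ◁ ε (Ps n)))) ?_ ?_ ?_ hd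
  · intro n a ha k
    rw [towerP_x_pow]
    refine (congrArg (fun t => Mid (m + 1) n ((F m).map t)) (closeU_mono k a)).mpr ?_
    rw [Functor.map_comp]
    exact Mid.pure (comp_mem (η_U_Xs_mem m n k) (map_mem (m := m + 1) ha))
  · intro n a ha b hb
    refine (congrArg (fun t => Mid (m + 1) (n + 1) ((F m).map t))
      (closeU_cross (Z := Ps n) a b)).mpr ?_
    refine (congrArg (Mid (m + 1) (n + 1)) (map_comp_four (F m) (A := 𝖰 ⊗ 𝖯 ⊗ Ps n) (B := 𝖰 ⊗ 𝖯 ⊗ Ps n)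
      (D := 𝖰 ⊗ 𝖯 ⊗ Ps n) (E := 𝖰 ⊗ 𝖯 ⊗ Ps n) (𝖰 ◁ b) (ε (Ps n)) (η (Ps n)) (𝖰 ◁ a))).mpr ?_
    exact Mid.turn (map_mem (m := m + 1) hb) (map_mem (m := m + 1) ha)
  · intro n a b h1 h2
    refine (congrArg (fun t => Mid (m + 1) n ((F m).map t)) (closeU_add (Z := Ps n) a b)).mpr ?_
    rw [Functor.map_add]
    exact h1.add h2

/-- The closure of the innermost strands by a cup and a cap, with `a` on the downward strands and
`d` on the upward strands. -/
def closeUp {m n : ℕ} (a : End (F (m + 1))) (d : 𝖯 ⊗ Ps n ⟶ 𝖯 ⊗ Ps n) : O m n ⟶ O m n :=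
  (F m).map (η (Ps n)) ≫ (a.app (𝖯 ⊗ Ps n) :) ≫ (F m).map (𝖰 ◁ d ≫ ε (Ps n))

theorem x_pow_app (m k : ℕ) {Z : Obj} (d : 𝖯 ⊗ Z ⟶ 𝖯 ⊗ Z) :
    (show (F m).obj (𝖰 ⊗ 𝖯 ⊗ Z) ⟶ (F m).obj (𝖰 ⊗ 𝖯 ⊗ Z) from (towerQ.x m ^ k).app (𝖯 ⊗ Z)) ≫
      (F m).map (𝖰 ◁ d ≫ ε Z) = (F m).map (𝖰 ◁ (d ≫ Xs k Z) ≫ ε Z) := by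
  induction k with
  | zero =>
    rw [Xs_zero, Category.comp_id]
    exact Category.id_comp _
  | succ k ih =>
    rw [pow_succ]
    refine (Category.assoc _ _ _).trans ?_
    refine (congrArg (fun t => (F m).map (Y (𝖯 ⊗ Z)) ≫ t) ih).trans ?_
    rw [← Functor.map_comp, ← reassoc_of% Y_nat, Y_ε, Xs_succ, ← whiskerLeft_comp_assoc,
      Category.assoc]

theorem conj_natural {G : Obj ⥤ Obj} (a b : ∀ Z, G.obj (𝖰 ⊗ Z) ⟶ G.obj (𝖰 ⊗ Z))
    (ha : ∀ {Z W : Obj} (f : Z ⟶ W), G.map (𝖰 ◁ f) ≫ a W = a Z ≫ G.map (𝖰 ◁ f))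
    (hb : ∀ {Z W : Obj} (f : Z ⟶ W), G.map (𝖰 ◁ f) ≫ b W = b Z ≫ G.map (𝖰 ◁ f)) {Z W : Obj}
    (f : Z ⟶ W) (u : 𝖰 ⊗ W ⟶ 𝖰 ⊗ W) (g : W ⟶ Z) :
    G.map (𝖰 ◁ f) ≫ (b W ≫ G.map u ≫ a W) ≫ G.map (𝖰 ◁ g) =
      b Z ≫ G.map (𝖰 ◁ f ≫ u ≫ 𝖰 ◁ g) ≫ a Z := by
  rw [Functor.map_comp, Functor.map_comp]
  simp only [Category.assoc]
  rw [ha, reassoc_of% hb]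

/-- If the innermost downward strand is separate, its dots pass to the upward side and the closure
lies in `algP`. If it crosses once, `a` and `b` move out by naturality, leaving a closure with one
`U`, where the upward strand is treated in the same way. -/
theorem closeUp_mid {m n : ℕ} {a : End (F (m + 1))} {d : 𝖯 ⊗ Ps n ⟶ 𝖯 ⊗ Ps n}
    (ha : towerQ.Dec ⊥ m a) (hd : (d : End (Ps (n + 1))) ∈ algP (n + 1)) :
    Mid m n (closeUp a d) := by
  refine HeckeTower.Dec.ind (p := fun m (a : End (F (m + 1))) => Mid m n (closeUp a d))
    ?_ ?_ ?_ ha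
  · intro m a ha k
    have h : closeUp (towerQ.sh m a * towerQ.x m ^ k) d =
        (F m).map (η (Ps n) ≫ 𝖰 ◁ (d ≫ Xs k (Ps n)) ≫ ε (Ps n)) ≫ a.app (Ps n) := by
      have h1 := congrArg (fun t => (F m).map (η (Ps n)) ≫ t ≫ a.app (Ps n)) (x_pow_app m k d)
      rw [Functor.map_comp, Category.assoc]
      refine Eq.trans ?_ h1
      have h2 := a.naturality (𝖰 ◁ d ≫ ε (Ps n))
      refine congrArg ((F m).map (η (Ps n)) ≫ ·) ((Category.assoc _ _ _).trans ?_)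
      refine Eq.trans ?_ (Category.assoc _ _ _).symm
      exact congrArg (_ ≫ ·) h2.symm
    rw [h]
    refine Mid.pure (comp_mem (map_mem (η_d_ε_mem_algP (HeckeTower.dec_of_mem ?_))) (app_mem ha))
    exact (algP (n + 1)).mul_mem (Xs_mem_algP k n) hd
  · intro m a ha b hb
    have h : closeUp (towerQ.sh _ a * towerQ.s m * towerQ.sh _ b) d = b.app (Ps n) ≫
        (F m).map (𝖰 ◁ η (Ps n) ≫ U (𝖯 ⊗ Ps n) ≫ 𝖰 ◁ 𝖰 ◁ d ≫ 𝖰 ◁ ε (Ps n)) ≫ a.app (Ps n) := by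
      rw [← whiskerLeft_comp]
      exact conj_natural (G := F m) (fun Z => a.app Z) (fun Z => b.app Z) (fun f => a.naturality f)
        (fun f => b.naturality f) (η (Ps n)) (U (𝖯 ⊗ Ps n)) (𝖰 ◁ d ≫ ε (Ps n))
    rw [h]
    exact ((η_U_d_mid (HeckeTower.dec_of_mem hd)).comp (app_mem ha)).precomp (app_mem hb)
  · intro m a b h1 h2
    have h : closeUp (a + b) d = closeUp a d + closeUp b d := by
      have h3 := (Preadditive.add_comp _ _ _ (a.app (𝖯 ⊗ Ps n)) (b.app (𝖯 ⊗ Ps n))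
        ((F m).map (𝖰 ◁ d ≫ ε (Ps n))))
      exact (congrArg ((F m).map (η (Ps n)) ≫ ·) h3).trans (Preadditive.comp_add _ _ _ _ _ _)
    rw [h]
    exact h1.add h2

theorem cup_cap_mid {m n : ℕ} {f : O (m + 1) (n + 1) ⟶ O (m + 1) (n + 1)}
    (hf : f ∈ pureSpan (m + 1) (n + 1)) : Mid m n (cup m n ≫ f ≫ cap m n) := by
  induction hf using Submodule.span_induction with
  | zero => rw [Limits.zero_comp, Limits.comp_zero]; exact Mid.pure (zero_mem _)
  | add x y _ _ h1 h2 => rw [Preadditive.add_comp, Preadditive.comp_add]; exact h1.add h2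
  | smul r x _ h => rw [Linear.smul_comp, Linear.comp_smul]; exact h.smul r
  | mem f hf =>
    obtain ⟨a, ha, d, hd, rfl⟩ := hf
    have h : cup m n ≫ (a.app (Ps (n + 1)) ≫ (F (m + 1)).map d) ≫ cap m n = closeUp a d := by
      unfold closeUp
      rw [Functor.map_comp, Category.assoc]
      rfl
    rw [h]
    exact closeUp_mid (HeckeTower.dec_of_mem ha) hd

end Heis

namespace Heis

open HomSpace

local notation "𝖯" => Obj.P
local notation "𝖰" => Obj.Q

/-! ### Normal forms -/

/-- The sums of compositions of caps and morphisms without interaction. -/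
inductive Capped (a b : ℕ) : ∀ m n, (O a b ⟶ O m n) → Prop
  | pure {f : O a b ⟶ O a b} (hf : f ∈ pureSpan a b) : Capped a b a b f
  | cap {m n : ℕ} {f : O a b ⟶ O (m + 1) (n + 1)} {g : O m n ⟶ O m n}
      (hf : Capped a b (m + 1) (n + 1) f) (hg : g ∈ pureSpan m n) : Capped a b m n (f ≫ cap m n ≫ g)
  | zero (m n : ℕ) : Capped a b m n 0
  | add {m n : ℕ} {f g : O a b ⟶ O m n} (hf : Capped a b m n f) (hg : Capped a b m n g) :
      Capped a b m n (f + g)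

/-- The sums of compositions of first caps and then cups, with morphisms without interaction in
between. -/
inductive Normal (a b : ℕ) : ∀ m n, (O a b ⟶ O m n) → Prop
  | of {m n : ℕ} {f : O a b ⟶ O m n} (hf : Capped a b m n f) : Normal a b m n f
  | cup {m n : ℕ} {f : O a b ⟶ O m n} {g : O (m + 1) (n + 1) ⟶ O (m + 1) (n + 1)}
      (hf : Normal a b m n f) (hg : g ∈ pureSpan (m + 1) (n + 1)) :
      Normal a b (m + 1) (n + 1) (f ≫ cup m n ≫ g)
  | add {m n : ℕ} {f g : O a b ⟶ O m n} (hf : Normal a b m n f) (hg : Normal a b m n g) :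
      Normal a b m n (f + g)

variable {a b m n : ℕ}

theorem Capped.comp {f : O a b ⟶ O m n} (hf : Capped a b m n f) {g : O m n ⟶ O m n}
    (hg : g ∈ pureSpan m n) : Capped a b m n (f ≫ g) := by
  induction hf with
  | pure hf => exact pure (comp_mem hf hg)
  | cap hf hg' =>
    rw [Category.assoc, Category.assoc]
    exact cap hf (comp_mem hg' hg)
  | zero => rw [Limits.zero_comp]; exact zero _ _
  | add _ _ h1 h2 => rw [Preadditive.add_comp]; exact (h1 hg).add (h2 hg)

theorem Normal.comp_pure {f : O a b ⟶ O m n} (hf : Normal a b m n f) {g : O m n ⟶ O m n}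
    (hg : g ∈ pureSpan m n) : Normal a b m n (f ≫ g) := by
  induction hf with
  | of hf => exact of (hf.comp hg)
  | cup hf hg' =>
    rw [Category.assoc, Category.assoc]
    exact cup hf (comp_mem hg' hg)
  | add _ _ h1 h2 => rw [Preadditive.add_comp]; exact (h1 hg).add (h2 hg)

theorem Normal.comp_cup {f : O a b ⟶ O m n} (hf : Normal a b m n f) :
    Normal a b (m + 1) (n + 1) (f ≫ Heis.cup m n) := by
  simpa using hf.cup (id_mem _ _)

theorem Capped.comp_cap {f : O a b ⟶ O (m + 1) (n + 1)} (hf : Capped a b (m + 1) (n + 1) f) :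
    Capped a b m n (f ≫ Heis.cap m n) := by
  simpa using hf.cap (id_mem _ _)

/-- The new cap meets the last cup, and `cup_cap_mid` replaces the pair. In a `turn` term the cap
has moved below the cup, where the inductive hypothesis for the shorter composition absorbs it. -/
theorem Normal.comp_pure_cap {f : O a b ⟶ O (m + 1) (n + 1)} (hf : Normal a b (m + 1) (n + 1) f)
    {p : O (m + 1) (n + 1) ⟶ O (m + 1) (n + 1)} (hp : p ∈ pureSpan (m + 1) (n + 1)) :
    Normal a b m n (f ≫ p ≫ Heis.cap m n) := by
  have key (m n : ℕ) (f : O a b ⟶ O m n) (hf : Normal a b m n f) : match m, n, f with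
      | m + 1, n + 1, f => ∀ p ∈ pureSpan (m + 1) (n + 1), Normal a b m n (f ≫ p ≫ Heis.cap m n)
      | _, _, _ => True := by
    induction hf with
    | @of m n f hf =>
      rcases m with _ | m <;> rcases n with _ | n <;> try trivial
      intro p hp
      rw [← Category.assoc]
      exact of (hf.comp hp).comp_cap
    | @cup m n f g hf hg ih =>
      intro p hp
      have h : (f ≫ Heis.cup m n ≫ g) ≫ p ≫ Heis.cap m n =
          f ≫ (Heis.cup m n ≫ (g ≫ p) ≫ Heis.cap m n) := by simp only [Category.assoc]
      rw [h]
      have hm := cup_cap_mid (comp_mem hg hp)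
      generalize Heis.cup m n ≫ (g ≫ p) ≫ Heis.cap m n = e at hm
      clear h hp hg p g
      induction hm with
      | pure he => exact hf.comp_pure he
      | turn h1 h2 =>
        rw [← Category.assoc _ _ (_ ≫ _), ← Category.assoc]
        exact cup (by simpa using ih _ h1) h2
      | add _ _ h1 h2 => rw [Preadditive.comp_add]; exact (h1 hf ih).add (h2 hf ih)
    | @add m n f g _ _ h1 h2 =>
      rcases m with _ | m <;> rcases n with _ | n <;> try trivial
      intro p hp
      rw [Preadditive.add_comp]
      exact (h1 p hp).add (h2 p hp)
  exact key _ _ f hf p hp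

theorem Normal.comp_cap {f : O a b ⟶ O (m + 1) (n + 1)} (hf : Normal a b (m + 1) (n + 1) f) :
    Normal a b m n (f ≫ Heis.cap m n) := by
  simpa using hf.comp_pure_cap (id_mem _ _)

theorem Normal.zero (a b m n : ℕ) : Normal a b m n 0 := of (Capped.zero _ _)

theorem Normal.comp {f : O a b ⟶ O m n} (hf : Normal a b m n f) {k l : ℕ} {g : O m n ⟶ O k l}
    (hg : Normal m n k l g) : Normal a b k l (f ≫ g) := by
  induction hg with
  | of hg =>
    induction hg with
    | pure hg => exact hf.comp_pure hg
    | cap _ hp ih =>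
      rw [← Category.assoc, ← Category.assoc]
      exact ih.comp_cap.comp_pure hp
    | zero => rw [Limits.comp_zero]; exact zero _ _ _ _
    | add _ _ h1 h2 => rw [Preadditive.comp_add]; exact h1.add h2
  | cup _ hp ih =>
    rw [← Category.assoc]
    exact ih.cup hp
  | add _ _ h1 h2 => rw [Preadditive.comp_add]; exact h1.add h2

theorem normal_pure {f : O m n ⟶ O m n} (hf : f ∈ pureSpan m n) : Normal m n m n f :=
  Normal.of (Capped.pure hf)

theorem normal_cup (m n : ℕ) : Normal m n (m + 1) (n + 1) (cup m n) := by
  simpa using (normal_pure (id_mem m n)).comp_cup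

theorem normal_cap (m n : ℕ) : Normal (m + 1) (n + 1) m n (cap m n) := by
  simpa using (normal_pure (id_mem (m + 1) (n + 1))).comp_cap

/-- The morphisms without interaction, with separate source and target. -/
inductive PureHom (a b : ℕ) : ∀ m n, (O a b ⟶ O m n) → Prop
  | mk {f : O a b ⟶ O a b} (hf : f ∈ pureSpan a b) : PureHom a b a b f

theorem PureHom.add {f g : O a b ⟶ O m n} (hf : PureHom a b m n f) (hg : PureHom a b m n g) :
    PureHom a b m n (f + g) := by
  cases hf with
  | mk hf => cases hg with
    | mk hg => exact mk (add_mem hf hg)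

/-- Every cap lowers the number of downward strands, so a nonzero term that restores it contains no
cap. -/
theorem Capped.pureHom {f : O a b ⟶ O m n} (hf : Capped a b m n f) :
    f = 0 ∨ m < a ∨ PureHom a b m n f := by
  induction hf with
  | pure hf => exact Or.inr (Or.inr (PureHom.mk hf))
  | cap _ _ ih =>
    rcases ih with h | h | h
    · exact Or.inl (by rw [h, Limits.zero_comp])
    · exact Or.inr (Or.inl (by omega))
    · cases h
      exact Or.inr (Or.inl (by omega))
  | zero => exact Or.inl rfl
  | add _ _ h1 h2 =>
    rcases h1 with h1 | h1 | h1
    · rwa [h1, zero_add]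
    · exact Or.inr (Or.inl h1)
    · rcases h2 with h2 | h2 | h2
      · rw [h2, add_zero]; exact Or.inr (Or.inr h1)
      · exact Or.inr (Or.inl h2)
      · exact Or.inr (Or.inr (h1.add h2))

/-! ### Classes of normal forms. -/

/-- The sums of compositions that end with a cup and a morphism without interaction. -/
inductive Cupped (a b : ℕ) : ∀ m n, (O a b ⟶ O m n) → Prop
  | cup {m n : ℕ} {f : O a b ⟶ O m n} {g : O (m + 1) (n + 1) ⟶ O (m + 1) (n + 1)}
      (hf : Normal a b m n f) (hg : g ∈ pureSpan (m + 1) (n + 1)) :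
      Cupped a b (m + 1) (n + 1) (f ≫ cup m n ≫ g)
  | zero (m n : ℕ) : Cupped a b m n 0
  | add {m n : ℕ} {f g : O a b ⟶ O m n} (hf : Cupped a b m n f) (hg : Cupped a b m n g) :
      Cupped a b m n (f + g)

theorem Normal.decomp {f : O a b ⟶ O m n} (hf : Normal a b m n f) :
    ∃ g h, Capped a b m n g ∧ Cupped a b m n h ∧ f = g + h := by
  induction hf with
  | of hf => exact ⟨_, 0, hf, Cupped.zero _ _, (add_zero _).symm⟩
  | cup hf hg => exact ⟨0, _, Capped.zero _ _, Cupped.cup hf hg, (zero_add _).symm⟩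
  | add _ _ h1 h2 =>
    obtain ⟨g1, e1, hg1, he1, rfl⟩ := h1
    obtain ⟨g2, e2, hg2, he2, rfl⟩ := h2
    exact ⟨_, _, hg1.add hg2, he1.add he2, by abel⟩

/-- Cyclicity moves everything from the last cup on to the bottom, leaving a normal endomorphism of
one downward strand fewer. -/
theorem Cupped.cls_comp_mem {f : O a b ⟶ O m n} (hf : Cupped a b m n f) {g : O m n ⟶ O a b}
    (hg : Normal m n a b g)
    (ih : ∀ k < m, ∀ l, ∀ e : O k l ⟶ O k l, Normal k l k l e → cls e ∈ genAlg) :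
    cls (f ≫ g) ∈ genAlg := by
  induction hf with
  | cup hf hp =>
    rw [Category.assoc, cls_comm]
    exact ih _ (Nat.lt_succ_self _) _ _ ((((normal_cup _ _).comp_pure hp).comp hg).comp hf)
  | zero => rw [Limits.zero_comp, cls_zero]; exact zero_mem _
  | add _ _ h1 h2 => rw [Preadditive.add_comp, cls_add]; exact add_mem (h1 hg ih) (h2 hg ih)

theorem Normal.cls_mem {f : O m n ⟶ O m n} (hf : Normal m n m n f) : cls f ∈ genAlg := by
  induction m using Nat.strong_induction_on generalizing n with
  | _ m ih =>
  obtain ⟨g, h, hg, hh, rfl⟩ := hf.decomp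
  rw [cls_add]
  refine add_mem ?_ ?_
  · rcases hg.pureHom with hg | hg | hg
    · rw [hg, cls_zero]; exact zero_mem _
    · exact absurd hg (lt_irrefl _)
    · cases hg with
      | mk hg => exact cls_pureSpan_mem hg
  · rw [← Category.comp_id h]
    exact hh.cls_comp_mem (normal_pure (id_mem m n)) fun k hk l e he => ih k hk he

end Heis

namespace Heis

open HomSpace

local notation "𝖯" => Obj.P
local notation "𝖰" => Obj.Q

/-! ### Moving new strands into position -/

/-- Moving an upward strand through `m` downward strands. -/
def κ : ∀ m Z, 𝖯 ⊗ (F m).obj Z ⟶ (F m).obj (𝖯 ⊗ Z)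
  | 0, Z => 𝟙 (𝖯 ⊗ Z)
  | m + 1, Z => (κ m (𝖰 ⊗ Z) ≫ (F m).map (T Z) :
      𝖯 ⊗ (F m).obj (𝖰 ⊗ Z) ⟶ (F m).obj (𝖰 ⊗ 𝖯 ⊗ Z))

/-- Moving an upward strand back through `m` downward strands. -/
def κr : ∀ m Z, (F m).obj (𝖯 ⊗ Z) ⟶ 𝖯 ⊗ (F m).obj Z
  | 0, Z => 𝟙 (𝖯 ⊗ Z)
  | m + 1, Z => ((F m).map (T' Z) ≫ κr m (𝖰 ⊗ Z) :
      (F m).obj (𝖰 ⊗ 𝖯 ⊗ Z) ⟶ 𝖯 ⊗ (F m).obj (𝖰 ⊗ Z))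

/-- A downward strand on the left of `m` downward strands. -/
def ι : ∀ m Z, 𝖰 ⊗ (F m).obj Z ≅ (F m).obj (𝖰 ⊗ Z)
  | 0, Z => Iso.refl (𝖰 ⊗ Z)
  | m + 1, Z => ι m (𝖰 ⊗ Z)

/-- Only `T ≫ T'` is an identity, so this inverse is one-sided; the other composite is controlled by
`fam_κr_κ`. -/
theorem κ_κr (m : ℕ) (Z : Obj) : κ m Z ≫ κr m Z = 𝟙 _ := by
  induction m generalizing Z with
  | zero => exact Category.id_comp _
  | succ m ih =>
    change (κ m (𝖰 ⊗ Z) ≫ (F m).map (T Z)) ≫ (F m).map (T' Z) ≫ κr m (𝖰 ⊗ Z) = _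
    rw [Category.assoc, ← Functor.map_comp_assoc, T_T', CategoryTheory.Functor.map_id,
      Category.id_comp, ih]
    rfl

theorem κ_nat (m : ℕ) {Z W : Obj} (f : Z ⟶ W) :
    𝖯 ◁ (F m).map f ≫ κ m W = κ m Z ≫ (F m).map (𝖯 ◁ f) := by
  induction m generalizing Z W with
  | zero => exact (Category.comp_id _).trans (Category.id_comp _).symm
  | succ m ih =>
    change 𝖯 ◁ (F m).map (𝖰 ◁ f) ≫ κ m (𝖰 ⊗ W) ≫ (F m).map (T W) =
      (κ m (𝖰 ⊗ Z) ≫ (F m).map (T Z)) ≫ (F m).map (𝖰 ◁ 𝖯 ◁ f)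
    rw [reassoc_of% ih, Category.assoc, ← Functor.map_comp, ← Functor.map_comp, T_nat]

theorem κr_nat (m : ℕ) {Z W : Obj} (f : Z ⟶ W) :
    (F m).map (𝖯 ◁ f) ≫ κr m W = κr m Z ≫ 𝖯 ◁ (F m).map f := by
  induction m generalizing Z W with
  | zero => exact (Category.comp_id _).trans (Category.id_comp _).symm
  | succ m ih =>
    change (F m).map (𝖰 ◁ 𝖯 ◁ f) ≫ (F m).map (T' W) ≫ κr m (𝖰 ⊗ W) =
      ((F m).map (T' Z) ≫ κr m (𝖰 ⊗ Z)) ≫ 𝖯 ◁ (F m).map (𝖰 ◁ f)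
    rw [Category.assoc, ← ih, ← Functor.map_comp_assoc, T'_nat, Functor.map_comp_assoc]

theorem ι_nat (m : ℕ) {Z W : Obj} (f : Z ⟶ W) :
    𝖰 ◁ (F m).map f ≫ (ι m W).hom = (ι m Z).hom ≫ (F m).map (𝖰 ◁ f) := by
  induction m generalizing Z W with
  | zero => exact (Category.comp_id _).trans (Category.id_comp _).symm
  | succ m ih => exact ih (𝖰 ◁ f)

theorem ι_inv_nat (m : ℕ) {Z W : Obj} (f : Z ⟶ W) :
    (F m).map (𝖰 ◁ f) ≫ (ι m W).inv = (ι m Z).inv ≫ 𝖰 ◁ (F m).map f := by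
  rw [Iso.comp_inv_eq, Category.assoc, ι_nat, Iso.inv_hom_id_assoc]

theorem S_κ_κ (m : ℕ) (Z : Obj) : S ((F m).obj Z) ≫ 𝖯 ◁ κ m Z ≫ κ m (𝖯 ⊗ Z) =
    (𝖯 ◁ κ m Z ≫ κ m (𝖯 ⊗ Z)) ≫ (F m).map (S Z) := by
  induction m generalizing Z with
  | zero =>
    change S Z ≫ 𝖯 ◁ 𝟙 (𝖯 ⊗ Z) ≫ 𝟙 (𝖯 ⊗ 𝖯 ⊗ Z) = (𝖯 ◁ 𝟙 (𝖯 ⊗ Z) ≫ 𝟙 (𝖯 ⊗ 𝖯 ⊗ Z)) ≫ S Z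
    simp
  | succ m ih =>
    change S ((F m).obj (𝖰 ⊗ Z)) ≫ 𝖯 ◁ (κ m (𝖰 ⊗ Z) ≫ (F m).map (T Z)) ≫
      κ m (𝖰 ⊗ 𝖯 ⊗ Z) ≫ (F m).map (T (𝖯 ⊗ Z)) = (𝖯 ◁ (κ m (𝖰 ⊗ Z) ≫ (F m).map (T Z)) ≫
      κ m (𝖰 ⊗ 𝖯 ⊗ Z) ≫ (F m).map (T (𝖯 ⊗ Z))) ≫ (F m).map (𝖰 ◁ S Z)
    rw [whiskerLeft_comp, Category.assoc, reassoc_of% κ_nat, reassoc_of% ih]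
    simp only [Category.assoc, ← Functor.map_comp]
    rw [S_T_T]

/-! ### Words in crossings -/

/-- The crossings of neighbouring downward strands. -/
inductive UGen : ∀ m, End (F m) → Prop
  | s (m : ℕ) : UGen (m + 2) (towerQ.s m)
  | sh {m : ℕ} {f : End (F m)} (hf : UGen m f) : UGen (m + 1) (towerQ.sh m f)

theorem UGen.mem_algQ {m : ℕ} {f : End (F m)} (h : UGen m f) : f ∈ algQ m := by
  induction h with
  | s m => exact HeckeTower.s_mem m
  | sh _ ih => exact HeckeTower.sh_mem ih

theorem UGen.κ_comm {m : ℕ} {f : End (F m)} (h : UGen m f) (Z : Obj) :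
    𝖯 ◁ f.app Z ≫ κ m Z = κ m Z ≫ f.app (𝖯 ⊗ Z) := by
  induction h generalizing Z with
  | s m =>
    change 𝖯 ◁ (F m).map (U Z) ≫ (κ m (𝖰 ⊗ 𝖰 ⊗ Z) ≫ (F m).map (T (𝖰 ⊗ Z))) ≫
      (F m).map (𝖰 ◁ T Z) = ((κ m (𝖰 ⊗ 𝖰 ⊗ Z) ≫ (F m).map (T (𝖰 ⊗ Z))) ≫
      (F m).map (𝖰 ◁ T Z)) ≫ (F m).map (U (𝖯 ⊗ Z))
    rw [Category.assoc, reassoc_of% κ_nat]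
    simp only [Category.assoc, ← Functor.map_comp]
    rw [P_U_T_T]
  | @sh m f _ ih =>
    change 𝖯 ◁ f.app (𝖰 ⊗ Z) ≫ κ m (𝖰 ⊗ Z) ≫ (F m).map (T Z) =
      (κ m (𝖰 ⊗ Z) ≫ (F m).map (T Z)) ≫ f.app (𝖰 ⊗ 𝖯 ⊗ Z)
    rw [reassoc_of% ih (𝖰 ⊗ Z), Category.assoc, f.naturality]

theorem UGen.exists_ι {m : ℕ} {f : End (F m)} (h : UGen m f) :
    ∃ g, UGen (m + 1) g ∧ ∀ Z, 𝖰 ◁ f.app Z ≫ (ι m Z).hom = (ι m Z).hom ≫ g.app Z := by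
  induction h with
  | s m =>
    refine ⟨towerQ.s (m + 1), UGen.s (m + 1), fun Z => ?_⟩
    exact ι_nat m (U Z)
  | sh _ ih =>
    obtain ⟨g, hg, h⟩ := ih
    exact ⟨_, hg.sh, fun Z => h (𝖰 ⊗ Z)⟩

/-- The algebra generated by the crossings of downward strands. -/
def algU (m : ℕ) : Subalgebra ℂ (End (F m)) := Algebra.adjoin ℂ {f | UGen m f}

theorem sh_mem_algU {m : ℕ} {f : End (F m)} (hf : f ∈ algU m) : towerQ.sh m f ∈ algU (m + 1) := by
  have h : algU m ≤ (algU (m + 1)).comap (towerQ.sh m) :=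
    Algebra.adjoin_le fun g hg => Algebra.subset_adjoin (UGen.sh hg)
  exact h hf

theorem s_mem_algU (m : ℕ) : towerQ.s m ∈ algU (m + 2) := Algebra.subset_adjoin (UGen.s m)

/-- The natural families of endomorphisms that are made of crossings of downward strands and of the
composition of the innermost cap and cup. -/
inductive Fam : ∀ m, (∀ Z, (F m).obj (𝖯 ⊗ Z) ⟶ (F m).obj (𝖯 ⊗ Z)) → Prop
  | id (m : ℕ) : Fam m (fun _ => 𝟙 _)
  | u {m : ℕ} {f : End (F m)} (hf : UGen m f) : Fam m (fun Z => f.app (𝖯 ⊗ Z))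
  | e (m : ℕ) : Fam (m + 1) (fun Z => (F m).map (ε Z ≫ η Z))
  | comp {m : ℕ} {f g : ∀ Z, (F m).obj (𝖯 ⊗ Z) ⟶ (F m).obj (𝖯 ⊗ Z)} (hf : Fam m f) (hg : Fam m g) :
      Fam m (fun Z => f Z ≫ g Z)
  | sub {m : ℕ} {f g : ∀ Z, (F m).obj (𝖯 ⊗ Z) ⟶ (F m).obj (𝖯 ⊗ Z)} (hf : Fam m f) (hg : Fam m g) :
      Fam m (fun Z => f Z - g Z)

theorem Fam.congr {m : ℕ} {f g : ∀ Z, (F m).obj (𝖯 ⊗ Z) ⟶ (F m).obj (𝖯 ⊗ Z)} (hf : Fam m f)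
    (h : ∀ Z, g Z = f Z) : Fam m g := by
  obtain rfl : g = f := funext h
  exact hf

section

variable (G : Obj ⥤ Obj) (Z : Obj)

theorem map_T'_T [G.Additive] : G.map (T' Z ≫ T Z) = 𝟙 (G.obj (𝖰 ⊗ 𝖯 ⊗ Z)) - G.map (ε Z ≫ η Z) := by
  rw [T'_T, Functor.map_sub, CategoryTheory.Functor.map_id]

theorem push_id : G.map (T' Z) ≫ 𝟙 (G.obj (𝖯 ⊗ 𝖰 ⊗ Z)) ≫ G.map (T Z) = G.map (T' Z ≫ T Z) := by
  rw [Category.id_comp, Functor.map_comp]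

theorem push_comp (f g : G.obj (𝖯 ⊗ 𝖰 ⊗ Z) ⟶ G.obj (𝖯 ⊗ 𝖰 ⊗ Z)) :
    G.map (T' Z) ≫ (f ≫ g) ≫ G.map (T Z) =
      (G.map (T' Z) ≫ f ≫ G.map (T Z)) ≫ G.map (T' Z) ≫ g ≫ G.map (T Z) := by
  simp only [Category.assoc]
  rw [← Functor.map_comp_assoc _ (T Z), T_T', CategoryTheory.Functor.map_id, Category.id_comp]

theorem push_sub (f g : G.obj (𝖯 ⊗ 𝖰 ⊗ Z) ⟶ G.obj (𝖯 ⊗ 𝖰 ⊗ Z)) :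
    G.map (T' Z) ≫ (f - g) ≫ G.map (T Z) =
      G.map (T' Z) ≫ f ≫ G.map (T Z) - G.map (T' Z) ≫ g ≫ G.map (T Z) := by
  rw [Preadditive.sub_comp, Preadditive.comp_sub]

theorem push_e : G.map (𝖰 ◁ T' Z) ≫ G.map (ε (𝖰 ⊗ Z) ≫ η (𝖰 ⊗ Z)) ≫ G.map (𝖰 ◁ T Z) =
    (G.map (U (𝖯 ⊗ Z)) ≫ G.map (𝖰 ◁ (ε Z ≫ η Z))) ≫ G.map (U (𝖯 ⊗ Z)) := by
  simp only [← Functor.map_comp]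
  rw [Category.assoc, reassoc_of% T'_ε, ← η_U, whiskerLeft_comp]
  simp only [Category.assoc]

end

/-- Conjugation by `T` respects composition because `T ≫ T' = 𝟙`. It turns the cap and cup on the
old innermost strand into those on the new one conjugated by `U` (`push_e`). -/
theorem Fam.push {m : ℕ} {f : ∀ Z, (F m).obj (𝖯 ⊗ Z) ⟶ (F m).obj (𝖯 ⊗ Z)} (hf : Fam m f) :
    Fam (m + 1) (fun Z => (F m).map (T' Z) ≫ f (𝖰 ⊗ Z) ≫ (F m).map (T Z)) := by
  have h1 (m : ℕ) : Fam (m + 1) (fun Z => (F m).map (T' Z ≫ T Z)) :=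
    ((Fam.id (m + 1)).sub (Fam.e m)).congr fun Z => map_T'_T (F m) Z
  induction hf with
  | id m => exact (h1 m).congr fun Z => push_id (F m) Z
  | @u m f hf =>
    refine ((h1 m).comp (Fam.u hf.sh)).congr fun Z => ?_
    have h2 := f.naturality (T Z)
    rw [Functor.map_comp]
    exact (congrArg (_ ≫ ·) h2.symm).trans (Category.assoc _ _ _).symm
  | e m =>
    exact (((Fam.u (UGen.s m)).comp (Fam.e (m + 1))).comp (Fam.u (UGen.s m))).congr
      fun Z => push_e (F m) Z
  | comp _ _ h2 h3 => exact (h2.comp h3).congr fun Z => push_comp (F _) Z _ _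
  | sub _ _ h2 h3 => exact (h2.sub h3).congr fun Z => push_sub (F _) Z _ _

theorem fam_κr_κ (m : ℕ) : Fam m (fun Z => κr m Z ≫ κ m Z) := by
  induction m with
  | zero => exact (Fam.id 0).congr fun Z => Category.id_comp _
  | succ m ih =>
    refine ih.push.congr fun Z => ?_
    have h {A B C D E : Obj} (f : A ⟶ B) (g : B ⟶ C) (h : C ⟶ D) (k : D ⟶ E) :
        (f ≫ g) ≫ h ≫ k = f ≫ (g ≫ h) ≫ k := by simp only [Category.assoc]
    exact h _ _ _ _

/-! ### Generation of morphisms between standard words. -/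

/-- The words with strands in standard position. -/
abbrev OO (a : ℕ × ℕ) : Obj := O a.1 a.2

/-- The morphisms between the words with strands in standard position that are generated by
morphisms of upward strands, crossings of downward strands and the innermost caps and cups. -/
inductive Word : ∀ a b : ℕ × ℕ, (OO a ⟶ OO b) → Prop
  | map (m n : ℕ) {d : Ps n ⟶ Ps n} (hd : (d : End (Ps n)) ∈ algP n) :
      Word (m, n) (m, n) ((F m).map d)
  | u {m : ℕ} (n : ℕ) {f : End (F m)} (hf : UGen m f) : Word (m, n) (m, n) (f.app (Ps n))
  | cap (m n : ℕ) : Word (m + 1, n + 1) (m, n) (cap m n)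
  | cup (m n : ℕ) : Word (m, n) (m + 1, n + 1) (cup m n)
  | comp {a b c : ℕ × ℕ} {f : OO a ⟶ OO b} {g : OO b ⟶ OO c} (hf : Word a b f) (hg : Word b c g) :
      Word a c (f ≫ g)
  | add {a b : ℕ × ℕ} {f g : OO a ⟶ OO b} (hf : Word a b f) (hg : Word a b g) : Word a b (f + g)
  | smul {a b : ℕ × ℕ} (r : ℂ) {f : OO a ⟶ OO b} (hf : Word a b f) : Word a b (r • f)
  | zero (a b : ℕ × ℕ) : Word a b 0

theorem Word.normal {a b : ℕ × ℕ} {f : OO a ⟶ OO b} (hf : Word a b f) :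
    Normal a.1 a.2 b.1 b.2 f := by
  induction hf with
  | map m n hd => exact normal_pure (map_mem hd)
  | u n hf => exact normal_pure (app_mem hf.mem_algQ)
  | cap m n => exact normal_cap m n
  | cup m n => exact normal_cup m n
  | comp _ _ h1 h2 => exact h1.comp h2
  | add _ _ h1 h2 => exact h1.add h2
  | @smul a b r f _ h =>
    have h1 := h.comp_pure (Submodule.smul_mem _ r (id_mem b.1 b.2))
    rwa [Linear.comp_smul, Category.comp_id] at h1
  | zero a b => exact Normal.zero _ _ _ _

theorem Word.id (a : ℕ × ℕ) : Word a a (𝟙 _) := by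
  have h := Word.map a.1 a.2 (one_mem (algP a.2))
  exact (congrArg (Word a a) ((F a.1).map_id (Ps a.2))).mp h

theorem Word.sub {a b : ℕ × ℕ} {f g : OO a ⟶ OO b} (hf : Word a b f) (hg : Word a b g) :
    Word a b (f - g) := by
  rw [sub_eq_add_neg, ← neg_one_smul ℂ g]
  exact hf.add (hg.smul _)

theorem Word.algU {m : ℕ} (n : ℕ) {f : End (F m)} (hf : f ∈ algU m) :
    Word (m, n) (m, n) (f.app (Ps n)) := by
  induction hf using Algebra.adjoin_induction with
  | mem f hf => exact Word.u n hf
  | algebraMap r => exact (Word.id (m, n)).smul r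
  | add _ _ _ _ h1 h2 => exact h1.add h2
  | mul _ _ _ _ h1 h2 => exact h2.comp h1

theorem Word.fam {m : ℕ} (n : ℕ) {f : ∀ Z, (F m).obj (𝖯 ⊗ Z) ⟶ (F m).obj (𝖯 ⊗ Z)} (hf : Fam m f) :
    Word (m, n + 1) (m, n + 1) (f (Ps n)) := by
  induction hf with
  | id m => exact Word.id (m, n + 1)
  | u hf => exact Word.u (n + 1) hf
  | e m =>
    have h := (Word.cap m n).comp (Word.cup m n)
    exact (congrArg (Word (m + 1, n + 1) (m + 1, n + 1)) ((F m).map_comp _ _)).mpr h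
  | comp _ _ h1 h2 => exact h1.comp h2
  | sub _ _ h1 h2 => exact h1.sub h2

theorem Word.κr_κ (m n : ℕ) : Word (m, n + 1) (m, n + 1) (κr m (Ps n) ≫ κ m (Ps n)) :=
  Word.fam n (fam_κr_κ m)

theorem Word.S (m n : ℕ) : Word (m, n + 2) (m, n + 2) ((F m).map (S (Ps n))) :=
  Word.map m (n + 2) (HeckeTower.s_mem (H := towerP) n)

theorem κr_cap_κ (m : ℕ) (Z : Obj) :
    ((F m).map (T' (𝖯 ⊗ Z)) ≫ κr m (𝖰 ⊗ 𝖯 ⊗ Z)) ≫ 𝖯 ◁ (F m).map (ε Z) ≫ κ m Z =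
      ((F m).map (𝖰 ◁ Heis.S Z) ≫ (F m).map (ε (𝖯 ⊗ Z))) ≫ κr m Z ≫ κ m Z := by
  rw [← Functor.map_comp, S_ε, Functor.map_comp, Category.assoc, Category.assoc,
    reassoc_of% κr_nat]

section

variable {V A B A' B' : Obj} (k : A' ⟶ V ⊗ A) (f g : A ⟶ B) (l : V ⊗ B ⟶ B')

theorem conj_add : k ≫ V ◁ (f + g) ≫ l = k ≫ V ◁ f ≫ l + k ≫ V ◁ g ≫ l := by
  rw [MonoidalPreadditive.whiskerLeft_add, Preadditive.add_comp, Preadditive.comp_add]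

theorem conj_smul (r : ℂ) : k ≫ V ◁ (r • f) ≫ l = r • (k ≫ V ◁ f ≫ l) := by
  rw [MonoidalLinear.whiskerLeft_smul, Linear.smul_comp, Linear.comp_smul]

theorem conj_zero : k ≫ V ◁ (0 : A ⟶ B) ≫ l = 0 := by
  rw [MonoidalPreadditive.whiskerLeft_zero, Limits.zero_comp, Limits.comp_zero]

end

/-- Conjugation respects composition because `κ ≫ κr = 𝟙`. A generator conjugates to its analogue on
one more upward strand, times the word `κr ≫ κ`; the innermost cap and cup also acquire a crossing
with the new strand. -/
theorem Word.conjP {a b : ℕ × ℕ} {f : OO a ⟶ OO b} (hf : Word a b f) :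
    Word (a.1, a.2 + 1) (b.1, b.2 + 1) (κr a.1 (Ps a.2) ≫ 𝖯 ◁ f ≫ κ b.1 (Ps b.2)) := by
  induction hf with
  | @map m n d hd =>
    refine (congrArg (Word (m, n + 1) (m, n + 1)) ?_).mpr
      ((Word.κr_κ m n).comp (Word.map m (n + 1) (whiskerLeft_mem_algP hd)))
    exact (congrArg (_ ≫ ·) (κ_nat m d)).trans (Category.assoc _ _ _).symm
  | @u m n f hf =>
    refine (congrArg (Word (m, n + 1) (m, n + 1)) ?_).mpr
      ((Word.κr_κ m n).comp (Word.u (n + 1) hf))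
    exact (congrArg (_ ≫ ·) (hf.κ_comm (Ps n))).trans (Category.assoc _ _ _).symm
  | cap m n =>
    refine (congrArg (Word (m + 1, n + 2) (m, n + 1)) ?_).mpr
      (((Word.S (m + 1) n).comp (Word.cap m (n + 1))).comp (Word.κr_κ m n))
    exact κr_cap_κ m (Ps n)
  | cup m n =>
    refine (congrArg (Word (m, n + 1) (m + 1, n + 2)) ?_).mpr
      ((Word.κr_κ m n).comp ((Word.cup m (n + 1)).comp (Word.S (m + 1) n)))
    change κr m (Ps n) ≫ 𝖯 ◁ (F m).map (η (Ps n)) ≫ κ m (𝖰 ⊗ 𝖯 ⊗ Ps n) ≫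
      (F m).map (T (𝖯 ⊗ Ps n)) = (κr m (Ps n) ≫ κ m (Ps n)) ≫ (F m).map (η (𝖯 ⊗ Ps n)) ≫
      (F m).map (𝖰 ◁ Heis.S (Ps n))
    rw [← Functor.map_comp, ← η_T, Functor.map_comp, Category.assoc, reassoc_of% κ_nat]
  | @comp a b c f g _ _ h1 h2 =>
    have h := h1.comp h2
    have h3 : (κr a.1 (Ps a.2) ≫ 𝖯 ◁ f ≫ κ b.1 (Ps b.2)) ≫
        κr b.1 (Ps b.2) ≫ 𝖯 ◁ g ≫ κ c.1 (Ps c.2) =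
        κr a.1 (Ps a.2) ≫ 𝖯 ◁ (f ≫ g) ≫ κ c.1 (Ps c.2) := by
      simp only [Category.assoc, whiskerLeft_comp]
      rw [reassoc_of% κ_κr]
    exact (congrArg (Word _ _) h3).mp h
  | add _ _ h1 h2 => exact (congrArg (Word _ _) (conj_add _ _ _ _)).mpr (h1.add h2)
  | smul r _ h => exact (congrArg (Word _ _) (conj_smul _ _ _ r)).mpr (h.smul r)
  | zero a b => exact (congrArg (Word _ _) (conj_zero _ _)).mpr (Word.zero _ _)

theorem Word.conjQ {a b : ℕ × ℕ} {f : OO a ⟶ OO b} (hf : Word a b f) :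
    Word (a.1 + 1, a.2) (b.1 + 1, b.2) ((ι a.1 (Ps a.2)).inv ≫ 𝖰 ◁ f ≫ (ι b.1 (Ps b.2)).hom) := by
  induction hf with
  | @map m n d hd =>
    refine (congrArg (Word (m + 1, n) (m + 1, n)) ?_).mpr (Word.map (m + 1) n hd)
    exact (Iso.inv_comp_eq _).2 (ι_nat m d)
  | @u m n f hf =>
    obtain ⟨g, hg, h⟩ := hf.exists_ι
    refine (congrArg (Word (m + 1, n) (m + 1, n)) ?_).mpr (Word.u n hg)
    exact (Iso.inv_comp_eq _).2 (h (Ps n))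
  | cap m n =>
    refine (congrArg (Word (m + 2, n + 1) (m + 1, n)) ?_).mpr (Word.cap (m + 1) n)
    exact (Iso.inv_comp_eq _).2 (ι_nat m (ε (Ps n)))
  | cup m n =>
    refine (congrArg (Word (m + 1, n) (m + 2, n + 1)) ?_).mpr (Word.cup (m + 1) n)
    exact (Iso.inv_comp_eq _).2 (ι_nat m (η (Ps n)))
  | @comp a b c f g _ _ h1 h2 =>
    have h3 : ((ι a.1 (Ps a.2)).inv ≫ 𝖰 ◁ f ≫ (ι b.1 (Ps b.2)).hom) ≫
        (ι b.1 (Ps b.2)).inv ≫ 𝖰 ◁ g ≫ (ι c.1 (Ps c.2)).hom =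
        (ι a.1 (Ps a.2)).inv ≫ 𝖰 ◁ (f ≫ g) ≫ (ι c.1 (Ps c.2)).hom := by
      simp
    exact (congrArg (Word _ _) h3).mp (h1.comp h2)
  | add _ _ h1 h2 => exact (congrArg (Word _ _) (conj_add _ _ _ _)).mpr (h1.add h2)
  | smul r _ h => exact (congrArg (Word _ _) (conj_smul _ _ _ r)).mpr (h.smul r)
  | zero a b => exact (congrArg (Word _ _) (conj_zero _ _)).mpr (Word.zero _ _)

end Heis

namespace Heis

open HomSpace

local notation "𝖯" => Obj.P
local notation "𝖰" => Obj.Q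

/-! ### Caps and cups in standard position -/

section

variable (G : Obj ⥤ Obj) {ψ χ : ∀ W, G.obj (𝖰 ⊗ W) ⟶ G.obj (𝖰 ⊗ W)} (Z : Obj)

/-- Moving the cup inward past one more downward strand produces one crossing `U`; the crossings
already collected commute past by naturality. -/
theorem cup_step (hψ : ∀ {V W : Obj} (f : V ⟶ W), G.map (𝖰 ◁ f) ≫ ψ W = ψ V ≫ G.map (𝖰 ◁ f)) :
    (G.map (η (𝖰 ⊗ Z)) ≫ ψ (𝖯 ⊗ 𝖰 ⊗ Z)) ≫ G.map (𝖰 ◁ T Z) =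
      G.map (𝖰 ◁ η Z) ≫ G.map (U (𝖯 ⊗ Z)) ≫ ψ (𝖰 ⊗ 𝖯 ⊗ Z) := by
  rw [Category.assoc, ← hψ, ← Functor.map_comp_assoc, ← Functor.map_comp_assoc, η_U]

theorem cap_step (hψ : ∀ {V W : Obj} (f : V ⟶ W), G.map (𝖰 ◁ f) ≫ ψ W = ψ V ≫ G.map (𝖰 ◁ f)) :
    G.map (𝖰 ◁ T' Z) ≫ ψ (𝖯 ⊗ 𝖰 ⊗ Z) ≫ G.map (ε (𝖰 ⊗ Z)) =
      (ψ (𝖰 ⊗ 𝖯 ⊗ Z) ≫ G.map (U (𝖯 ⊗ Z))) ≫ G.map (𝖰 ◁ ε Z) := by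
  rw [reassoc_of% hψ, ← Functor.map_comp, T'_ε, Functor.map_comp, Category.assoc]

/-- Now the dot must also pass the new crossing. The turnback left by `T_X` is straightened by a
zigzag to the old crossings without a dot, hence the correction `-ψ`. -/
theorem cup'_step [G.Additive]
    (hψ : ∀ {V W : Obj} (f : V ⟶ W), G.map (𝖰 ◁ f) ≫ ψ W = ψ V ≫ G.map (𝖰 ◁ f))
    (hχ : ∀ {V W : Obj} (f : V ⟶ W), G.map (𝖰 ◁ f) ≫ χ W = χ V ≫ G.map (𝖰 ◁ f)) :
    (G.map (η (𝖰 ⊗ Z)) ≫ ψ (𝖯 ⊗ 𝖰 ⊗ Z) ≫ G.map (𝖰 ◁ X (𝖰 ⊗ Z)) +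
      G.map (η (𝖰 ⊗ Z)) ≫ χ (𝖯 ⊗ 𝖰 ⊗ Z)) ≫ G.map (𝖰 ◁ T Z) =
    G.map (𝖰 ◁ η Z) ≫ (G.map (U (𝖯 ⊗ Z)) ≫ ψ (𝖰 ⊗ 𝖯 ⊗ Z)) ≫ G.map (𝖰 ◁ 𝖰 ◁ X Z) +
      G.map (𝖰 ◁ η Z) ≫ (G.map (U (𝖯 ⊗ Z)) ≫ χ (𝖰 ⊗ 𝖯 ⊗ Z) - ψ (𝖰 ⊗ 𝖯 ⊗ Z)) := by
  have h1 : G.map (𝖰 ◁ X (𝖰 ⊗ Z)) ≫ G.map (𝖰 ◁ T Z) =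
      G.map (𝖰 ◁ T Z) ≫ G.map (𝖰 ◁ 𝖰 ◁ X Z) - G.map (𝖰 ◁ ε' Z) ≫ G.map (𝖰 ◁ η Z) := by
    simp only [← Functor.map_comp, ← whiskerLeft_comp, ← Functor.map_sub, ← whiskerLeft_sub', T_X,
      add_sub_cancel_right]
  have h2 : G.map (η (𝖰 ⊗ Z)) ≫ ψ (𝖯 ⊗ 𝖰 ⊗ Z) ≫ G.map (𝖰 ◁ ε' Z) ≫ G.map (𝖰 ◁ η Z) =
      G.map (𝖰 ◁ η Z) ≫ ψ (𝖰 ⊗ 𝖯 ⊗ Z) := by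
    rw [← reassoc_of% hψ, ← Functor.map_comp_assoc, zigQ', CategoryTheory.Functor.map_id,
      Category.id_comp, hψ]
  have h3 := cup_step G Z hψ
  rw [Category.assoc] at h3
  rw [Preadditive.add_comp, cup_step G Z hχ, Category.assoc, Category.assoc, h1,
    Preadditive.comp_sub, Preadditive.comp_sub, h2, reassoc_of% h3, Preadditive.comp_sub]
  simp only [Category.assoc]
  abel

theorem cap'_step [G.Additive]
    (hψ : ∀ {V W : Obj} (f : V ⟶ W), G.map (𝖰 ◁ f) ≫ ψ W = ψ V ≫ G.map (𝖰 ◁ f))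
    (hχ : ∀ {V W : Obj} (f : V ⟶ W), G.map (𝖰 ◁ f) ≫ χ W = χ V ≫ G.map (𝖰 ◁ f)) :
    G.map (𝖰 ◁ T' Z) ≫ (G.map (𝖰 ◁ X (𝖰 ⊗ Z)) ≫ ψ (𝖯 ⊗ 𝖰 ⊗ Z) ≫ G.map (ε (𝖰 ⊗ Z)) +
      χ (𝖯 ⊗ 𝖰 ⊗ Z) ≫ G.map (ε (𝖰 ⊗ Z))) =
    G.map (𝖰 ◁ 𝖰 ◁ X Z) ≫ (ψ (𝖰 ⊗ 𝖯 ⊗ Z) ≫ G.map (U (𝖯 ⊗ Z))) ≫ G.map (𝖰 ◁ ε Z) +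
      (χ (𝖰 ⊗ 𝖯 ⊗ Z) ≫ G.map (U (𝖯 ⊗ Z)) - ψ (𝖰 ⊗ 𝖯 ⊗ Z)) ≫ G.map (𝖰 ◁ ε Z) := by
  have h1 : G.map (𝖰 ◁ T' Z) ≫ G.map (𝖰 ◁ X (𝖰 ⊗ Z)) =
      G.map (𝖰 ◁ 𝖰 ◁ X Z) ≫ G.map (𝖰 ◁ T' Z) - G.map (𝖰 ◁ ε Z) ≫ G.map (𝖰 ◁ η' Z) := by
    simp only [← Functor.map_comp, ← whiskerLeft_comp, ← Functor.map_sub, ← whiskerLeft_sub', X_T',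
      add_sub_cancel_right]
  have h2 : G.map (𝖰 ◁ ε Z) ≫ G.map (𝖰 ◁ η' Z) ≫ ψ (𝖯 ⊗ 𝖰 ⊗ Z) ≫ G.map (ε (𝖰 ⊗ Z)) =
      ψ (𝖰 ⊗ 𝖯 ⊗ Z) ≫ G.map (𝖰 ◁ ε Z) := by
    rw [reassoc_of% hψ, ← Functor.map_comp, zigQ, CategoryTheory.Functor.map_id,
      Category.comp_id, hψ]
  rw [Preadditive.comp_add, cap_step G Z hχ, reassoc_of% h1, Preadditive.sub_comp, Category.assoc,
    Category.assoc, h2, cap_step G Z hψ, Preadditive.sub_comp]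
  abel

end

/-- The component at `W` of an endomorphism of `F (m + 1)`. -/
def appQ {m : ℕ} (ψ : End (F (m + 1))) (W : Obj) : (F m).obj (𝖰 ⊗ W) ⟶ (F m).obj (𝖰 ⊗ W) :=
  ψ.app W

theorem appQ_nat {m : ℕ} (ψ : End (F (m + 1))) {V W : Obj} (f : V ⟶ W) :
    (F m).map (𝖰 ◁ f) ≫ appQ ψ W = appQ ψ V ≫ (F m).map (𝖰 ◁ f) := ψ.naturality f

theorem exists_cup (m : ℕ) : ∃ ψ ∈ algU (m + 1), ∀ Z,
    η ((F m).obj Z) ≫ 𝖰 ◁ κ m Z ≫ (ι m (𝖯 ⊗ Z)).hom =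
      (F m).map (η Z) ≫ appQ ψ (𝖯 ⊗ Z) := by
  induction m with
  | zero =>
    refine ⟨1, one_mem _, fun Z => ?_⟩
    change η Z ≫ 𝖰 ◁ 𝟙 (𝖯 ⊗ Z) ≫ 𝟙 (𝖰 ⊗ 𝖯 ⊗ Z) = η Z ≫ 𝟙 (𝖰 ⊗ 𝖯 ⊗ Z)
    simp
  | succ m ih =>
    obtain ⟨ψ, hψ, h⟩ := ih
    refine ⟨towerQ.sh _ ψ * towerQ.s m, mul_mem (sh_mem_algU hψ) (s_mem_algU m), fun Z => ?_⟩
    refine Eq.trans ?_ (cup_step (F m) (ψ := appQ ψ) Z (appQ_nat ψ))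
    refine Eq.trans ?_ (congrArg (· ≫ (F m).map (𝖰 ◁ T Z)) (h (𝖰 ⊗ Z)))
    have e : η ((F m).obj (𝖰 ⊗ Z)) ≫ 𝖰 ◁ (κ m (𝖰 ⊗ Z) ≫ (F m).map (T Z)) ≫
        (ι m (𝖰 ⊗ 𝖯 ⊗ Z)).hom = (η ((F m).obj (𝖰 ⊗ Z)) ≫ 𝖰 ◁ κ m (𝖰 ⊗ Z) ≫
          (ι m (𝖯 ⊗ 𝖰 ⊗ Z)).hom) ≫ (F m).map (𝖰 ◁ T Z) := by
      rw [whiskerLeft_comp, Category.assoc, ι_nat]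
      simp only [Category.assoc]
    exact e

theorem exists_cap (m : ℕ) : ∃ ψ ∈ algU (m + 1), ∀ Z,
    (ι m (𝖯 ⊗ Z)).inv ≫ 𝖰 ◁ κr m Z ≫ ε ((F m).obj Z) =
      appQ ψ (𝖯 ⊗ Z) ≫ (F m).map (ε Z) := by
  induction m with
  | zero =>
    refine ⟨1, one_mem _, fun Z => ?_⟩
    change 𝟙 (𝖰 ⊗ 𝖯 ⊗ Z) ≫ 𝖰 ◁ 𝟙 (𝖯 ⊗ Z) ≫ ε Z = 𝟙 (𝖰 ⊗ 𝖯 ⊗ Z) ≫ ε Z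
    simp
  | succ m ih =>
    obtain ⟨ψ, hψ, h⟩ := ih
    refine ⟨towerQ.s m * towerQ.sh _ ψ, mul_mem (s_mem_algU m) (sh_mem_algU hψ), fun Z => ?_⟩
    refine Eq.trans ?_ (cap_step (F m) (ψ := appQ ψ) Z (appQ_nat ψ))
    refine Eq.trans ?_ (congrArg ((F m).map (𝖰 ◁ T' Z) ≫ ·) (h (𝖰 ⊗ Z)))
    have e : (ι m (𝖰 ⊗ 𝖯 ⊗ Z)).inv ≫ 𝖰 ◁ ((F m).map (T' Z) ≫ κr m (𝖰 ⊗ Z)) ≫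
        ε ((F m).obj (𝖰 ⊗ Z)) = (F m).map (𝖰 ◁ T' Z) ≫ (ι m (𝖯 ⊗ 𝖰 ⊗ Z)).inv ≫
          𝖰 ◁ κr m (𝖰 ⊗ Z) ≫ ε ((F m).obj (𝖰 ⊗ Z)) := by
      rw [whiskerLeft_comp, Category.assoc, ← reassoc_of% ι_inv_nat]
    exact e

theorem exists_cup' (m : ℕ) : ∃ ψ ∈ algU (m + 1), ∃ χ ∈ algU (m + 1), ∀ Z,
    η' ((F m).obj Z) ≫ 𝖯 ◁ (ι m Z).hom ≫ κ m (𝖰 ⊗ Z) ≫ (F m).map (T Z) =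
      (F m).map (η Z) ≫ appQ ψ (𝖯 ⊗ Z) ≫
        (F m).map (𝖰 ◁ X Z) +
      (F m).map (η Z) ≫ appQ χ (𝖯 ⊗ Z) := by
  induction m with
  | zero =>
    refine ⟨1, one_mem _, 0, zero_mem _, fun Z => ?_⟩
    change η' Z ≫ 𝖯 ◁ 𝟙 (𝖰 ⊗ Z) ≫ 𝟙 (𝖯 ⊗ 𝖰 ⊗ Z) ≫ T Z =
      η Z ≫ 𝟙 (𝖰 ⊗ 𝖯 ⊗ Z) ≫ 𝖰 ◁ X Z + η Z ≫ (0 : 𝖰 ⊗ 𝖯 ⊗ Z ⟶ 𝖰 ⊗ 𝖯 ⊗ Z)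
    simp [η'_T]
  | succ m ih =>
    obtain ⟨ψ, hψ, χ, hχ, h⟩ := ih
    refine ⟨towerQ.sh _ ψ * towerQ.s m, mul_mem (sh_mem_algU hψ) (s_mem_algU m),
      towerQ.sh _ χ * towerQ.s m - towerQ.sh _ ψ,
      sub_mem (mul_mem (sh_mem_algU hχ) (s_mem_algU m)) (sh_mem_algU hψ), fun Z => ?_⟩
    refine Eq.trans ?_ (cup'_step (F m) (ψ := appQ ψ) (χ := appQ χ) Z
      (appQ_nat ψ) (appQ_nat χ))
    refine Eq.trans ?_ (congrArg (· ≫ (F m).map (𝖰 ◁ T Z)) (h (𝖰 ⊗ Z)))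
    have e : η' ((F m).obj (𝖰 ⊗ Z)) ≫ 𝖯 ◁ (ι m (𝖰 ⊗ Z)).hom ≫ (κ m (𝖰 ⊗ 𝖰 ⊗ Z) ≫
        (F m).map (T (𝖰 ⊗ Z))) ≫ (F m).map (𝖰 ◁ T Z) = (η' ((F m).obj (𝖰 ⊗ Z)) ≫
          𝖯 ◁ (ι m (𝖰 ⊗ Z)).hom ≫ κ m (𝖰 ⊗ 𝖰 ⊗ Z) ≫ (F m).map (T (𝖰 ⊗ Z))) ≫
            (F m).map (𝖰 ◁ T Z) := by
      simp only [Category.assoc]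
    exact e

theorem exists_cap' (m : ℕ) : ∃ ψ ∈ algU (m + 1), ∃ χ ∈ algU (m + 1), ∀ Z,
    ((F m).map (T' Z) ≫ κr m (𝖰 ⊗ Z)) ≫ 𝖯 ◁ (ι m Z).inv ≫ ε' ((F m).obj Z) =
      (F m).map (𝖰 ◁ X Z) ≫ appQ ψ (𝖯 ⊗ Z) ≫
        (F m).map (ε Z) +
      appQ χ (𝖯 ⊗ Z) ≫ (F m).map (ε Z) := by
  induction m with
  | zero =>
    refine ⟨1, one_mem _, 0, zero_mem _, fun Z => ?_⟩
    change (T' Z ≫ 𝟙 (𝖯 ⊗ 𝖰 ⊗ Z)) ≫ 𝖯 ◁ 𝟙 (𝖰 ⊗ Z) ≫ ε' Z =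
      𝖰 ◁ X Z ≫ 𝟙 (𝖰 ⊗ 𝖯 ⊗ Z) ≫ ε Z + (0 : 𝖰 ⊗ 𝖯 ⊗ Z ⟶ 𝖰 ⊗ 𝖯 ⊗ Z) ≫ ε Z
    simp [T'_ε']
  | succ m ih =>
    obtain ⟨ψ, hψ, χ, hχ, h⟩ := ih
    refine ⟨towerQ.s m * towerQ.sh _ ψ, mul_mem (s_mem_algU m) (sh_mem_algU hψ),
      towerQ.s m * towerQ.sh _ χ - towerQ.sh _ ψ,
      sub_mem (mul_mem (s_mem_algU m) (sh_mem_algU hχ)) (sh_mem_algU hψ), fun Z => ?_⟩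
    refine Eq.trans ?_ (cap'_step (F m) (ψ := appQ ψ) (χ := appQ χ) Z
      (appQ_nat ψ) (appQ_nat χ))
    refine Eq.trans ?_ (congrArg ((F m).map (𝖰 ◁ T' Z) ≫ ·) (h (𝖰 ⊗ Z)))
    have e : ((F m).map (𝖰 ◁ T' Z) ≫ (F m).map (T' (𝖰 ⊗ Z)) ≫ κr m (𝖰 ⊗ 𝖰 ⊗ Z)) ≫
        𝖯 ◁ (ι m (𝖰 ⊗ Z)).inv ≫ ε' ((F m).obj (𝖰 ⊗ Z)) = (F m).map (𝖰 ◁ T' Z) ≫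
          ((F m).map (T' (𝖰 ⊗ Z)) ≫ κr m (𝖰 ⊗ 𝖰 ⊗ Z)) ≫ 𝖯 ◁ (ι m (𝖰 ⊗ Z)).inv ≫
            ε' ((F m).obj (𝖰 ⊗ Z)) := by
      simp only [Category.assoc]
    exact e

theorem Word.cupQP (m n : ℕ) : Word (m, n) (m + 1, n + 1)
    (η ((F m).obj (Ps n)) ≫ 𝖰 ◁ κ m (Ps n) ≫ (ι m (𝖯 ⊗ Ps n)).hom) := by
  obtain ⟨ψ, hψ, h⟩ := exists_cup m
  exact (congrArg (Word (m, n) (m + 1, n + 1)) (h (Ps n))).mpr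
    ((Word.cup m n).comp (Word.algU (n + 1) hψ))

theorem Word.capQP (m n : ℕ) : Word (m + 1, n + 1) (m, n)
    ((ι m (𝖯 ⊗ Ps n)).inv ≫ 𝖰 ◁ κr m (Ps n) ≫ ε ((F m).obj (Ps n))) := by
  obtain ⟨ψ, hψ, h⟩ := exists_cap m
  exact (congrArg (Word (m + 1, n + 1) (m, n)) (h (Ps n))).mpr
    ((Word.algU (n + 1) hψ).comp (Word.cap m n))

theorem Word.X (m n : ℕ) : Word (m, n + 1) (m, n + 1) ((F m).map (X (Ps n))) :=
  Word.map m (n + 1) (HeckeTower.x_mem (H := towerP) n)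

theorem Word.cupPQ (m n : ℕ) : Word (m, n) (m + 1, n + 1)
    (η' ((F m).obj (Ps n)) ≫ 𝖯 ◁ (ι m (Ps n)).hom ≫ κ m (𝖰 ⊗ Ps n) ≫ (F m).map (T (Ps n))) := by
  obtain ⟨ψ, hψ, χ, hχ, h⟩ := exists_cup' m
  exact (congrArg (Word (m, n) (m + 1, n + 1)) (h (Ps n))).mpr
    (((Word.cup m n).comp ((Word.algU (n + 1) hψ).comp (Word.X (m + 1) n))).add
      ((Word.cup m n).comp (Word.algU (n + 1) hχ)))

theorem Word.capPQ (m n : ℕ) : Word (m + 1, n + 1) (m, n)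
    (((F m).map (T' (Ps n)) ≫ κr m (𝖰 ⊗ Ps n)) ≫ 𝖯 ◁ (ι m (Ps n)).inv ≫ ε' ((F m).obj (Ps n))) := by
  obtain ⟨ψ, hψ, χ, hχ, h⟩ := exists_cap' m
  exact (congrArg (Word (m + 1, n + 1) (m, n)) (h (Ps n))).mpr
    (((Word.X (m + 1) n).comp ((Word.algU (n + 1) hψ).comp (Word.cap m n))).add
      ((Word.algU (n + 1) hχ).comp (Word.cap m n)))

end Heis

namespace Heis

open HomSpace

local notation "𝖯" => Obj.P
local notation "𝖰" => Obj.Q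

/-! ### All diagrams in standard position -/

/-- The numbers of strands after putting a word on the left of strands in standard position. -/
def act : Obj → ℕ × ℕ → ℕ × ℕ
  | .one, a => a
  | .P, a => (a.1, a.2 + 1)
  | .Q, a => (a.1 + 1, a.2)
  | .tensor V W, a => act V (act W a)

/-- Moving the strands of a word into standard position. -/
def ins : ∀ V a, V ⊗ OO a ⟶ OO (act V a)
  | .one, a => (λ_ (OO a)).hom
  | .P, a => κ a.1 (Ps a.2)
  | .Q, a => (ι a.1 (Ps a.2)).hom
  | .tensor V W, a => (α_ V W (OO a)).hom ≫ V ◁ ins W a ≫ ins V (act W a)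

/-- Moving the strands of a word back from standard position. -/
def rem : ∀ V a, OO (act V a) ⟶ V ⊗ OO a
  | .one, a => (λ_ (OO a)).inv
  | .P, a => κr a.1 (Ps a.2)
  | .Q, a => (ι a.1 (Ps a.2)).inv
  | .tensor V W, a => rem V (act W a) ≫ V ◁ rem W a ≫ (α_ V W (OO a)).inv

theorem ins_rem (V : Obj) (a : ℕ × ℕ) : ins V a ≫ rem V a = 𝟙 _ := by
  induction V generalizing a with
  | one => exact (λ_ (OO a)).hom_inv_id
  | P => exact κ_κr _ _
  | Q => exact (ι a.1 (Ps a.2)).hom_inv_id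
  | tensor V W hV hW =>
    change ((α_ V W (OO a)).hom ≫ V ◁ ins W a ≫ ins V (act W a)) ≫
      rem V (act W a) ≫ V ◁ rem W a ≫ (α_ V W (OO a)).inv = _
    simp only [Category.assoc]
    rw [reassoc_of% hV, ← whiskerLeft_comp_assoc, hW, whiskerLeft_id, Category.id_comp,
      Iso.hom_inv_id]
    rfl

theorem Word.conj (V : Obj) {a b : ℕ × ℕ} {f : OO a ⟶ OO b} (hf : Word a b f) :
    Word (act V a) (act V b) (rem V a ≫ V ◁ f ≫ ins V b) := by
  induction V generalizing a b with
  | one =>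
    refine (congrArg (Word a b) ?_).mpr hf
    change (λ_ (OO a)).inv ≫ 𝟙_ Obj ◁ f ≫ (λ_ (OO b)).hom = f
    simp
  | P => exact hf.conjP
  | Q => exact hf.conjQ
  | tensor V W hV hW =>
    refine (congrArg (Word (act V (act W a)) (act V (act W b))) ?_).mpr (hV (hW hf))
    change (rem V (act W a) ≫ V ◁ rem W a ≫ (α_ V W (OO a)).inv) ≫ (V ⊗ W) ◁ f ≫
      (α_ V W (OO b)).hom ≫ V ◁ ins W b ≫ ins V (act W b) = _
    simp

/-- The morphisms that are words in standard position. -/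
def Standard {V W : Obj} (f : V ⟶ W) : Prop :=
  ∀ a, Word (act V a) (act W a) (rem V a ≫ f ▷ OO a ≫ ins W a)

theorem Word.rem_ins (V : Obj) (a : ℕ × ℕ) : Word (act V a) (act V a) (rem V a ≫ ins V a) := by
  have h := (Word.id a).conj V
  rwa [whiskerLeft_id, Category.id_comp] at h

section

variable {V W V' W' : Obj}

theorem Standard.id (V : Obj) : Standard (𝟙 V) := by
  intro a
  rw [id_whiskerRight, Category.id_comp]
  exact Word.rem_ins V a

theorem Standard.comp {f : V ⟶ W} {g : W ⟶ V'} (hf : Standard f) (hg : Standard g) :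
    Standard (f ≫ g) := by
  intro a
  have h : (rem V a ≫ f ▷ OO a ≫ ins W a) ≫ rem W a ≫ g ▷ OO a ≫ ins V' a =
      rem V a ≫ (f ≫ g) ▷ OO a ≫ ins V' a := by
    simp only [Category.assoc, comp_whiskerRight]
    rw [reassoc_of% ins_rem]
  exact h ▸ (hf a).comp (hg a)

theorem Standard.add {f g : V ⟶ W} (hf : Standard f) (hg : Standard g) : Standard (f + g) := by
  intro a
  rw [MonoidalPreadditive.add_whiskerRight, Preadditive.add_comp, Preadditive.comp_add]
  exact (hf a).add (hg a)

theorem Standard.smul (r : ℂ) {f : V ⟶ W} (hf : Standard f) : Standard (r • f) := by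
  intro a
  rw [MonoidalLinear.smul_whiskerRight, Linear.smul_comp, Linear.comp_smul]
  exact (hf a).smul r

theorem Standard.zero (V W : Obj) : Standard (0 : V ⟶ W) := by
  intro a
  rw [MonoidalPreadditive.zero_whiskerRight, Limits.zero_comp, Limits.comp_zero]
  exact Word.zero _ _

/-- By the interchange law `g` acts first next to the standard strands, then `f` next to what `g`
has produced; the first step is a conjugation by `V`, covered by `Word.conj`. -/
theorem Standard.tensor {f : V ⟶ V'} {g : W ⟶ W'} (hf : Standard f) (hg : Standard g) :
    Standard (f ⊗ₘ g) := by
  intro a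
  have h : (rem V (act W a) ≫ V ◁ (rem W a ≫ g ▷ OO a ≫ ins W' a) ≫ ins V (act W' a)) ≫
      rem V (act W' a) ≫ f ▷ OO (act W' a) ≫ ins V' (act W' a) =
      (rem V (act W a) ≫ V ◁ rem W a ≫ (α_ V W (OO a)).inv) ≫ (f ⊗ₘ g) ▷ OO a ≫
        (α_ V' W' (OO a)).hom ≫ V' ◁ ins W' a ≫ ins V' (act W' a) := by
    simp only [Category.assoc, whiskerLeft_comp]
    rw [reassoc_of% ins_rem, MonoidalCategory.tensorHom_def' f g, comp_whiskerRight]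
    simp only [Category.assoc]
    rw [associator_naturality_left_assoc, ← whisker_exchange_assoc]
    simp
  exact (congrArg (Word _ _) h).mp (((hg a).conj V).comp (hf (act W' a)))

/-- `act` forgets bracketing and units, so the structural isomorphisms become identities in standard
position up to the word `rem ≫ ins`. -/
theorem rem_assoc (V W Z : Obj) (a : ℕ × ℕ) :
    rem ((V ⊗ W) ⊗ Z) a ≫ (α_ V W Z).hom ▷ OO a = rem (V ⊗ W ⊗ Z) a := by
  change ((rem V (act W (act Z a)) ≫ V ◁ rem W (act Z a) ≫ (α_ V W _).inv) ≫
    (V ⊗ W) ◁ rem Z a ≫ (α_ (V ⊗ W) Z (OO a)).inv) ≫ (α_ V W Z).hom ▷ OO a =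
      rem V (act W (act Z a)) ≫ V ◁ (rem W (act Z a) ≫ W ◁ rem Z a ≫
        (α_ W Z (OO a)).inv) ≫ (α_ V (W ⊗ Z) (OO a)).inv
  simp

theorem rem_lunit (V : Obj) (a : ℕ × ℕ) : rem (𝟙_ Obj ⊗ V) a ≫ (λ_ V).hom ▷ OO a = rem V a := by
  change ((λ_ (OO (act V a))).inv ≫ 𝟙_ Obj ◁ rem V a ≫ (α_ (𝟙_ Obj) V (OO a)).inv) ≫
    (λ_ V).hom ▷ OO a = rem V a
  simp

theorem rem_runit (V : Obj) (a : ℕ × ℕ) : rem (V ⊗ 𝟙_ Obj) a ≫ (ρ_ V).hom ▷ OO a = rem V a := by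
  change (rem V a ≫ V ◁ (λ_ (OO a)).inv ≫ (α_ V (𝟙_ Obj) (OO a)).inv) ≫
    (ρ_ V).hom ▷ OO a = rem V a
  simp

theorem rem_iso_inv {a : ℕ × ℕ} {A : Obj} {r : A ⟶ V ⊗ OO a} {s : A ⟶ W ⊗ OO a} (i : V ≅ W)
    (h : r ≫ i.hom ▷ OO a = s) : s ≫ i.inv ▷ OO a = r := by
  rw [← h, Category.assoc, ← comp_whiskerRight, i.hom_inv_id, id_whiskerRight, Category.comp_id]

theorem Word.of_rem {a : ℕ × ℕ} {f : V ⟶ W} {r : OO (act W a) ⟶ V ⊗ OO a}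
    (h : r ≫ f ▷ OO a = rem W a) :
    Word (act W a) (act W a) (r ≫ f ▷ OO a ≫ ins W a) := by
  rw [← Category.assoc, h]
  exact Word.rem_ins W a

theorem Standard.assoc (V W Z : Obj) : Standard (α_ V W Z).hom := fun a =>
  Word.of_rem (W := V ⊗ W ⊗ Z) (rem_assoc V W Z a)

theorem Standard.assocInv (V W Z : Obj) : Standard (α_ V W Z).inv := fun a =>
  Word.of_rem (W := (V ⊗ W) ⊗ Z) (rem_iso_inv (α_ V W Z) (rem_assoc V W Z a))

theorem Standard.lunit (V : Obj) : Standard (λ_ V).hom := fun a => Word.of_rem (W := V) (rem_lunit V a)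

theorem Standard.lunitInv (V : Obj) : Standard (λ_ V).inv := fun a =>
  Word.of_rem (W := 𝟙_ Obj ⊗ V) (rem_iso_inv (λ_ V) (rem_lunit V a))

theorem Standard.runit (V : Obj) : Standard (ρ_ V).hom := fun a => Word.of_rem (W := V) (rem_runit V a)

theorem Standard.runitInv (V : Obj) : Standard (ρ_ V).inv := fun a =>
  Word.of_rem (W := V ⊗ 𝟙_ Obj) (rem_iso_inv (ρ_ V) (rem_runit V a))

end

theorem Standard.crossing : Standard crossingHom := by
  rintro ⟨m, n⟩
  have h := (Word.rem_ins (𝖯 ⊗ 𝖯) (m, n)).comp (Word.S m n)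
  refine (congrArg (Word (m, n + 2) (m, n + 2)) ?_).mpr h
  have e {A B C : Obj} (r : A ⟶ 𝖯 ⊗ 𝖯 ⊗ B) (i : 𝖯 ⊗ 𝖯 ⊗ B ⟶ C) (s : C ⟶ C) (h : S B ≫ i = i ≫ s) :
      (r ≫ (α_ 𝖯 𝖯 B).inv) ≫ crossingHom ▷ B ≫ (α_ 𝖯 𝖯 B).hom ≫ i =
        ((r ≫ (α_ 𝖯 𝖯 B).inv) ≫ (α_ 𝖯 𝖯 B).hom ≫ i) ≫ s := by
    simp only [Category.assoc, Iso.inv_hom_id_assoc]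
    rw [← h, S]
    simp only [Category.assoc]
  refine Eq.trans ?_ ((e (κr m (𝖯 ⊗ Ps n) ≫ 𝖯 ◁ κr m (Ps n)) (𝖯 ◁ κ m (Ps n) ≫ κ m (𝖯 ⊗ Ps n))
    ((F m).map (S (Ps n))) (S_κ_κ m (Ps n))).trans ?_)
  · rw [Category.assoc (κr m (𝖯 ⊗ Ps n))]
    rfl
  · rw [Category.assoc (κr m (𝖯 ⊗ Ps n))]
    rfl

theorem Standard.cupQP : Standard cupQPHom := by
  rintro ⟨m, n⟩
  refine (congrArg (Word (m, n) (m + 1, n + 1)) ?_).mpr (Word.cupQP m n)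
  rw [η, Category.assoc, Category.assoc]
  rfl

theorem Standard.cupPQ : Standard cupPQHom := by
  rintro ⟨m, n⟩
  refine (congrArg (Word (m, n) (m + 1, n + 1)) ?_).mpr (Word.cupPQ m n)
  rw [η', Category.assoc, Category.assoc]
  rfl

theorem Standard.capQP : Standard capQPHom := by
  rintro ⟨m, n⟩
  refine (congrArg (Word (m + 1, n + 1) (m, n)) ?_).mpr (Word.capQP m n)
  have e {A B C D E G : Obj} (f : A ⟶ B) (g : B ⟶ C) (h : C ⟶ D) (k : D ⟶ E) (l : E ⟶ G) :
      (f ≫ g ≫ h) ≫ k ≫ l = f ≫ g ≫ h ≫ k ≫ l := by simp only [Category.assoc]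
  exact e _ _ _ _ _

theorem Standard.capPQ : Standard capPQHom := by
  rintro ⟨m, n⟩
  refine (congrArg (Word (m + 1, n + 1) (m, n)) ?_).mpr (Word.capPQ m n)
  have e {A B C D E G : Obj} (f : A ⟶ B) (g : B ⟶ C) (h : C ⟶ D) (k : D ⟶ E) (l : E ⟶ G) :
      (f ≫ g ≫ h) ≫ k ≫ l = f ≫ g ≫ h ≫ k ≫ l := by simp only [Category.assoc]
  exact e _ _ _ _ _

theorem standard_mk {V W : Obj} (f : Diag V W) : Standard (mk f : V ⟶ W) := by
  induction f with
  | ident V => exact Standard.id V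
  | comp f g hf hg => exact hf.comp hg
  | tens f g hf hg => exact hf.tensor hg
  | assoc V W Z => exact Standard.assoc V W Z
  | assocInv V W Z => exact Standard.assocInv V W Z
  | lunit V => exact Standard.lunit V
  | lunitInv V => exact Standard.lunitInv V
  | runit V => exact Standard.runit V
  | runitInv V => exact Standard.runitInv V
  | zero V W => exact Standard.zero V W
  | add f g hf hg => exact hf.add hg
  | smul r f hf => exact hf.smul r
  | crossing => exact Standard.crossing
  | cupQP => exact Standard.cupQP
  | capQP => exact Standard.capQP
  | cupPQ => exact Standard.cupPQ
  | capPQ => exact Standard.capPQ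

/-- Standard position is taken relative to the empty word `(0, 0)`. Since `ins ≫ rem = 𝟙`, cyclicity
shows that passing to standard position does not change the class. -/
theorem cls_mem_genAlg {V : Obj} (f : V ⟶ V) : cls f ∈ genAlg := by
  have h1 : cls f = cls (f ▷ 𝟙_ Obj) :=
    cls_conj (ρ_ V).symm f (f ▷ 𝟙_ Obj) (rightUnitor_inv_naturality f)
  have h2 : Standard f := HomSpace.ind (p := fun f : V ⟶ V => Standard f) standard_mk f
  have h3 := (h2 (0, 0)).normal.cls_mem
  rw [h1]
  have h4 : cls (rem V (0, 0) ≫ f ▷ OO (0, 0) ≫ ins V (0, 0)) = cls (f ▷ OO (0, 0)) := by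
    rw [cls_comm, Category.assoc, ins_rem, Category.comp_id]
  exact h4 ▸ h3

theorem genAlg_eq_top : genAlg = ⊤ := by
  refine Algebra.eq_top_iff.2 fun x => ?_
  exact TrH_induction (p := (· ∈ genAlg)) (zero_mem _) (fun _ _ => add_mem)
    (fun _ f => cls_mem_genAlg f) x

end Heis

end

theorem mainTheorem8 :
    Algebra.adjoin ℂ ({Heis.hNegOne, Heis.hOne, Heis.c 0 + Heis.c 1} : Set Heis.TrH) = ⊤ := by
  exact Heis.genAlg_eq_top
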